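/- **Setting.** For $(t,x)\in\mathbb R\times\mathbb R$ consider the system $$\partial_t^2\Lambda-\partial_x^2\Lambda=-2\sinh(2\Lambda)\big((\partial_x\phi)^2-(\partial_t\phi)^2\big),\qquad \partial_t^2\phi-\partial_x^2\phi=-\frac{\sinh(2\Lambda)}{\sinh^2\Lambda}\big(\partial_t\phi\,\partial_t\Lambda-\partial_x\phi\,\partial_x\Lambda\big).\tag{PCF}$$ A *global solution* is a pair $\Lambda,\phi\in C^2(\mathbb R\times\mathbb R)$ with $\Lambda\neq0$ everywhere that satisfies (PCF) everywhere. Let $\theta,\sigma\in C^2_c(\mathbb R)$, $\lambda>0$, $\mu>0$ with $\mu\ne1$, and put $$v_\mu=-\frac{\mu^2+1}{2\mu},\qquad \sqrt c:=\frac{2\mu}{\mu^2-1}\ (\text{signed}),\qquad \beta=\frac{\mu+1}{\mu-1}.$$ For $\varepsilon>0$ let $\gamma_1=\lambda+\varepsilon\theta(x+t)$, $\gamma_2=\varepsilon\sigma(x-t)$, $\gamma=\gamma_1+\gamma_2$, $Y=\beta\gamma_1+\beta^{-1}\gamma_2$. The 1-soliton is $$B=\operatorname{arcosh}\Big(|v_\mu|\cosh\gamma-\tfrac1{\sqrt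 c}\tanh Y\,\sinh\gamma\Big),\qquad D=\frac\pi4-\frac12\arctan\Big(\cosh Y\cosh\gamma\,\big[\tanh Y+v_\mu\sqrt c\,\tanh\gamma\big]\Big).$$ For $z_0,w_0,s_0,m_0\in C_c^\infty(\mathbb R)$ consider the data at $t=0$ $$(\Lambda,\partial_t\Lambda,\phi,\partial_t\phi)|_{t=0}=(B+\varepsilon z_0,\ \partial_tB+\varepsilon w_0,\ D+\varepsilon s_0,\ \partial_tD+\varepsilon m_0)|_{t=0},\tag{ID}$$ and write the corresponding solution as $(\Lambda,\partial_t\Lambda,\phi,\partial_t\phi)=(B+z,\ \partial_tB+w,\ D+s,\ \partial_tD+m)$, so that $w=z_t$, $m=s_t$. For $0<\eta<\frac13$ put $\varphi(r)=(1+|r|^2)^{1+\eta}$, $u=\frac{t-x}2$, $\underline u=\frac{t+x}2$, $L=\partial_t+\partial_x$, $\underline L=\partial_t-\partial_x$, and $$\mathcal E(t)=\sum_{k=0,1}\int_{\mathbb R}\Big[\varphi(u)|\underline L\partial_x^kz|^2+\varphi(\underline u)|L\partial_x^kz|^2\Big](t,x)\,dx,$$ $$\overline{\mathcal E}(t)=\sum_{k=0,1}\int_{\mathbb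 R}\Big[\varphi(u)|\underline L\partial_x^ks|^2+\varphi(\underline u)|L\partial_x^ks|^2\Big](t,x)\,dx.$$ **Theorem.** Fix $\theta,\sigma,\lambda,\mu$ as above. (1) *External energetic control.* For every $M>0$ there is $\varepsilon_0>0$ such that for all $0<\varepsilon<\varepsilon_0$ there is $\delta_0>0$ with the following property. Let $0<\delta<\delta_0$ and let $z_0,w_0,s_0,m_0\in C_c^\infty(\mathbb R)$ be supported in $[-M,M]$ with $$\int_{\mathbb R}\Big(\tfrac12(w_0^2+z_{0,x}^2)+2\sinh^2(B(0,x)+z_0)(s_{0,x}^2+m_0^2)\Big)dx<\delta .$$ Then (ID) has a unique global solution, and: * for all $t\in\mathbb R$, $\displaystyle\int_{\mathbb R}\Big(\tfrac12(z_x-w)^2+2\sinh^2(B+z)(s_x-m)^2\Big)(t,x)\,dx<3\delta$; * for every $\nu\in(-1,1)$, with $\omega(t)=t/\log^2t$, $$\lim_{t\to+\infty}\int_{\nu t-\omega(t)}^{\nu t+\omega(t)}\Big(w^2+z_x^2+\sinh^2(B+z)(m^2+s_x^2)\Big)(t,x)\,dx=0;$$ * for every $R>0$ with $\operatorname{supp}\theta'\cup\operatorname{supp}\sigma'\subset(-R,R)$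 and all $t\ge0$, $$\int_{|x+t|\ge R}\Big(\tfrac12(w^2+z_x^2)+2\sinh^2(B+z)(s_x^2+m^2)\Big)(t,x)\,dx<\delta.$$ (2) *Full orbital stability.* There is $\varepsilon_0>0$ such that for all $0<\varepsilon<\varepsilon_0$ there are $C,\delta_0>0$ with the following property. Let $0<\delta<\delta_0$, $0<\eta<\frac13$, and let $z_0,w_0,s_0,m_0\in C_c^\infty(\mathbb R)$ satisfy $$\sum_{k=0,1}\int_{\mathbb R}(1+|x|^2)^{1+\eta}\Big((\partial_x^kw_0)^2+(\partial_x^{k+1}z_0)^2+(\partial_x^km_0)^2+(\partial_x^{k+1}s_0)^2\Big)dx<\delta^2 .$$ Then (ID) has a unique global solution, and $\displaystyle\sup_{t\ge0}\big(\mathcal E(t)+\overline{\mathcal E}(t)\big)\le C\delta^2$. -/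

import Mathlib

open MeasureTheory Filter Set
open scoped ContDiff Topology ENNReal

noncomputable section

namespace PCF

/-! Fields on `ℝ × ℝ` are functions `f : ℝ → ℝ → ℝ`, written `f t x`. -/

/-- The time derivative `∂ₜ f`. -/
def pdt (f : ℝ → ℝ → ℝ) (t x : ℝ) : ℝ := deriv (fun τ => f τ x) t

/-- The space derivative `∂ₓ f`. -/
def pdx (f : ℝ → ℝ → ℝ) (t x : ℝ) : ℝ := deriv (fun y => f t y) x

/-- A global classical solution `(Λ, φ)` of the PCF system. The field `Λ` does not vanish, so that
the quotient in the second equation is a genuine one. -/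
structure IsGlobalSolution (Λ φ : ℝ → ℝ → ℝ) : Prop where
  contDiff_left : ContDiff ℝ 2 (Function.uncurry Λ)
  contDiff_right : ContDiff ℝ 2 (Function.uncurry φ)
  ne_zero : ∀ t x, Λ t x ≠ 0
  eq_left : ∀ t x, pdt (pdt Λ) t x - pdx (pdx Λ) t x =
    -2 * Real.sinh (2 * Λ t x) * ((pdx φ t x) ^ 2 - (pdt φ t x) ^ 2)
  eq_right : ∀ t x, pdt (pdt φ) t x - pdx (pdx φ) t x =
    -(Real.sinh (2 * Λ t x) / Real.sinh (Λ t x) ^ 2) *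
      (pdt φ t x * pdt Λ t x - pdx φ t x * pdx Λ t x)

/-! ### The soliton -/

/-- The speed parameter `v = -(μ² + 1) / (2μ)`. -/
def speed (μ : ℝ) : ℝ := -(μ ^ 2 + 1) / (2 * μ)

/-- The root `√c = 2μ / (μ² - 1)` of `c = (2μ / (μ² - 1))²`; it has the sign of `μ - 1`. -/
def sqrtc (μ : ℝ) : ℝ := 2 * μ / (μ ^ 2 - 1)

/-- The parameter `β = (μ + 1) / (μ - 1)`. -/
def beta (μ : ℝ) : ℝ := (μ + 1) / (μ - 1)

/-- `γ₁ = λ + ε θ(x + t)`. -/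
def gamma1 (θ : ℝ → ℝ) (lam ε t x : ℝ) : ℝ := lam + ε * θ (x + t)

/-- `γ₂ = ε σ(x - t)`. -/
def gamma2 (σ : ℝ → ℝ) (ε t x : ℝ) : ℝ := ε * σ (x - t)

/-- The seed `γ = γ₁ + γ₂ = λ + ε (θ(x + t) + σ(x - t))`. -/
def seed (θ σ : ℝ → ℝ) (lam ε t x : ℝ) : ℝ := gamma1 θ lam ε t x + gamma2 σ ε t x

/-- The phase `β γ₁ + β⁻¹ γ₂`. -/
def phase (θ σ : ℝ → ℝ) (μ lam ε t x : ℝ) : ℝ :=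
  beta μ * gamma1 θ lam ε t x + (beta μ)⁻¹ * gamma2 σ ε t x

/-- The first component `B` of the 1-soliton. -/
def solitonB (θ σ : ℝ → ℝ) (μ lam ε t x : ℝ) : ℝ :=
  Real.arcosh (|speed μ| * Real.cosh (seed θ σ lam ε t x)
    - 1 / sqrtc μ * Real.tanh (phase θ σ μ lam ε t x) * Real.sinh (seed θ σ lam ε t x))

/-- The second component `D` of the 1-soliton. -/
def solitonD (θ σ : ℝ → ℝ) (μ lam ε t x : ℝ) : ℝ :=
  Real.pi / 4 - 1 / 2 * Real.arctan
    (Real.cosh (phase θ σ μ lam ε t x) * Real.cosh (seed θ σ lam ε t x) *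
      (Real.tanh (phase θ σ μ lam ε t x) +
        speed μ * sqrtc μ * Real.tanh (seed θ σ lam ε t x)))

/-! ### Perturbations -/

/-- Smooth compactly supported perturbation profiles `[z₀, w₀, s₀, m₀]`. -/
structure IsProfile (z₀ w₀ s₀ m₀ : ℝ → ℝ) : Prop where
  smooth_z : ContDiff ℝ ∞ z₀
  smooth_w : ContDiff ℝ ∞ w₀
  smooth_s : ContDiff ℝ ∞ s₀
  smooth_m : ContDiff ℝ ∞ m₀
  supp_z : HasCompactSupport z₀
  supp_w : HasCompactSupport w₀
  supp_s : HasCompactSupport s₀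
  supp_m : HasCompactSupport m₀

/-- `(Λ, φ)` has at `t = 0` the data `(B + ε z₀, Bₜ + ε w₀, D + ε s₀, Dₜ + ε m₀)`. -/
structure HasPerturbedData (B D : ℝ → ℝ → ℝ) (ε : ℝ) (z₀ w₀ s₀ m₀ : ℝ → ℝ)
    (Λ φ : ℝ → ℝ → ℝ) : Prop where
  left : ∀ x, Λ 0 x = B 0 x + ε * z₀ x
  left_t : ∀ x, pdt Λ 0 x = pdt B 0 x + ε * w₀ x
  right : ∀ x, φ 0 x = D 0 x + ε * s₀ x
  right_t : ∀ x, pdt φ 0 x = pdt D 0 x + ε * m₀ x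

/-- `(Λ, φ)` is the one and only global solution with the given perturbed data. -/
def IsTheSolution (B D : ℝ → ℝ → ℝ) (ε : ℝ) (z₀ w₀ s₀ m₀ : ℝ → ℝ)
    (Λ φ : ℝ → ℝ → ℝ) : Prop :=
  IsGlobalSolution Λ φ ∧ HasPerturbedData B D ε z₀ w₀ s₀ m₀ Λ φ ∧
    ∀ Λ' φ', IsGlobalSolution Λ' φ' → HasPerturbedData B D ε z₀ w₀ s₀ m₀ Λ' φ' →
      Λ' = Λ ∧ φ' = φ

/-- The localized energy density of the profiles,
`½ (w₀² + z₀ₓ²) + 2 sinh²(B + z₀) (s₀ₓ² + m₀²)` at time `0`. -/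
def profileDensity (B : ℝ → ℝ → ℝ) (z₀ w₀ s₀ m₀ : ℝ → ℝ) (x : ℝ) : ℝ :=
  1 / 2 * ((w₀ x) ^ 2 + (deriv z₀ x) ^ 2) +
    2 * Real.sinh (B 0 x + z₀ x) ^ 2 * ((deriv s₀ x) ^ 2 + (m₀ x) ^ 2)

/-- The crossed density `½ (zₓ - w)² + 2 sinh²(B + z) (sₓ - m)²`, with `w = zₜ`, `m = sₜ`. -/
def crossedDensity (B z s : ℝ → ℝ → ℝ) (t x : ℝ) : ℝ :=
  1 / 2 * (pdx z t x - pdt z t x) ^ 2 +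
    2 * Real.sinh (B t x + z t x) ^ 2 * (pdx s t x - pdt s t x) ^ 2

/-- The density `w² + zₓ² + sinh²(B + z) (m² + sₓ²)`, with `w = zₜ`, `m = sₜ`. -/
def coneDensity (B z s : ℝ → ℝ → ℝ) (t x : ℝ) : ℝ :=
  (pdt z t x) ^ 2 + (pdx z t x) ^ 2 +
    Real.sinh (B t x + z t x) ^ 2 * ((pdt s t x) ^ 2 + (pdx s t x) ^ 2)

/-- The localized energy density `½ (w² + zₓ²) + 2 sinh²(B + z) (sₓ² + m²)`,
with `w = zₜ`, `m = sₜ`. -/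
def energyDensity (B z s : ℝ → ℝ → ℝ) (t x : ℝ) : ℝ :=
  1 / 2 * ((pdt z t x) ^ 2 + (pdx z t x) ^ 2) +
    2 * Real.sinh (B t x + z t x) ^ 2 * ((pdx s t x) ^ 2 + (pdt s t x) ^ 2)

/-! ### Weighted energies -/

/-- The weight `(1 + |r|²)^(1 + η)`. -/
def weight (η r : ℝ) : ℝ := (1 + |r| ^ 2) ^ (1 + η)

/-- The null derivative `L = ∂ₜ + ∂ₓ`. -/
def nullL (f : ℝ → ℝ → ℝ) (t x : ℝ) : ℝ := pdt f t x + pdx f t x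

/-- The null derivative `∂ₜ - ∂ₓ`. -/
def nullLbar (f : ℝ → ℝ → ℝ) (t x : ℝ) : ℝ := pdt f t x - pdx f t x

/-- The weighted energy of order `k` at time `t`, with the null coordinates `(t - x) / 2` and
`(t + x) / 2`. -/
def nullEnergyOrder (η : ℝ) (k : ℕ) (ψ : ℝ → ℝ → ℝ) (t : ℝ) : ℝ≥0∞ :=
  ∫⁻ x, ENNReal.ofReal
    (weight η ((t - x) / 2) * |nullLbar (pdx^[k] ψ) t x| ^ 2 +
      weight η ((t + x) / 2) * |nullL (pdx^[k] ψ) t x| ^ 2)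

/-- The total weighted energy, orders `0` and `1`. -/
def nullEnergy (η : ℝ) (ψ : ℝ → ℝ → ℝ) (t : ℝ) : ℝ≥0∞ :=
  nullEnergyOrder η 0 ψ t + nullEnergyOrder η 1 ψ t

/-- The weighted size of the profiles,
`∑ₖ ∫ (1 + |x|²)^(1 + η) ((∂ᵏ w₀)² + (∂ᵏ⁺¹ z₀)² + (∂ᵏ m₀)² + (∂ᵏ⁺¹ s₀)²)` over `k = 0, 1`. -/
def profileSize (η : ℝ) (z₀ w₀ s₀ m₀ : ℝ → ℝ) : ℝ≥0∞ :=
  ∑ k ∈ Finset.range 2, ∫⁻ x, ENNReal.ofReal (weight η x *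
    ((iteratedDeriv k w₀ x) ^ 2 + (iteratedDeriv (k + 1) z₀ x) ^ 2 +
      (iteratedDeriv k m₀ x) ^ 2 + (iteratedDeriv (k + 1) s₀ x) ^ 2))

end PCF

end

set_option maxSynthPendingDepth 3

/-! In the null coordinates `w = x - t`, `v = x + t` the system reads `X_wv = N(X)(X_w, X_v)` for `X
= (Λ, φ)`, with `N` bilinear in the first derivatives and smooth where `Λ > 0`; the line `t = 0`
becomes the diagonal `w = v`. Each term of the source contains one `w`-derivative and one
`v`-derivative. Hence `X_v` varies along a line `v = const` only through an integral of `X_w` in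
`w`, and conversely. If the first derivatives of the data are small in `L¹`, dominated by an
integrable `k`, a contraction on the whole plane gives a global solution with `|X_v| ≤ k(v)` and
`|X_w| ≤ k(w)` (`exists_isNullSolution`). No energy estimate and no continuation in time are
involved.

The soliton is a solution of this kind. As a function of `(γ₁, γ₂)` it solves the null-form equation
(`IsSolitonParam.hasDerivAt_solPsiA`), and bilinearity allows the substitution `γ₁ = λ + ε θ(v)`,
`γ₂ = ε σ(w)`; its null derivatives are then `O(ε)` and integrable. The perturbed data are of the
same kind. Comparing the two solutions and their second derivatives (`IsNullSolution.norm_sub_le`,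
`IsNullSolution.norm_sub_deriv_p_le`) shows that `L z` and `L s` at `(t, x)` are bounded by a
constant times `d(x + t) + D κ(x + t)`. Here `d` is the pointwise size of the first derivatives of
the perturbation, `D` bounds its integral, and `κ` is a fixed profile made of the seeds and a
decaying tail. The other null derivatives obey the same bound at `x - t`, and the second derivatives
a similar one. This is `exists_perturbed_solution`.

The conclusions follow by integration. The energy densities are at most `g(x + t) + g(x - t)`, and
the integral of this bound does not depend on `t`. In part (1) the perturbation carries the factor
`ε`, so `∫ g = O(ε² δ)` and the energy over the whole line stays below `δ` for small `ε`; strictly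
inside the light cone both arguments of `g` tend to infinity. In part (2) the weights in the energy
are dominated by weights at `x ± t`, and the weighted size of the data closes the estimate. The `L¹`
size `D` is obtained from the `L²` hypotheses by Cauchy-Schwarz, using the support in `[-M, M]` in
part (1) and the weight in part (2). -/

namespace PCF

/-! ### Calculus in two variables, and Grönwall's lemma on a square. -/

section Calculus

variable {F : Type*} [NormedAddCommGroup F] [NormedSpace ℝ F]

/-- The solutions are built through their partial derivatives in `w` and `v`; joint
differentiability is what permits differentiation along the diagonal and in the directions `t` and
`x`. -/
theorem hasStrictFDerivAt_of_partials {f f₁ f₂ : ℝ → ℝ → F}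
    (h₁ : ∀ w v, HasDerivAt (fun y => f y v) (f₁ w v) w)
    (h₂ : ∀ w v, HasDerivAt (fun y => f w y) (f₂ w v) v)
    (c₁ : Continuous (Function.uncurry f₁)) (c₂ : Continuous (Function.uncurry f₂)) (u : ℝ × ℝ) :
    HasStrictFDerivAt (Function.uncurry f)
      ((ContinuousLinearMap.toSpanSingleton ℝ (f₁ u.1 u.2)).coprod
        (ContinuousLinearMap.toSpanSingleton ℝ (f₂ u.1 u.2))) u := by
  have hc : Continuous (fun x : F => ContinuousLinearMap.toSpanSingleton ℝ x) :=
    (ContinuousLinearMap.toSpanSingletonCLE (𝕜 := ℝ) (E := F)).continuous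
  exact hasStrictFDerivAt_uncurry_coprod (f := f)
    (f₁ := fun w v => ContinuousLinearMap.toSpanSingleton ℝ (f₁ w v))
    (f₂ := fun w v => ContinuousLinearMap.toSpanSingleton ℝ (f₂ w v))
    (Eventually.of_forall fun v => (h₁ v.1 v.2).hasFDerivAt)
    (Eventually.of_forall fun v => (h₂ v.1 v.2).hasFDerivAt)
    (hc.comp c₁).continuousAt (hc.comp c₂).continuousAt

theorem contDiff_one_of_partials {f f₁ f₂ : ℝ → ℝ → F}
    (h₁ : ∀ w v, HasDerivAt (fun y => f y v) (f₁ w v) w)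
    (h₂ : ∀ w v, HasDerivAt (fun y => f w y) (f₂ w v) v)
    (c₁ : Continuous (Function.uncurry f₁)) (c₂ : Continuous (Function.uncurry f₂)) :
    ContDiff ℝ 1 (Function.uncurry f) := by
  rw [contDiff_one_iff_fderiv]
  refine ⟨fun u => (hasStrictFDerivAt_of_partials h₁ h₂ c₁ c₂ u).hasFDerivAt.differentiableAt, ?_⟩
  have hc : Continuous (fun x : F => ContinuousLinearMap.toSpanSingleton ℝ x) :=
    (ContinuousLinearMap.toSpanSingletonCLE (𝕜 := ℝ) (E := F)).continuous
  have : fderiv ℝ (Function.uncurry f) = fun u =>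
      ((ContinuousLinearMap.toSpanSingleton ℝ (f₁ u.1 u.2)).coprod
        (ContinuousLinearMap.toSpanSingleton ℝ (f₂ u.1 u.2))) :=
    funext fun u => (hasStrictFDerivAt_of_partials h₁ h₂ c₁ c₂ u).hasFDerivAt.fderiv
  rw [this]
  have e : (fun u : ℝ × ℝ => ((ContinuousLinearMap.toSpanSingleton ℝ (f₁ u.1 u.2)).coprod
        (ContinuousLinearMap.toSpanSingleton ℝ (f₂ u.1 u.2)))) = fun u =>
      (ContinuousLinearMap.toSpanSingleton ℝ (f₁ u.1 u.2)).comp (ContinuousLinearMap.fst ℝ ℝ ℝ) +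
      (ContinuousLinearMap.toSpanSingleton ℝ (f₂ u.1 u.2)).comp
        (ContinuousLinearMap.snd ℝ ℝ ℝ) := by
    ext u <;> simp
  rw [e]
  exact ((hc.comp c₁).clm_comp continuous_const).add ((hc.comp c₂).clm_comp continuous_const)

theorem contDiff_two_of_partials {f f₁ f₂ : ℝ → ℝ → F}
    (h₁ : ∀ w v, HasDerivAt (fun y => f y v) (f₁ w v) w)
    (h₂ : ∀ w v, HasDerivAt (fun y => f w y) (f₂ w v) v)
    (c₁ : ContDiff ℝ 1 (Function.uncurry f₁)) (c₂ : ContDiff ℝ 1 (Function.uncurry f₂)) :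
    ContDiff ℝ 2 (Function.uncurry f) := by
  have h2 : (2 : WithTop ℕ∞) = 1 + 1 := by norm_num
  rw [h2, contDiff_succ_iff_fderiv]
  refine ⟨fun u => (hasStrictFDerivAt_of_partials h₁ h₂ c₁.continuous c₂.continuous
    u).hasFDerivAt.differentiableAt, by simp, ?_⟩
  have : fderiv ℝ (Function.uncurry f) = fun u =>
      (ContinuousLinearMap.toSpanSingletonCLE (𝕜 := ℝ) (E := F)
        (Function.uncurry f₁ u)).comp (ContinuousLinearMap.fst ℝ ℝ ℝ) +
      (ContinuousLinearMap.toSpanSingletonCLE (𝕜 := ℝ) (E := F)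
        (Function.uncurry f₂ u)).comp (ContinuousLinearMap.snd ℝ ℝ ℝ) := by
    funext u
    rw [(hasStrictFDerivAt_of_partials h₁ h₂ c₁.continuous c₂.continuous u).hasFDerivAt.fderiv]
    ext <;> simp [Function.uncurry]
  rw [this]
  exact (((ContinuousLinearEquiv.contDiff _).comp c₁).clm_comp contDiff_const).add
    (((ContinuousLinearEquiv.contDiff _).comp c₂).clm_comp contDiff_const)

theorem continuous_integral_of_continuous₂ {Y : Type*} [TopologicalSpace Y]
    [FirstCountableTopology Y] [LocallyCompactSpace Y] {f : Y → ℝ → F} {a b : Y → ℝ}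
    (hf : Continuous (Function.uncurry f)) (ha : Continuous a) (hb : Continuous b) :
    Continuous fun x => ∫ y in (a x)..(b x), f x y := by
  have e : (fun x => ∫ y in (a x)..(b x), f x y) =
      fun x => (∫ y in (0 : ℝ)..(b x), f x y) - ∫ y in (0 : ℝ)..(a x), f x y := by
    funext x
    have hc : Continuous (f x) := hf.comp (by fun_prop : Continuous fun y : ℝ => (x, y))
    rw [intervalIntegral.integral_interval_sub_left] <;> exact hc.intervalIntegrable _ _
  rw [e]
  exact (intervalIntegral.continuous_parametric_intervalIntegral_of_continuous hf hb).sub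
    (intervalIntegral.continuous_parametric_intervalIntegral_of_continuous hf ha)

theorem hasDerivAt_integral_param [CompleteSpace F] {f f₁ : ℝ → ℝ → F}
    (h₁ : ∀ w v, HasDerivAt (fun y => f y v) (f₁ w v) w)
    (c : Continuous (Function.uncurry f)) (c₁ : Continuous (Function.uncurry f₁)) (a b w : ℝ) :
    HasDerivAt (fun x => ∫ y in a..b, f x y) (∫ y in a..b, f₁ w y) w := by
  obtain ⟨M, hM⟩ := ((isCompact_closedBall w 1).prod (isCompact_uIcc (a := a) (b := b))).exists_bound_of_continuousOn
    c₁.continuousOn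
  have cs : ∀ x, Continuous (f x) := fun x => c.comp (by fun_prop : Continuous fun y : ℝ => (x, y))
  have cs₁ : ∀ x, Continuous (f₁ x) :=
    fun x => c₁.comp (by fun_prop : Continuous fun y : ℝ => (x, y))
  refine (intervalIntegral.hasDerivAt_integral_of_dominated_loc_of_deriv_le
    (bound := fun _ => M) (Metric.closedBall_mem_nhds w one_pos)
    (Eventually.of_forall fun x => (cs x).aestronglyMeasurable) ((cs w).intervalIntegrable _ _)
    (cs₁ w).aestronglyMeasurable ?_ intervalIntegrable_const ?_).2
  · exact Eventually.of_forall fun t ht x hx => hM (x, t) ⟨hx, uIoc_subset_uIcc ht⟩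
  · exact Eventually.of_forall fun t _ x _ => h₁ x t

/-- **Leibniz rule** with the parameter as lower endpoint. -/
theorem hasDerivAt_integral_left_param [CompleteSpace F] {f f₁ : ℝ → ℝ → F}
    (h₁ : ∀ w v, HasDerivAt (fun y => f y v) (f₁ w v) w)
    (c : Continuous (Function.uncurry f)) (c₁ : Continuous (Function.uncurry f₁)) (w v : ℝ) :
    HasDerivAt (fun x => ∫ y in x..v, f x y) ((∫ y in w..v, f₁ w y) - f w w) w := by
  have cs : ∀ x, Continuous (f x) := fun x => c.comp (by fun_prop : Continuous fun y : ℝ => (x, y))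
  -- The lower endpoint `s` and the parameter `x` are separated into two variables; the chain rule
  -- along `s = x` adds the two contributions.
  have H := hasStrictFDerivAt_of_partials
    (f := fun s x => ∫ y in s..v, f x y) (f₁ := fun s x => - f x s)
    (f₂ := fun s x => ∫ y in s..v, f₁ x y)
    (fun s x => intervalIntegral.integral_hasDerivAt_left ((cs x).intervalIntegrable _ _)
      ((cs x).stronglyMeasurableAtFilter _ _) (cs x).continuousAt)
    (fun s x => hasDerivAt_integral_param h₁ c c₁ s v x)
    (c.comp continuous_swap).neg
    (continuous_integral_of_continuous₂ (f := fun u : ℝ × ℝ => f₁ u.2) (a := fun u => u.1)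
      (c₁.comp (by fun_prop : Continuous fun p : (ℝ × ℝ) × ℝ => (p.1.2, p.2)))
      continuous_fst continuous_const) (w, w)
  have hd : HasDerivAt (fun x : ℝ => (x, x)) ((1 : ℝ), (1 : ℝ)) w :=
    (hasDerivAt_id w).prodMk (hasDerivAt_id w)
  have := HasFDerivAt.comp_hasDerivAt (f := fun x : ℝ => (x, x)) w H.hasFDerivAt hd
  refine (this.congr_deriv ?_)
  simp [sub_eq_add_neg, add_comm]

theorem norm_intervalIntegral_le_of_le {f : ℝ → F} {g : ℝ → ℝ} {a b : ℝ} (hg : Continuous g)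
    (h : ∀ y ∈ uIcc a b, ‖f y‖ ≤ g y) : ‖∫ y in a..b, f y‖ ≤ |∫ y in a..b, g y| := by
  refine intervalIntegral.norm_integral_le_abs_of_norm_le ?_ (hg.intervalIntegrable _ _)
  rw [ae_restrict_iff' measurableSet_uIoc]
  exact Eventually.of_forall fun y hy => h y (uIoc_subset_uIcc hy)

/-- Extending the integral of the dominating function to the whole line makes the bound uniform in
the endpoints. All later estimates are global in time for this reason. -/
theorem norm_intervalIntegral_le_integral {f : ℝ → F} {k : ℝ → ℝ} {a b c : ℝ} (hk : Integrable k)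
    (hk0 : ∀ y, 0 ≤ k y) (hc : 0 ≤ c) (h : ∀ y ∈ uIcc a b, ‖f y‖ ≤ c * k y) :
    ‖∫ y in a..b, f y‖ ≤ c * ∫ y, k y := by
  have hk' : Integrable (fun y => c * k y) := hk.const_mul c
  calc ‖∫ y in a..b, f y‖ ≤ |∫ y in a..b, c * k y| := by
        refine intervalIntegral.norm_integral_le_abs_of_norm_le ?_ hk'.intervalIntegrable
        rw [ae_restrict_iff' measurableSet_uIoc]
        exact Eventually.of_forall fun y hy => h y (uIoc_subset_uIcc hy)
    _ = ∫ y in uIoc a b, c * k y := by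
        rw [intervalIntegral.abs_integral_eq_abs_integral_uIoc, abs_of_nonneg]
        exact integral_nonneg fun y => mul_nonneg hc (hk0 y)
    _ ≤ ∫ y, c * k y := setIntegral_le_integral hk'
        (Eventually.of_forall fun y => mul_nonneg hc (hk0 y))
    _ = c * ∫ y, k y := integral_const_mul _ _

/-- Integrating the Grönwall weight gains the factor `1 / κ`. -/
theorem abs_integral_exp_abs_sub_le {κ : ℝ} (hκ : 0 < κ) (v w : ℝ) :
    |∫ y in v..w, Real.exp (κ * |y - v|)| ≤ Real.exp (κ * |w - v|) / κ := by
  have hn : 0 ≤ Real.exp (κ * |w - v|) / κ := by positivity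
  rcases le_total v w with h | h
  · have e : ∫ y in v..w, Real.exp (κ * |y - v|) = ∫ y in v..w, Real.exp (κ * (y - v)) := by
      refine intervalIntegral.integral_congr fun y hy => ?_
      rw [uIcc_of_le h] at hy
      simp only [abs_of_nonneg (sub_nonneg.2 hy.1)]
    have hd : ∀ y ∈ uIcc v w, HasDerivAt (fun y => Real.exp (κ * (y - v)) / κ)
        (Real.exp (κ * (y - v))) y := fun y _ => by
      have := ((((hasDerivAt_id y).sub_const v).const_mul κ).exp).div_const κ
      refine this.congr_deriv ?_
      simp; field_simp
    rw [e, intervalIntegral.integral_eq_sub_of_hasDerivAt hd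
      ((by fun_prop : Continuous fun y => Real.exp (κ * (y - v))).intervalIntegrable _ _),
      abs_of_nonneg (sub_nonneg.2 h), sub_self, mul_zero, Real.exp_zero]
    have h1 : 1 / κ ≤ Real.exp (κ * (w - v)) / κ := by
      gcongr; exact Real.one_le_exp (mul_nonneg hκ.le (sub_nonneg.2 h))
    have h2 : 0 < 1 / κ := by positivity
    rw [abs_of_nonneg (by linarith)]; linarith
  · have e : ∫ y in v..w, Real.exp (κ * |y - v|) = ∫ y in v..w, Real.exp (κ * (v - y)) := by
      refine intervalIntegral.integral_congr fun y hy => ?_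
      rw [uIcc_of_ge h] at hy
      simp only [abs_of_nonpos (sub_nonpos.2 hy.2), neg_sub]
    have hd : ∀ y ∈ uIcc v w, HasDerivAt (fun y => - (Real.exp (κ * (v - y)) / κ))
        (Real.exp (κ * (v - y))) y := fun y _ => by
      have := (((((hasDerivAt_id y).const_sub v).const_mul κ).exp).div_const κ).neg
      refine this.congr_deriv ?_
      simp; field_simp
    rw [e, intervalIntegral.integral_eq_sub_of_hasDerivAt hd
      ((by fun_prop : Continuous fun y => Real.exp (κ * (v - y))).intervalIntegrable _ _),
      abs_of_nonpos (sub_nonpos.2 h), sub_self, mul_zero, Real.exp_zero, neg_sub]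
    have h1 : 1 / κ ≤ Real.exp (κ * (v - w)) / κ := by
      gcongr; exact Real.one_le_exp (mul_nonneg hκ.le (sub_nonneg.2 h))
    have h2 : 0 < 1 / κ := by positivity
    rw [abs_of_nonpos (by linarith)]; linarith

/-- **Grönwall's lemma on a square** `[a, b]²`, along the two characteristic directions that lead
back to the diagonal. -/
theorem eq_zero_of_le_integral_diag {a b K : ℝ} (hK : 0 ≤ K) {g : ℝ → ℝ → ℝ}
    (hg : Continuous (Function.uncurry g)) (hpos : ∀ w v, 0 ≤ g w v)
    (h : ∀ w ∈ Icc a b, ∀ v ∈ Icc a b,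
      g w v ≤ K * |∫ y in v..w, g y v| + K * |∫ y in w..v, g w y|) :
    ∀ w ∈ Icc a b, ∀ v ∈ Icc a b, g w v = 0 := by
  intro w₁ hw₁ v₁ hv₁
  -- If `M` is the maximum of `exp(-κ|w - v|) g` over the square, the hypothesis at the maximum
  -- point yields `M ≤ (2K/κ) M`, and this `κ` makes the factor at most `1/2`. The integration paths
  -- run to the diagonal inside the square, so the maximum controls `g` on them.
  set κ := 4 * K + 1 with hκ
  have hκ0 : 0 < κ := by positivity
  have hGc : Continuous fun u : ℝ × ℝ => Real.exp (-(κ * |u.1 - u.2|)) * g u.1 u.2 :=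
    (by fun_prop : Continuous fun u : ℝ × ℝ => Real.exp (-(κ * |u.1 - u.2|))).mul hg
  obtain ⟨u, hu, hmax⟩ := ((isCompact_Icc (a := a) (b := b)).prod isCompact_Icc).exists_isMaxOn
    ⟨(w₁, v₁), hw₁, hv₁⟩ hGc.continuousOn
  obtain ⟨w, v⟩ := u
  obtain ⟨hw, hv⟩ := hu
  simp only at hw hv
  set M := Real.exp (-(κ * |w - v|)) * g w v with hM
  have hb : ∀ w' ∈ Icc a b, ∀ v' ∈ Icc a b, g w' v' ≤ M * Real.exp (κ * |w' - v'|) := by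
    intro w' hw' v' hv'
    have h1 : Real.exp (-(κ * |w' - v'|)) * g w' v' ≤ M := hmax (show (w', v') ∈ _ from ⟨hw', hv'⟩)
    calc g w' v' = Real.exp (-(κ * |w' - v'|)) * g w' v' * Real.exp (κ * |w' - v'|) := by
          rw [mul_right_comm, ← Real.exp_add]; simp
      _ ≤ _ := by gcongr
  have hM0 : 0 ≤ M := mul_nonneg (Real.exp_pos _).le (hpos _ _)
  have hsub : ∀ {x y : ℝ}, x ∈ Icc a b → y ∈ Icc a b → uIcc x y ⊆ Icc a b :=
    fun hx hy => OrdConnected.uIcc_subset ordConnected_Icc hx hy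
  have i1 : |∫ y in v..w, g y v| ≤ M * (Real.exp (κ * |w - v|) / κ) := by
    have := norm_intervalIntegral_le_of_le (f := fun y => g y v)
      (g := fun y => M * Real.exp (κ * |y - v|)) (a := v) (b := w) (by fun_prop)
      (fun y hy => by
        rw [Real.norm_of_nonneg (hpos _ _)]
        exact hb y (hsub hv hw hy) v hv)
    rw [intervalIntegral.integral_const_mul, abs_mul, abs_of_nonneg hM0, Real.norm_eq_abs] at this
    exact this.trans (mul_le_mul_of_nonneg_left (abs_integral_exp_abs_sub_le hκ0 v w) hM0)
  have i2 : |∫ y in w..v, g w y| ≤ M * (Real.exp (κ * |w - v|) / κ) := by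
    have := norm_intervalIntegral_le_of_le (f := fun y => g w y)
      (g := fun y => M * Real.exp (κ * |y - w|)) (a := w) (b := v) (by fun_prop)
      (fun y hy => by
        rw [Real.norm_of_nonneg (hpos _ _), abs_sub_comm]
        exact hb w hw y (hsub hw hv hy))
    rw [intervalIntegral.integral_const_mul, abs_mul, abs_of_nonneg hM0, Real.norm_eq_abs] at this
    rw [abs_sub_comm w v]
    exact this.trans (mul_le_mul_of_nonneg_left (abs_integral_exp_abs_sub_le hκ0 w v) hM0)
  have key : g w v ≤ 2 * K / κ * M * Real.exp (κ * |w - v|) := by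
    calc g w v ≤ K * (M * (Real.exp (κ * |w - v|) / κ)) + K * (M * (Real.exp (κ * |w - v|) / κ)) :=
          (h w hw v hv).trans (by gcongr)
      _ = _ := by ring
  have hMle : M ≤ 2 * K / κ * M := by
    calc M ≤ Real.exp (-(κ * |w - v|)) * (2 * K / κ * M * Real.exp (κ * |w - v|)) := by
          rw [hM]; gcongr
      _ = 2 * K / κ * M * (Real.exp (-(κ * |w - v|)) * Real.exp (κ * |w - v|)) := by ring
      _ = _ := by rw [← Real.exp_add]; simp
  have hlt : 2 * K / κ ≤ 1 / 2 := by rw [div_le_div_iff₀ hκ0 two_pos]; linarith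
  have hMz : M = 0 := by nlinarith
  have := hb w₁ hw₁ v₁ hv₁
  rw [hMz, zero_mul] at this
  exact le_antisymm this (hpos _ _)

end Calculus

section NullSystem

variable {E : Type*} [NormedAddCommGroup E] [NormedSpace ℝ E]

/-! ### Semilinear systems `X_wv = N(X)(X_w, X_v)` in null coordinates -/

/-- A field of bilinear maps `N`, with derivative `N'` on `S`, both bounded and Lipschitz there. -/
structure IsNullForm (N : E → E →L[ℝ] E →L[ℝ] E) (N' : E → E →L[ℝ] E →L[ℝ] E →L[ℝ] E)
    (S : Set E) (C : ℝ) : Prop where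
  one_le : 1 ≤ C
  hasFDerivAt : ∀ x ∈ S, HasFDerivAt N (N' x) x
  norm_le : ∀ x ∈ S, ‖N x‖ ≤ C
  norm_deriv_le : ∀ x ∈ S, ‖N' x‖ ≤ C
  lipschitz : ∀ x ∈ S, ∀ y ∈ S, ‖N x - N y‖ ≤ C * ‖x - y‖
  lipschitz_deriv : ∀ x ∈ S, ∀ y ∈ S, ‖N' x - N' y‖ ≤ C * ‖x - y‖

/-- A classical solution of `X_wv = N(X)(X_w, X_v)`, with `p = X_v` and `q = X_w`. -/
structure IsNullField (N : E → E →L[ℝ] E →L[ℝ] E) (X p q : ℝ → ℝ → E) : Prop where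
  hasDerivAt_right : ∀ w v, HasDerivAt (fun y => X w y) (p w v) v
  hasDerivAt_left : ∀ w v, HasDerivAt (fun y => X y v) (q w v) w
  hasDerivAt_p : ∀ w v, HasDerivAt (fun y => p y v) (N (X w v) (q w v) (p w v)) w
  hasDerivAt_q : ∀ w v, HasDerivAt (fun y => q w y) (N (X w v) (q w v) (p w v)) v
  continuous_p : Continuous (Function.uncurry p)
  continuous_q : Continuous (Function.uncurry q)

/-- A classical solution with values in `S`, where `p = X_v` and `q = X_w` are dominated by `k(v)`
and `k(w)`. -/
structure IsNullSolution (N : E → E →L[ℝ] E →L[ℝ] E) (S : Set E) (k : ℝ → ℝ)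
    (X p q : ℝ → ℝ → E) : Prop extends IsNullField N X p q where
  mem : ∀ w v, X w v ∈ S
  norm_p_le : ∀ w v, ‖p w v‖ ≤ k v
  norm_q_le : ∀ w v, ‖q w v‖ ≤ k w

variable {N : E → E →L[ℝ] E →L[ℝ] E} {N' : E → E →L[ℝ] E →L[ℝ] E →L[ℝ] E} {S : Set E} {C : ℝ}
  {k : ℝ → ℝ} {X p q : ℝ → ℝ → E}

theorem norm_apply_sub_apply_le {F G : Type*} [NormedAddCommGroup F] [NormedSpace ℝ F]
    [NormedAddCommGroup G] [NormedSpace ℝ G] (A B : F →L[ℝ] G) (x y : F) :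
    ‖A x - B y‖ ≤ ‖A - B‖ * ‖x‖ + ‖B‖ * ‖x - y‖ := by
  have e : A x - B y = (A - B) x + B (x - y) := by simp
  rw [e]
  exact (norm_add_le _ _).trans (add_le_add ((A - B).le_opNorm x) (B.le_opNorm _))

theorem norm_apply₂_sub_le (A B : E →L[ℝ] E →L[ℝ] E) (q q' p p' : E) :
    ‖A q p - B q' p'‖ ≤ ‖A - B‖ * ‖q‖ * ‖p‖ + ‖B‖ * ‖q - q'‖ * ‖p‖ + ‖B‖ * ‖q'‖ * ‖p - p'‖ := by
  calc ‖A q p - B q' p'‖ ≤ ‖A q - B q'‖ * ‖p‖ + ‖B q'‖ * ‖p - p'‖ :=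
        norm_apply_sub_apply_le _ _ _ _
    _ ≤ (‖A - B‖ * ‖q‖ + ‖B‖ * ‖q - q'‖) * ‖p‖ + ‖B‖ * ‖q'‖ * ‖p - p'‖ := by
        gcongr
        · exact norm_apply_sub_apply_le _ _ _ _
        · exact B.le_opNorm _
    _ = _ := by ring

theorem IsNullForm.norm_apply_le (hN : IsNullForm N N' S C) {x : E} (hx : x ∈ S) (q p : E) :
    ‖N x q p‖ ≤ C * ‖q‖ * ‖p‖ := by
  refine ((N x).le_opNorm₂ q p).trans ?_
  gcongr
  exact hN.norm_le x hx

theorem IsNullForm.norm_apply_sub_le (hN : IsNullForm N N' S C) {x y : E} (hx : x ∈ S)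
    (hy : y ∈ S) (q q' p p' : E) :
    ‖N x q p - N y q' p'‖ ≤
      C * ‖x - y‖ * ‖q‖ * ‖p‖ + C * ‖q - q'‖ * ‖p‖ + C * ‖q'‖ * ‖p - p'‖ := by
  refine (norm_apply₂_sub_le _ _ _ _ _ _).trans ?_
  gcongr
  · exact hN.lipschitz x hx y hy
  · exact hN.norm_le y hy
  · exact hN.norm_le y hy

theorem IsNullForm.pos (hN : IsNullForm N N' S C) : 0 < C := one_pos.trans_le hN.one_le

theorem IsNullForm.continuousOn (hN : IsNullForm N N' S C) : ContinuousOn N S :=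
  fun x hx => (hN.hasFDerivAt x hx).continuousAt.continuousWithinAt

theorem IsNullForm.continuousOn_deriv (hN : IsNullForm N N' S C) : ContinuousOn N' S := by
  have : LipschitzOnWith ⟨C, hN.pos.le⟩ N' S :=
    LipschitzOnWith.of_dist_le_mul fun x hx y hy => by
      rw [dist_eq_norm, dist_eq_norm]; exact hN.lipschitz_deriv x hx y hy
  exact this.continuousOn

/-- Exchanging `w` and `v` replaces `N` by its flip, with the same constant. Together with
`IsNullSolution.swap` this deduces the estimates for `q` and `X_ww` from those for `p` and `X_vv`.
-/
theorem IsNullForm.flip (hN : IsNullForm N N' S C) :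
    IsNullForm (fun x => (N x).flip)
      (fun x => ((ContinuousLinearMap.flipₗᵢ ℝ E E E).toContinuousLinearEquiv :
        (E →L[ℝ] E →L[ℝ] E) →L[ℝ] (E →L[ℝ] E →L[ℝ] E)).comp (N' x)) S C where
  one_le := hN.one_le
  hasFDerivAt x hx :=
    (((ContinuousLinearMap.flipₗᵢ ℝ E E E).toContinuousLinearEquiv :
      (E →L[ℝ] E →L[ℝ] E) →L[ℝ] (E →L[ℝ] E →L[ℝ] E)).hasFDerivAt).comp x (hN.hasFDerivAt x hx)
  norm_le x hx := by
    rw [ContinuousLinearMap.opNorm_flip]; exact hN.norm_le x hx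
  norm_deriv_le x hx := by
    refine ContinuousLinearMap.opNorm_le_bound _ hN.pos.le fun y => ?_
    have := ((N' x).le_of_opNorm_le (hN.norm_deriv_le x hx) y)
    simpa using this
  lipschitz x hx y hy := by
    have e : (N x).flip - (N y).flip = (N x - N y).flip := by ext; simp
    rw [e, ContinuousLinearMap.opNorm_flip]; exact hN.lipschitz x hx y hy
  lipschitz_deriv x hx y hy := by
    rw [← ContinuousLinearMap.comp_sub]
    refine ContinuousLinearMap.opNorm_le_bound _ (mul_nonneg hN.pos.le (norm_nonneg _))
      fun z => ?_
    have := ((N' x - N' y).le_of_opNorm_le (hN.lipschitz_deriv x hx y hy) z)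
    refine le_trans (le_of_eq ?_) this
    exact (ContinuousLinearMap.flipₗᵢ ℝ E E E).norm_map _

theorem IsNullSolution.swap (h : IsNullSolution N S k X p q) :
    IsNullSolution (fun x => (N x).flip) S k (fun w v => X v w) (fun w v => q v w)
      (fun w v => p v w) where
  hasDerivAt_right w v := h.hasDerivAt_left v w
  hasDerivAt_left w v := h.hasDerivAt_right v w
  hasDerivAt_p w v := h.hasDerivAt_q v w
  hasDerivAt_q w v := h.hasDerivAt_p v w
  continuous_p := h.continuous_q.comp continuous_swap
  continuous_q := h.continuous_p.comp continuous_swap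
  mem w v := h.mem v w
  norm_p_le w v := h.norm_q_le v w
  norm_q_le w v := h.norm_p_le v w

theorem IsNullField.continuous (h : IsNullField N X p q) :
    Continuous (Function.uncurry X) :=
  (contDiff_one_of_partials h.hasDerivAt_left h.hasDerivAt_right h.continuous_q
    h.continuous_p).continuous

theorem IsNullSolution.continuous_form (h : IsNullSolution N S k X p q)
    (hN : IsNullForm N N' S C) : Continuous fun u : ℝ × ℝ => N (X u.1 u.2) :=
  hN.continuousOn.comp_continuous h.toIsNullField.continuous fun u => h.mem u.1 u.2

theorem IsNullSolution.continuous_source (h : IsNullSolution N S k X p q)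
    (hN : IsNullForm N N' S C) :
    Continuous fun u : ℝ × ℝ => N (X u.1 u.2) (q u.1 u.2) (p u.1 u.2) :=
  ((h.continuous_form hN).clm_apply h.continuous_q).clm_apply h.continuous_p

/-! ### Linear transport along characteristics, and second derivatives of solutions. -/

section Transport

variable [CompleteSpace E]

/-- For each `v` this is a linear integral equation in `w`. It is solved on the whole line at once
because `a ↦ ∫ A a` has norm at most `C ∫ k ≤ 1/2`; treating all `v` together gives joint
continuity. -/
theorem exists_continuous_linear_transport {A : ℝ → ℝ → E →L[ℝ] E} {f : ℝ → ℝ → E} {s : ℝ → E}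
    {m : ℝ → ℝ} (hk : Integrable k) (hk0 : ∀ y, 0 ≤ k y) (hC : 0 ≤ C) (hCk : C * ∫ y, k y ≤ 1 / 2)
    (hA : Continuous (Function.uncurry A)) (hf : Continuous (Function.uncurry f))
    (hs : Continuous s) (hm : Continuous m) (hAk : ∀ w v, ‖A w v‖ ≤ C * k w)
    (hfk : ∀ w v, ‖f w v‖ ≤ m v * k w) (hm0 : ∀ v, 0 ≤ m v) :
    ∃ a : ℝ → ℝ → E, Continuous (Function.uncurry a) ∧
      ∀ w v, a w v = s v + ∫ y in v..w, (f y v + A y v (a y v)) := by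
  -- Division by `l v` absorbs the size of the data and of the inhomogeneity, so the quotient `b`
  -- may be sought among bounded continuous functions on the plane. The summand `1` keeps `l`
  -- positive.
  set l : ℝ → ℝ := fun v => 1 + ‖s v‖ + m v with hl
  have hl0 : ∀ v, 0 < l v := fun v => by have := hm0 v; positivity
  have hlc : Continuous l := (continuous_const.add hs.norm).add hm
  have hκ0 : 0 ≤ ∫ y, k y := integral_nonneg hk0
  let α (b : BoundedContinuousFunction (ℝ × ℝ) E) : ℝ → ℝ → E := fun w v => l v • b (w, v)
  have hα : ∀ b, Continuous (Function.uncurry (α b)) := fun b =>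
    (hlc.comp continuous_snd).smul b.continuous
  have hint : ∀ b, Continuous fun u : ℝ × ℝ =>
      ∫ y in u.2..u.1, (f y u.2 + A y u.2 (α b y u.2)) := fun b => by
    have cs : Continuous fun z : (ℝ × ℝ) × ℝ => (z.2, z.1.2) := by fun_prop
    exact continuous_integral_of_continuous₂ (f := fun u : ℝ × ℝ => fun y =>
      f y u.2 + A y u.2 (α b y u.2))
      ((hf.comp cs).add ((hA.comp cs).clm_apply ((hα b).comp cs))) continuous_snd continuous_fst
  have hA1 : ∀ b w v, ‖∫ y in v..w, A y v (α b y v)‖ ≤ 1 / 2 * (l v * ‖b‖) := fun b w v => by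
    have h1 : ‖∫ y in v..w, A y v (α b y v)‖ ≤ (C * (l v * ‖b‖)) * ∫ y, k y := by
      refine norm_intervalIntegral_le_integral hk hk0
        (mul_nonneg hC (mul_nonneg (hl0 v).le (norm_nonneg _))) fun y _ => ?_
      calc ‖A y v (α b y v)‖ ≤ (C * k y) * (l v * ‖b‖) := by
            refine (A y v).le_of_opNorm_le_of_le (hAk y v) ?_
            rw [norm_smul, Real.norm_of_nonneg (hl0 v).le]
            have := b.norm_coe_le_norm (y, v)
            have := (hl0 v).le
            gcongr
        _ = _ := by ring
    calc _ ≤ _ := h1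
      _ = (C * ∫ y, k y) * (l v * ‖b‖) := by ring
      _ ≤ _ := by
        have := (hl0 v).le
        gcongr
  have hcs : ∀ b v, Continuous fun y => A y v (α b y v) := fun b v => by
    have cs : Continuous fun y : ℝ => (y, v) := by fun_prop
    exact (hA.comp cs).clm_apply ((hα b).comp cs)
  have hfs : ∀ v, Continuous fun y => f y v := fun v =>
    hf.comp (by fun_prop : Continuous fun y : ℝ => (y, v))
  have hsplit : ∀ b w v, ∫ y in v..w, (f y v + A y v (α b y v)) =
      (∫ y in v..w, f y v) + ∫ y in v..w, A y v (α b y v) := fun b w v =>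
    intervalIntegral.integral_add ((hfs v).intervalIntegrable _ _)
      ((hcs b v).intervalIntegrable _ _)
  let Φ (b : BoundedContinuousFunction (ℝ × ℝ) E) : BoundedContinuousFunction (ℝ × ℝ) E :=
    BoundedContinuousFunction.ofNormedAddCommGroup
      (fun u => (l u.2)⁻¹ • (s u.2 + ∫ y in u.2..u.1, (f y u.2 + A y u.2 (α b y u.2))))
      (((hlc.comp continuous_snd).inv₀ fun u => (hl0 _).ne').smul
        ((hs.comp continuous_snd).add (hint b))) (1 + (∫ y, k y) + 1 / 2 * ‖b‖) (by
        rintro ⟨w, v⟩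
        have hf1 : ‖∫ y in v..w, f y v‖ ≤ m v * ∫ y, k y :=
          norm_intervalIntegral_le_integral hk hk0 (hm0 v) fun y _ => hfk y v
        have := hA1 b w v
        rw [norm_smul, norm_inv, Real.norm_of_nonneg (hl0 v).le, inv_mul_le_iff₀ (hl0 v)]
        simp only
        rw [hsplit]
        refine (norm_add_le _ _).trans ((add_le_add_right (norm_add_le _ _) _).trans ?_)
        have e1 : ‖s v‖ ≤ l v := by have := hm0 v; simp only [hl]; linarith [norm_nonneg (s v)]
        have e2 : m v * ∫ y, k y ≤ l v * ∫ y, k y := by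
          gcongr; simp only [hl]; linarith [norm_nonneg (s v)]
        nlinarith)
  have hΦ : ContractingWith (1 / 2) Φ := by
    refine ⟨by rw [← NNReal.coe_lt_coe]; norm_num, LipschitzWith.of_dist_le_mul fun b b' => ?_⟩
    rw [BoundedContinuousFunction.dist_le (by positivity)]
    rintro ⟨w, v⟩
    have e : Φ b (w, v) - Φ b' (w, v) = (l v)⁻¹ • ∫ y in v..w, A y v (α (b - b') y v) := by
      change (l v)⁻¹ • (s v + ∫ y in v..w, (f y v + A y v (α b y v))) -
        (l v)⁻¹ • (s v + ∫ y in v..w, (f y v + A y v (α b' y v))) = _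
      rw [hsplit, hsplit, ← smul_sub]
      congr 1
      have : ∀ y, A y v (α (b - b') y v) = A y v (α b y v) - A y v (α b' y v) := fun y => by
        rw [← map_sub]; congr 1; simp [α, smul_sub]
      simp only [this]
      rw [intervalIntegral.integral_sub ((hcs b v).intervalIntegrable _ _)
        ((hcs b' v).intervalIntegrable _ _)]
      abel
    rw [dist_eq_norm, e, dist_eq_norm, norm_smul, norm_inv, Real.norm_of_nonneg (hl0 v).le,
      inv_mul_le_iff₀ (hl0 v)]
    refine (hA1 _ w v).trans (le_of_eq ?_)
    push_cast; ring
  have hfix := hΦ.fixedPoint_isFixedPt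
  set b := hΦ.fixedPoint with hb
  refine ⟨α b, hα b, fun w v => ?_⟩
  have : Φ b (w, v) = b (w, v) := by rw [hfix]
  change l v • b (w, v) = _
  rw [← this]
  change l v • ((l v)⁻¹ • (s v + ∫ y in v..w, (f y v + A y v (α b y v)))) = _
  rw [smul_inv_smul₀ (hl0 v).ne']

/-- Differentiability in the parameter `v` of solutions of the linear equation `p_w = A p`. -/
theorem exists_hasDerivAt_of_linear_transport {A A' : ℝ → ℝ → E →L[ℝ] E} {p : ℝ → ℝ → E}
    {p₀' : ℝ → E} {m : ℝ → ℝ} (hk : Integrable k) (hk0 : ∀ y, 0 ≤ k y) (hC : 0 ≤ C)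
    (hCk : C * ∫ y, k y ≤ 1 / 2)
    (hA : Continuous (Function.uncurry A)) (hA' : Continuous (Function.uncurry A'))
    (hp : Continuous (Function.uncurry p)) (hm : Continuous m) (hm0 : ∀ v, 0 ≤ m v)
    (hAk : ∀ w v, ‖A w v‖ ≤ C * k w) (hfk : ∀ w v, ‖A' w v (p w v)‖ ≤ m v * k w)
    (dA : ∀ w v, HasDerivAt (fun y => A w y) (A' w v) v)
    (dp : ∀ w v, HasDerivAt (fun y => p y v) (A w v (p w v)) w)
    (dp₀ : ∀ y, HasDerivAt (fun y => p y y) (p₀' y) y) (hp₀' : Continuous p₀') :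
    ∃ a : ℝ → ℝ → E, Continuous (Function.uncurry a) ∧
      ∀ w v, HasDerivAt (fun y => p w y) (a w v) v := by
  have hdiag : Continuous fun y : ℝ => (y, y) := by fun_prop
  -- The candidate `a` for `p_v` solves the equation differentiated in `v`, namely `a_w = A' p + A
  -- a`. Its diagonal value is forced: the derivative `p₀'` along the diagonal is `p_w + p_v`, and
  -- `p_w = A p`.
  obtain ⟨a, ha, hae⟩ := exists_continuous_linear_transport (f := fun w v => A' w v (p w v))
    (s := fun v => p₀' v - A v v (p v v)) hk hk0 hC hCk hA (hA'.clm_apply hp)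
    (hp₀'.sub ((hA.comp hdiag).clm_apply (hp.comp hdiag))) hm hAk hfk hm0
  refine ⟨a, ha, ?_⟩
  have cr : ∀ w : ℝ, Continuous fun y : ℝ => (w, y) := fun w => by fun_prop
  have cl : ∀ v : ℝ, Continuous fun y : ℝ => (y, v) := fun v => by fun_prop
  have hsrc : Continuous (Function.uncurry fun w v => A' w v (p w v) + A w v (a w v)) :=
    (hA'.clm_apply hp).add (hA.clm_apply ha)
  have da : ∀ w v, HasDerivAt (fun y => a y v) (A' w v (p w v) + A w v (a w v)) w := fun w v => by
    have : (fun y => a y v) = fun w => (p₀' v - A v v (p v v)) +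
        ∫ y in v..w, (A' y v (p y v) + A y v (a y v)) := funext fun w => hae w v
    rw [this]
    have hc : Continuous fun y => A' y v (p y v) + A y v (a y v) := hsrc.comp (cl v)
    exact (intervalIntegral.integral_hasDerivAt_right (hc.intervalIntegrable _ _)
      (hc.stronglyMeasurableAtFilter _ _) hc.continuousAt).const_add _
  -- By construction `P_v = a` and `P = p` on the diagonal; it remains to see that `P = p`
  -- everywhere.
  set P : ℝ → ℝ → E := fun w v => p w w + ∫ y in w..v, a w y with hP
  have hPc : Continuous (Function.uncurry P) :=
    (hp.comp (hdiag.comp continuous_fst)).add (continuous_integral_of_continuous₂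
      (f := fun u : ℝ × ℝ => a u.1)
      (ha.comp (by fun_prop : Continuous fun z : (ℝ × ℝ) × ℝ => (z.1.1, z.2)))
      continuous_fst continuous_snd)
  have dPv : ∀ w v, HasDerivAt (fun y => P w y) (a w v) v := fun w v => by
    have hc : Continuous (a w) := ha.comp (cr w)
    exact (intervalIntegral.integral_hasDerivAt_right (hc.intervalIntegrable _ _)
      (hc.stronglyMeasurableAtFilter _ _) hc.continuousAt).const_add _
  set D : ℝ → ℝ → E := fun w v => p w v - P w v with hD
  have hDc : Continuous (Function.uncurry D) := hp.sub hPc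
  -- `J` is the defect of `P` in the transport equation: integrating `(A P)_v = A' P + A a` gives
  -- `P_w = A P + J`, and therefore `D_w = A D - J`.
  set J : ℝ → ℝ → E := fun w v => ∫ y in w..v, A' w y (D w y) with hJ
  have hJc : Continuous (Function.uncurry J) := by
    have cs : Continuous fun z : (ℝ × ℝ) × ℝ => (z.1.1, z.2) := by fun_prop
    exact continuous_integral_of_continuous₂ (f := fun u : ℝ × ℝ => fun y => A' u.1 y (D u.1 y))
      ((hA'.comp cs).clm_apply (hDc.comp cs)) continuous_fst continuous_snd
  have dPw : ∀ w v, HasDerivAt (fun y => P y v) (A w v (P w v) + J w v) w := fun w v => by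
    have h1 := (dp₀ w).add (hasDerivAt_integral_left_param da ha hsrc w v)
    refine h1.congr_deriv ?_
    have hAP : ∀ y ∈ uIcc w v, HasDerivAt (fun y => A w y (P w y))
        (A' w y (P w y) + A w y (a w y)) y := fun y _ => by
      have := (dA w y).clm_apply (dPv w y)
      exact this
    have hc1 : Continuous fun y => A' w y (P w y) + A w y (a w y) :=
      ((hA'.comp (cr w)).clm_apply (hPc.comp (cr w))).add
        ((hA.comp (cr w)).clm_apply (ha.comp (cr w)))
    have hc2 : Continuous fun y => A' w y (D w y) :=
      (hA'.comp (cr w)).clm_apply (hDc.comp (cr w))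
    have e1 := intervalIntegral.integral_eq_sub_of_hasDerivAt hAP (hc1.intervalIntegrable _ _)
    have e2 : ∫ y in w..v, (A' w y (p w y) + A w y (a w y)) =
        (∫ y in w..v, (A' w y (P w y) + A w y (a w y))) + J w v := by
      rw [hJ, ← intervalIntegral.integral_add (hc1.intervalIntegrable _ _)
        (hc2.intervalIntegrable _ _)]
      refine intervalIntegral.integral_congr fun y _ => ?_
      simp only [hD, map_sub]; abel
    have e3 : a w w = p₀' w - A w w (p w w) := by rw [hae w w]; simp
    have e4 : P w w = p w w := by simp [hP]
    rw [e2, e1, e3, e4]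
    abel
  have dD : ∀ w v, HasDerivAt (fun y => D y v) (A w v (D w v) - J w v) w := fun w v => by
    refine ((dp w v).sub (dPw w v)).congr_deriv ?_
    simp only [hD, map_sub]; abel
  have hDint : ∀ w v, D w v = ∫ y in v..w, (A y v (D y v) - J y v) := fun w v => by
    have hc : Continuous fun y => A y v (D y v) - J y v :=
      ((hA.comp (cl v)).clm_apply (hDc.comp (cl v))).sub (hJc.comp (cl v))
    rw [intervalIntegral.integral_eq_sub_of_hasDerivAt (fun y _ => dD y v)
      (hc.intervalIntegrable _ _)]
    simp [hD, hP]
  -- `D` is an integral in `w` of `A D - J`, and `J` an integral in `v` of `A' D`, both starting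
  -- from the diagonal. Grönwall on a square therefore applies to `‖D‖ + ‖J‖`.
  have hD0 : ∀ w v, D w v = 0 := fun w v => by
    set T := max |w| |v|
    obtain ⟨K₁, hK₁⟩ := ((isCompact_Icc (a := -T) (b := T)).prod
      isCompact_Icc).exists_bound_of_continuousOn hA.continuousOn
    obtain ⟨K₂, hK₂⟩ := ((isCompact_Icc (a := -T) (b := T)).prod
      isCompact_Icc).exists_bound_of_continuousOn hA'.continuousOn
    set K := max 1 (max K₁ K₂) with hK
    have hK0 : 0 ≤ K := zero_le_one.trans (le_max_left _ _)
    have hsub : ∀ {x y : ℝ}, x ∈ Icc (-T) T → y ∈ Icc (-T) T → uIcc x y ⊆ Icc (-T) T :=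
      fun hx hy => OrdConnected.uIcc_subset ordConnected_Icc hx hy
    have hgc : Continuous (Function.uncurry fun w v => ‖D w v‖ + ‖J w v‖) :=
      hDc.norm.add hJc.norm
    have := eq_zero_of_le_integral_diag (a := -T) (b := T) hK0
      (g := fun w v => ‖D w v‖ + ‖J w v‖) hgc
      (fun w v => by positivity) (fun w hw v hv => by
        have h1 : ‖D w v‖ ≤ K * |∫ y in v..w, (‖D y v‖ + ‖J y v‖)| := by
          have := norm_intervalIntegral_le_of_le (f := fun y => A y v (D y v) - J y v)
            (g := fun y => K * (‖D y v‖ + ‖J y v‖)) (a := v) (b := w)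
            (continuous_const.mul (hgc.comp (cl v))) (fun y hy => by
              refine (norm_sub_le _ _).trans ?_
              have h2 : ‖A y v (D y v)‖ ≤ K * ‖D y v‖ := (A y v).le_of_opNorm_le
                ((hK₁ (y, v) ⟨hsub hv hw hy, hv⟩).trans
                  ((le_max_left _ _).trans (le_max_right _ _))) _
              have h3 : ‖J y v‖ ≤ K * ‖J y v‖ :=
                le_mul_of_one_le_left (norm_nonneg _) (le_max_left _ _)
              linarith)
          rwa [← hDint, intervalIntegral.integral_const_mul, abs_mul, abs_of_nonneg hK0] at this
        have h2 : ‖J w v‖ ≤ K * |∫ y in w..v, (‖D w y‖ + ‖J w y‖)| := by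
          have := norm_intervalIntegral_le_of_le (f := fun y => A' w y (D w y))
            (g := fun y => K * (‖D w y‖ + ‖J w y‖)) (a := w) (b := v)
            (continuous_const.mul (hgc.comp (cr w))) (fun y hy => by
              have h2 : ‖A' w y (D w y)‖ ≤ K * ‖D w y‖ := (A' w y).le_of_opNorm_le
                ((hK₂ (w, y) ⟨hw, hsub hw hv hy⟩).trans
                  ((le_max_right _ _).trans (le_max_right _ _))) _
              have h3 : 0 ≤ K * ‖J w y‖ := by positivity
              linarith)
          rwa [intervalIntegral.integral_const_mul, abs_mul, abs_of_nonneg hK0] at this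
        exact add_le_add h1 h2)
      w (abs_le.1 (le_max_left _ _)) v (abs_le.1 (le_max_right _ _))
    have h0 : ‖D w v‖ ≤ 0 := by linarith [norm_nonneg (J w v), norm_nonneg (D w v)]
    exact norm_le_zero_iff.1 h0
  intro w v
  have : (fun y => p w y) = fun y => P w y := funext fun y => sub_eq_zero.1 (hD0 w y)
  rw [this]
  exact dPv w v

end Transport

/-- The coefficient `N(X) q` is differentiable in `v` without any knowledge of `p_v`, since `q_v` is
given by the equation. -/
theorem IsNullSolution.hasDerivAt_form (h : IsNullSolution N S k X p q)
    (hN : IsNullForm N N' S C) (w v : ℝ) :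
    HasDerivAt (fun y => N (X w y) (q w y))
      (N' (X w v) (p w v) (q w v) + N (X w v) (N (X w v) (q w v) (p w v))) v :=
  (((hN.hasFDerivAt _ (h.mem w v)).comp_hasDerivAt v (h.hasDerivAt_right w v)).clm_apply
    (h.hasDerivAt_q w v))

theorem IsNullSolution.continuous_deriv_form (h : IsNullSolution N S k X p q)
    (hN : IsNullForm N N' S C) :
    Continuous (Function.uncurry fun w v =>
      N' (X w v) (p w v) (q w v) + N (X w v) (N (X w v) (q w v) (p w v))) := by
  have h1 : Continuous fun u : ℝ × ℝ => N' (X u.1 u.2) :=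
    hN.continuousOn_deriv.comp_continuous h.toIsNullField.continuous fun u => h.mem u.1 u.2
  exact ((h1.clm_apply h.continuous_p).clm_apply h.continuous_q).add
    ((h.continuous_form hN).clm_apply (h.continuous_source hN))

/-- The contraction produces first derivatives only. But `p_w = N(X)(q, p)` is linear in `p` with a
coefficient differentiable in `v`, so differentiability of `p` on the diagonal propagates to `X_vv`
everywhere, and after the exchange of variables to `X_ww`. -/
theorem IsNullSolution.exists_hasDerivAt_p [CompleteSpace E] (h : IsNullSolution N S k X p q)
    (hN : IsNullForm N N' S C) (hk : Integrable k) (hkc : Continuous k)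
    (hCk : C * ∫ y, k y ≤ 1 / 2) {p₀' : ℝ → E}
    (dp₀ : ∀ y, HasDerivAt (fun y => p y y) (p₀' y) y) (hp₀' : Continuous p₀') :
    ∃ a : ℝ → ℝ → E, Continuous (Function.uncurry a) ∧
      ∀ w v, HasDerivAt (fun y => p w y) (a w v) v := by
  have hk0 : ∀ y, 0 ≤ k y := fun y => (norm_nonneg _).trans (h.norm_p_le 0 y)
  have hC := hN.pos.le
  refine exists_hasDerivAt_of_linear_transport (A := fun w v => N (X w v) (q w v))
    (m := fun v => C * k v * k v + C * C * k v * k v) hk hk0 hC hCk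
    ((h.continuous_form hN).clm_apply h.continuous_q) (h.continuous_deriv_form hN) h.continuous_p
    (by fun_prop) (fun v => by have := hk0 v; positivity) (fun w v => ?_) (fun w v => ?_)
    (h.hasDerivAt_form hN) h.hasDerivAt_p dp₀ hp₀'
  · exact (N (X w v)).le_of_opNorm_le_of_le (hN.norm_le _ (h.mem w v)) (h.norm_q_le w v)
  · have hkw := hk0 w
    have hkv := hk0 v
    have e1 : ‖N' (X w v) (p w v) (q w v) (p w v)‖ ≤ C * k v * k w * k v :=
      ContinuousLinearMap.le_of_opNorm_le_of_le _
        (ContinuousLinearMap.le_of_opNorm_le_of_le _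
          ((N' _).le_of_opNorm_le_of_le (hN.norm_deriv_le _ (h.mem w v)) (h.norm_p_le w v))
          (h.norm_q_le w v)) (h.norm_p_le w v)
    have e2 : ‖N (X w v) (N (X w v) (q w v) (p w v)) (p w v)‖ ≤ C * (C * k w * k v) * k v := by
      refine (hN.norm_apply_le (h.mem w v) _ _).trans ?_
      have := hN.norm_apply_le (h.mem w v) (q w v) (p w v)
      have h3 := h.norm_p_le w v
      have h4 := h.norm_q_le w v
      gcongr
      exact this.trans (by gcongr)
    refine (norm_add_le _ _).trans ((add_le_add e1 e2).trans (le_of_eq (by ring)))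

end NullSystem

section Existence

variable {E : Type*} [NormedAddCommGroup E] [NormedSpace ℝ E]

/-! ### Existence -/

/-- The primitive in the variable `v` with value `f` on the diagonal. -/
noncomputable def primRight (f : ℝ → E) (c : ℝ → ℝ → E) (w v : ℝ) : E := f w + ∫ y in w..v, c w y

/-- The primitive in the variable `w` with value `f` on the diagonal. -/
noncomputable def primLeft (f : ℝ → E) (c : ℝ → ℝ → E) (w v : ℝ) : E := f v + ∫ y in v..w, c y v

theorem continuous_primRight {f : ℝ → E} {c : ℝ → ℝ → E} (hf : Continuous f)
    (hc : Continuous (Function.uncurry c)) : Continuous (Function.uncurry (primRight f c)) :=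
  (hf.comp continuous_fst).add (continuous_integral_of_continuous₂ (f := fun u : ℝ × ℝ => c u.1)
    (hc.comp (by fun_prop : Continuous fun z : (ℝ × ℝ) × ℝ => (z.1.1, z.2)))
    continuous_fst continuous_snd)

theorem continuous_primLeft {f : ℝ → E} {c : ℝ → ℝ → E} (hf : Continuous f)
    (hc : Continuous (Function.uncurry c)) : Continuous (Function.uncurry (primLeft f c)) :=
  (continuous_primRight (c := fun w v => c v w) hf (hc.comp continuous_swap)).comp continuous_swap

theorem norm_primRight_sub_le {k : ℝ → ℝ} {f : ℝ → E} {c : ℝ → ℝ → E} {w v g : ℝ}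
    (hk : Integrable k) (hk0 : ∀ y, 0 ≤ k y) (hg : 0 ≤ g) (h : ∀ y, ‖c w y‖ ≤ g * k y) :
    ‖primRight f c w v - f w‖ ≤ g * ∫ y, k y := by
  simp only [primRight, add_sub_cancel_left]
  exact norm_intervalIntegral_le_integral hk hk0 hg fun y _ => h y

theorem norm_primLeft_sub_le {k : ℝ → ℝ} {f : ℝ → E} {c : ℝ → ℝ → E} {w v g : ℝ}
    (hk : Integrable k) (hk0 : ∀ y, 0 ≤ k y) (hg : 0 ≤ g) (h : ∀ y, ‖c y v‖ ≤ g * k y) :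
    ‖primLeft f c w v - f v‖ ≤ g * ∫ y, k y :=
  norm_primRight_sub_le (c := fun w v => c v w) hk hk0 hg h

theorem norm_primRight_sub_primRight_le {k : ℝ → ℝ} {f : ℝ → E} {c c' : ℝ → ℝ → E} {w v g : ℝ}
    (hk : Integrable k) (hk0 : ∀ y, 0 ≤ k y) (hg : 0 ≤ g) (hc : Continuous (Function.uncurry c))
    (hc' : Continuous (Function.uncurry c')) (h : ∀ y, ‖c w y - c' w y‖ ≤ g * k y) :
    ‖primRight f c w v - primRight f c' w v‖ ≤ g * ∫ y, k y := by
  have cr : Continuous fun y : ℝ => (w, y) := by fun_prop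
  simp only [primRight, add_sub_add_left_eq_sub]
  have h1 : Continuous (c w) := hc.comp cr
  have h2 : Continuous (c' w) := hc'.comp cr
  rw [← intervalIntegral.integral_sub (h1.intervalIntegrable _ _) (h2.intervalIntegrable _ _)]
  exact norm_intervalIntegral_le_integral hk hk0 hg fun y _ => h y

theorem norm_primLeft_sub_primLeft_le {k : ℝ → ℝ} {f : ℝ → E} {c c' : ℝ → ℝ → E} {w v g : ℝ}
    (hk : Integrable k) (hk0 : ∀ y, 0 ≤ k y) (hg : 0 ≤ g) (hc : Continuous (Function.uncurry c))
    (hc' : Continuous (Function.uncurry c')) (h : ∀ y, ‖c y v - c' y v‖ ≤ g * k y) :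
    ‖primLeft f c w v - primLeft f c' w v‖ ≤ g * ∫ y, k y :=
  norm_primRight_sub_primRight_le (c := fun w v => c v w) (c' := fun w v => c' v w) hk hk0 hg
    (hc.comp continuous_swap) (hc'.comp continuous_swap) h

variable [CompleteSpace E]

theorem hasDerivAt_primRight {f : ℝ → E} {c : ℝ → ℝ → E} (hc : Continuous (Function.uncurry c))
    (w v : ℝ) : HasDerivAt (fun y => primRight f c w y) (c w v) v := by
  have h : Continuous (c w) := hc.comp (by fun_prop : Continuous fun y : ℝ => (w, y))
  exact (intervalIntegral.integral_hasDerivAt_right (h.intervalIntegrable _ _)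
    (h.stronglyMeasurableAtFilter _ _) h.continuousAt).const_add _

theorem hasDerivAt_primLeft {f : ℝ → E} {c : ℝ → ℝ → E} (hc : Continuous (Function.uncurry c))
    (w v : ℝ) : HasDerivAt (fun y => primLeft f c y v) (c w v) w :=
  hasDerivAt_primRight (c := fun w v => c v w) (hc.comp continuous_swap) v w

/-- Existence of a solution with data of small total variation on the diagonal. -/
theorem exists_isNullSolution {N : E → E →L[ℝ] E →L[ℝ] E} {N' : E → E →L[ℝ] E →L[ℝ] E →L[ℝ] E}
    {x₀ : E} {ρ C : ℝ} (hN : IsNullForm N N' (Metric.closedBall x₀ ρ) C) {k : ℝ → ℝ}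
    (hkc : Continuous k) (hk0 : ∀ y, 0 < k y) (hk : Integrable k)
    (hCk : C * ∫ y, k y ≤ 1 / 100) (hkρ : ∫ y, k y ≤ ρ / 2) {X₀ p₀ q₀ : ℝ → E}
    (hX₀ : ∀ y, HasDerivAt X₀ (p₀ y + q₀ y) y) (hX₀m : ∀ y, ‖X₀ y - x₀‖ ≤ ρ / 2)
    (hp₀ : Continuous p₀) (hq₀ : Continuous q₀) (hp₀k : ∀ y, ‖p₀ y‖ ≤ k y / 2)
    (hq₀k : ∀ y, ‖q₀ y‖ ≤ k y / 2) :
    ∃ X p q : ℝ → ℝ → E, IsNullSolution N (Metric.closedBall x₀ ρ) k X p q ∧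
      (∀ y, X y y = X₀ y) ∧ (∀ y, p y y = p₀ y) ∧ ∀ y, q y y = q₀ y := by
  set κ := ∫ y, k y with hκ
  have hk0' : ∀ y, 0 ≤ k y := fun y => (hk0 y).le
  have hκ0 : 0 ≤ κ := integral_nonneg hk0'
  have hC1 := hN.one_le
  have hC0 := hN.pos
  have hκ1 : κ ≤ 1 / 100 := by nlinarith
  have hX₀c : Continuous X₀ := continuous_iff_continuousAt.2 fun y => (hX₀ y).continuousAt
  let V := BoundedContinuousFunction (ℝ × ℝ) E
  -- The unknown `b` is `X_wv` divided by `C k(w) k(v)`, the size allowed to the source. With this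
  -- normalisation the unit ball is mapped into itself.
  let c (b : V) : ℝ → ℝ → E := fun w v => (C * k w * k v) • b (w, v)
  have hck : ∀ w v, 0 < C * k w * k v := fun w v => by have := hk0 w; have := hk0 v; positivity
  have hcc : ∀ b, Continuous (Function.uncurry (c b)) := fun b =>
    ((continuous_const.mul (hkc.comp continuous_fst)).mul (hkc.comp continuous_snd)).smul
      b.continuous
  have hcd : ∀ b b' w v, ‖c b w v - c b' w v‖ ≤ C * k w * k v * dist b b' := fun b b' w v => by
    simp only [c]
    rw [← smul_sub, norm_smul, Real.norm_of_nonneg (hck w v).le, ← dist_eq_norm]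
    exact mul_le_mul_of_nonneg_left (BoundedContinuousFunction.dist_coe_le_dist _) (hck w v).le
  have hcn : ∀ b : V, ‖b‖ ≤ 1 → ∀ w v, ‖c b w v‖ ≤ C * k w * k v := fun b hb w v => by
    simp only [c]
    rw [norm_smul, Real.norm_of_nonneg (hck w v).le]
    exact mul_le_of_le_one_right (hck w v).le ((b.norm_coe_le_norm _).trans hb)
  -- The mixed derivative determines `X_w` and `X_v` by integration from the diagonal, and then `X`
  -- by integration of `X_w` in `w`. That the `v`-derivative of `X b` is `P b` is checked at the
  -- end.
  let Q (b : V) := primRight q₀ (c b)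
  let P (b : V) := primLeft p₀ (c b)
  let X (b : V) := primLeft X₀ (Q b)
  have hQc : ∀ b, Continuous (Function.uncurry (Q b)) := fun b => continuous_primRight hq₀ (hcc b)
  have hPc : ∀ b, Continuous (Function.uncurry (P b)) := fun b => continuous_primLeft hp₀ (hcc b)
  have hXc : ∀ b, Continuous (Function.uncurry (X b)) := fun b =>
    continuous_primLeft hX₀c (hQc b)
  -- The data use `k / 2` and the integrated source at most `C κ k ≤ k / 100`, so the bound by `k`
  -- persists.
  have hQn : ∀ b : V, ‖b‖ ≤ 1 → ∀ w v, ‖Q b w v‖ ≤ k w := fun b hb w v => by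
    have h1 := norm_primRight_sub_le (f := q₀) (c := c b) (w := w) (v := v) (g := C * k w) hk hk0'
      (mul_pos hC0 (hk0 w)).le (fun y => hcn b hb w y)
    have h2 := norm_le_norm_add_norm_sub' (Q b w v) (q₀ w)
    have h3 := hq₀k w
    have h4 := hk0 w
    have h1 : ‖Q b w v - q₀ w‖ ≤ C * k w * κ := h1
    nlinarith
  have hPn : ∀ b : V, ‖b‖ ≤ 1 → ∀ w v, ‖P b w v‖ ≤ k v := fun b hb w v => by
    have h1 := norm_primLeft_sub_le (f := p₀) (c := c b) (w := w) (v := v) (g := C * k v) hk hk0'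
      (mul_pos hC0 (hk0 v)).le (fun y => (hcn b hb y v).trans (le_of_eq (by ring)))
    have h2 := norm_le_norm_add_norm_sub' (P b w v) (p₀ v)
    have h3 := hp₀k v
    have h4 := hk0 v
    have h1 : ‖P b w v - p₀ v‖ ≤ C * k v * κ := h1
    nlinarith
  have hXm : ∀ b : V, ‖b‖ ≤ 1 → ∀ w v, X b w v ∈ Metric.closedBall x₀ ρ := fun b hb w v => by
    have h1 := norm_primLeft_sub_le (f := X₀) (c := Q b) (w := w) (v := v) (g := 1) hk hk0'
      zero_le_one (fun y => by rw [one_mul]; exact hQn b hb y v)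
    rw [mem_closedBall_iff_norm]
    calc ‖X b w v - x₀‖ ≤ ‖X b w v - X₀ v‖ + ‖X₀ v - x₀‖ := norm_sub_le_norm_sub_add_norm_sub _ _ _
      _ ≤ 1 * κ + ρ / 2 := add_le_add h1 (hX₀m v)
      _ ≤ ρ := by linarith
  have hQd : ∀ b b' w v, ‖Q b w v - Q b' w v‖ ≤ C * k w * dist b b' * κ := fun b b' w v =>
    norm_primRight_sub_primRight_le hk hk0' (by have := hk0 w; positivity) (hcc b) (hcc b')
      fun y => (hcd b b' w y).trans (le_of_eq (by ring))
  have hPd : ∀ b b' w v, ‖P b w v - P b' w v‖ ≤ C * k v * dist b b' * κ := fun b b' w v =>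
    norm_primLeft_sub_primLeft_le hk hk0' (by have := hk0 v; positivity) (hcc b) (hcc b')
      fun y => (hcd b b' y v).trans (le_of_eq (by ring))
  have hXd : ∀ b b' w v, ‖X b w v - X b' w v‖ ≤ C * dist b b' * κ * κ := fun b b' w v =>
    norm_primLeft_sub_primLeft_le hk hk0' (by positivity) (hQc b) (hQc b')
      fun y => (hQd b b' y v).trans (le_of_eq (by ring))
  let G (b : V) : ℝ × ℝ → E := fun u => N (X b u.1 u.2) (Q b u.1 u.2) (P b u.1 u.2)
  have hGc : ∀ b : V, ‖b‖ ≤ 1 → Continuous (G b) := fun b hb =>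
    ((hN.continuousOn.comp_continuous (hXc b) fun u => hXm b hb u.1 u.2).clm_apply
      (hQc b)).clm_apply (hPc b)
  have hGn : ∀ b : V, ‖b‖ ≤ 1 → ∀ u, ‖G b u‖ ≤ C * k u.1 * k u.2 := fun b hb u => by
    refine (hN.norm_apply_le (hXm b hb _ _) _ _).trans ?_
    have := hQn b hb u.1 u.2
    have := hPn b hb u.1 u.2
    have := hk0' u.1
    gcongr
  -- The Lipschitz constant found is `C κ² + 2 C κ`, one term for each of the arguments `X`, `q`,
  -- `p` of the source; it is below `1/2` since `C κ ≤ 1/100`.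
  have hGd : ∀ b b' : V, ‖b‖ ≤ 1 → ‖b'‖ ≤ 1 → ∀ u,
      ‖G b u - G b' u‖ ≤ C * k u.1 * k u.2 * (1 / 2 * dist b b') := fun b b' hb hb' u => by
    refine (hN.norm_apply_sub_le (hXm b hb _ _) (hXm b' hb' _ _) _ _ _ _).trans ?_
    have hku := hk0' u.1
    have hkv := hk0' u.2
    have hd : 0 ≤ dist b b' := dist_nonneg
    calc _ ≤ C * (C * dist b b' * κ * κ) * k u.1 * k u.2 +
          C * (C * k u.1 * dist b b' * κ) * k u.2 + C * k u.1 * (C * k u.2 * dist b b' * κ) := by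
          gcongr
          · exact hXd b b' _ _
          · exact hQn b hb _ _
          · exact hPn b hb _ _
          · exact hQd b b' _ _
          · exact hPn b hb _ _
          · exact hQn b' hb' _ _
          · exact hPd b b' _ _
      _ = C * k u.1 * k u.2 * dist b b' * (C * κ * κ + 2 * (C * κ)) := by ring
      _ ≤ C * k u.1 * k u.2 * dist b b' * (1 / 2) := by
          gcongr
          nlinarith [mul_nonneg hC0.le hκ0]
      _ = _ := by ring
  let B := Metric.closedBall (0 : V) 1
  have hB : ∀ b : B, ‖(b : V)‖ ≤ 1 := fun b => mem_closedBall_zero_iff.1 b.2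
  have hGb : ∀ b : B, ∀ u, ‖(C * k u.1 * k u.2)⁻¹ • G b u‖ ≤ 1 := fun b u => by
    rw [norm_smul, norm_inv, Real.norm_of_nonneg (hck _ _).le, inv_mul_le_iff₀ (hck _ _), mul_one]
    exact hGn b (hB b) u
  let Φ₀ (b : B) : V := BoundedContinuousFunction.ofNormedAddCommGroup
    (fun u => (C * k u.1 * k u.2)⁻¹ • G b u)
    ((((continuous_const.mul (hkc.comp continuous_fst)).mul (hkc.comp continuous_snd)).inv₀
      fun u => (hck u.1 u.2).ne').smul (hGc b (hB b))) 1 (hGb b)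
  let Φ (b : B) : B := ⟨Φ₀ b, mem_closedBall_zero_iff.2
    (BoundedContinuousFunction.norm_ofNormedAddCommGroup_le _ zero_le_one (hGb b))⟩
  have hΦ : ContractingWith (1 / 2) Φ := by
    refine ⟨by rw [← NNReal.coe_lt_coe]; norm_num, LipschitzWith.of_dist_le_mul fun b b' => ?_⟩
    change dist (Φ₀ b) (Φ₀ b') ≤ _
    rw [BoundedContinuousFunction.dist_le (by positivity)]
    intro u
    change dist ((C * k u.1 * k u.2)⁻¹ • G b u) ((C * k u.1 * k u.2)⁻¹ • G b' u) ≤ _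
    rw [dist_eq_norm, ← smul_sub, norm_smul, norm_inv, Real.norm_of_nonneg (hck _ _).le,
      inv_mul_le_iff₀ (hck _ _)]
    refine (hGd b b' (hB b) (hB b') u).trans (le_of_eq ?_)
    simp [Subtype.dist_eq]
  have : Nonempty B := ⟨⟨0, by simp [B]⟩⟩
  have : CompleteSpace B := Metric.isClosed_closedBall.completeSpace_coe
  have hfix := hΦ.fixedPoint_isFixedPt
  obtain ⟨b, hb⟩ : ∃ b : B, Φ b = b := ⟨_, hfix⟩
  have hcG : ∀ w v, c b w v = N (X b w v) (Q b w v) (P b w v) := fun w v => by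
    have h1 : (Φ b : V) (w, v) = (b : V) (w, v) := by rw [hb]
    simp only [c]
    rw [← h1]
    exact smul_inv_smul₀ (hck w v).ne' _
  refine ⟨X b, P b, Q b, ⟨⟨fun w v => ?_, fun w v => hasDerivAt_primLeft (hQc b) w v,
    fun w v => ?_, fun w v => ?_, hPc b, hQc b⟩, hXm b (hB b), hPn b (hB b), hQn b (hB b)⟩,
    fun y => by simp [X, primLeft], fun y => by simp [P, primLeft],
    fun y => by simp [Q, primRight]⟩
  -- The Leibniz rule gives `X_v = p₀ + q₀ - Q(v, v) + ∫ c`, and `Q(v, v) = q₀ v` leaves `P`.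
  · have h1 := (hX₀ v).add (hasDerivAt_integral_left_param (f := fun v y => Q b y v)
      (f₁ := fun v y => c b y v) (fun v y => hasDerivAt_primRight (hcc b) y v)
      ((hQc b).comp continuous_swap) ((hcc b).comp continuous_swap) v w)
    refine h1.congr_deriv ?_
    have : Q b v v = q₀ v := by simp [Q, primRight]
    simp only [this, P, primLeft]
    abel
  · rw [← hcG]; exact hasDerivAt_primLeft (hcc b) w v
  · rw [← hcG]; exact hasDerivAt_primRight (hcc b) w v

end Existence

/-! ### Two solutions with equal or close data. -/

section Comparison

variable {E : Type*} [NormedAddCommGroup E] [NormedSpace ℝ E]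
variable {N : E → E →L[ℝ] E →L[ℝ] E} {N' : E → E →L[ℝ] E →L[ℝ] E →L[ℝ] E} {S : Set E} {C : ℝ}
  {k : ℝ → ℝ} {X p q X' p' q' a a' : ℝ → ℝ → E}

theorem norm_intervalIntegral_le_integral_add {f : ℝ → E} {k r : ℝ → ℝ} {x y α β : ℝ}
    (hk : Integrable k) (hr : Integrable r) (hk0 : ∀ y, 0 ≤ k y) (hr0 : ∀ y, 0 ≤ r y)
    (hα : 0 ≤ α) (hβ : 0 ≤ β) (h : ∀ z ∈ uIcc x y, ‖f z‖ ≤ α * k z + β * r z) :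
    ‖∫ z in x..y, f z‖ ≤ α * (∫ z, k z) + β * ∫ z, r z := by
  have := norm_intervalIntegral_le_integral (f := f) (k := fun z => α * k z + β * r z) (c := 1)
    (a := x) (b := y) ((hk.const_mul α).add (hr.const_mul β))
    (fun z => add_nonneg (mul_nonneg hα (hk0 z)) (mul_nonneg hβ (hr0 z))) zero_le_one
    (fun z hz => by rw [one_mul]; exact h z hz)
  rwa [one_mul, integral_add (hk.const_mul α) (hr.const_mul β), integral_const_mul,
    integral_const_mul] at this

/-! ### Uniqueness -/

/-- Two solutions with the same data on the diagonal coincide. -/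
theorem IsNullField.eq_of_diag_eq [CompleteSpace E] (h : IsNullField N X p q) (h' : IsNullField N X' p' q')
    (hGc : Continuous fun u : ℝ × ℝ => N (X u.1 u.2))
    (hGc' : Continuous fun u : ℝ × ℝ => N (X' u.1 u.2))
    (hlip : ∀ T : ℝ, ∃ C : ℝ, ∀ w ∈ Icc (-T) T, ∀ v ∈ Icc (-T) T,
      ‖N (X w v) - N (X' w v)‖ ≤ C * ‖X w v - X' w v‖)
    (hX : ∀ y, X y y = X' y y) (hp : ∀ y, p y y = p' y y) (hq : ∀ y, q y y = q' y y) :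
    X = X' := by
  funext w₁ v₁
  set T := max |w₁| |v₁|
  have hcomp : IsCompact (Icc (-T) T ×ˢ Icc (-T) T) := isCompact_Icc.prod isCompact_Icc
  obtain ⟨C₁, hC₁⟩ := hlip T
  obtain ⟨C₂, hC₂⟩ := hcomp.exists_bound_of_continuousOn hGc'.continuousOn
  obtain ⟨b₁, hb₁⟩ := hcomp.exists_bound_of_continuousOn h.continuous_p.continuousOn
  obtain ⟨b₂, hb₂⟩ := hcomp.exists_bound_of_continuousOn h.continuous_q.continuousOn
  obtain ⟨b₃, hb₃⟩ := hcomp.exists_bound_of_continuousOn h'.continuous_q.continuousOn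
  set c := max 1 (max C₁ C₂) with hc
  set b := max 1 (max b₁ (max b₂ b₃)) with hb
  have hc1 : 1 ≤ c := le_max_left _ _
  have hb1 : 1 ≤ b := le_max_left _ _
  have hcC₁ : C₁ ≤ c := (le_max_left _ _).trans (le_max_right _ _)
  have hcC₂ : C₂ ≤ c := (le_max_right _ _).trans (le_max_right _ _)
  have hbb₁ : b₁ ≤ b := (le_max_left _ _).trans (le_max_right _ _)
  have hbb₂ : b₂ ≤ b := (le_max_left _ _).trans ((le_max_right _ _).trans (le_max_right _ _))
  have hbb₃ : b₃ ≤ b := (le_max_right _ _).trans ((le_max_right _ _).trans (le_max_right _ _))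
  -- As `b` and `c` are at least `1`, this dominates all the coefficients `1`, `c b` and `c b²` that
  -- occur.
  set K := c * b * b with hK
  have hcb : c ≤ c * b := le_mul_of_one_le_right (by linarith) hb1
  have hKcb : c * b ≤ K := le_mul_of_one_le_right (by positivity) hb1
  have hK1 : 1 ≤ K := by linarith
  set g : ℝ → ℝ → ℝ := fun w v => ‖X w v - X' w v‖ + ‖p w v - p' w v‖ + ‖q w v - q' w v‖ with hg
  have hgc : Continuous (Function.uncurry g) :=
    (((h.continuous.sub h'.continuous).norm).add ((h.continuous_p.sub h'.continuous_p).norm)).add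
      ((h.continuous_q.sub h'.continuous_q).norm)
  set G : ℝ → ℝ → E := fun w v => N (X w v) (q w v) (p w v) - N (X' w v) (q' w v) (p' w v) with hG
  have hGcont : Continuous (Function.uncurry G) :=
    ((hGc.clm_apply h.continuous_q).clm_apply h.continuous_p).sub
      ((hGc'.clm_apply h'.continuous_q).clm_apply h'.continuous_p)
  have hGb : ∀ w ∈ Icc (-T) T, ∀ v ∈ Icc (-T) T, ‖G w v‖ ≤ K * g w v := fun w hw v hv => by
    have m1 : ‖p w v‖ ≤ b := (hb₁ (w, v) ⟨hw, hv⟩).trans hbb₁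
    have m2 : ‖q w v‖ ≤ b := (hb₂ (w, v) ⟨hw, hv⟩).trans hbb₂
    have m3 : ‖q' w v‖ ≤ b := (hb₃ (w, v) ⟨hw, hv⟩).trans hbb₃
    have m4 : ‖N (X' w v)‖ ≤ c := (hC₂ (w, v) ⟨hw, hv⟩).trans hcC₂
    have m5 : ‖N (X w v) - N (X' w v)‖ ≤ c * ‖X w v - X' w v‖ :=
      (hC₁ w hw v hv).trans (by gcongr)
    calc ‖G w v‖ ≤ _ := norm_apply₂_sub_le _ _ _ _ _ _
      _ ≤ c * ‖X w v - X' w v‖ * b * b + c * ‖q w v - q' w v‖ * b + c * b * ‖p w v - p' w v‖ := by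
        gcongr
      _ = K * ‖X w v - X' w v‖ + c * b * ‖q w v - q' w v‖ + c * b * ‖p w v - p' w v‖ := by
        rw [hK]; ring
      _ ≤ K * ‖X w v - X' w v‖ + K * ‖q w v - q' w v‖ + K * ‖p w v - p' w v‖ := by gcongr
      _ = _ := by simp only [hg]; ring
  have cl : ∀ v : ℝ, Continuous fun y : ℝ => (y, v) := fun v => by fun_prop
  have cr : ∀ w : ℝ, Continuous fun y : ℝ => (w, y) := fun w => by fun_prop
  have hsub : ∀ {x y : ℝ}, x ∈ Icc (-T) T → y ∈ Icc (-T) T → uIcc x y ⊆ Icc (-T) T :=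
    fun hx hy => OrdConnected.uIcc_subset ordConnected_Icc hx hy
  have hg0 : ∀ w v, 0 ≤ g w v := fun w v => by simp only [hg]; positivity
  have hint : ∀ {f f' : ℝ → E} {s : ℝ → ℝ} {x y : ℝ}, (∀ z, HasDerivAt f (f' z) z) →
      Continuous f' → Continuous s → f x = 0 → (∀ z ∈ uIcc x y, ‖f' z‖ ≤ K * s z) →
      ‖f y‖ ≤ K * |∫ z in x..y, s z| := fun {f f' s x y} hd hf' hs hx hle => by
    have h1 := norm_intervalIntegral_le_of_le (f := f') (g := fun z => K * s z) (a := x) (b := y)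
      (continuous_const.mul hs) hle
    rwa [intervalIntegral.integral_eq_sub_of_hasDerivAt (fun z _ => hd z)
      (hf'.intervalIntegrable _ _), hx, sub_zero, intervalIntegral.integral_const_mul, abs_mul,
      abs_of_nonneg (by linarith)] at h1
  -- The differences of `X` and of `p` are recovered along `w`, that of `q` along `v`; the two
  -- integrals in the direction `w` account for the constant `2 * K`.
  have := eq_zero_of_le_integral_diag (a := -T) (b := T) (K := 2 * K) (by linarith) hgc hg0
    (fun w hw v hv => by
      have hqint : ‖X w v - X' w v‖ ≤ K * |∫ y in v..w, g y v| :=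
        hint (f := fun y => X y v - X' y v) (f' := fun y => q y v - q' y v) (s := fun y => g y v)
          (fun y => (h.hasDerivAt_left y v).sub (h'.hasDerivAt_left y v))
          ((h.continuous_q.sub h'.continuous_q).comp (cl v)) (hgc.comp (cl v))
          (sub_eq_zero.2 (hX v)) (fun y _ => by
            have h1 : ‖q y v - q' y v‖ ≤ g y v := by
              simp only [hg]; linarith [norm_nonneg (X y v - X' y v), norm_nonneg (p y v - p' y v)]
            exact h1.trans (le_mul_of_one_le_left (hg0 _ _) hK1))
      have hpint : ‖p w v - p' w v‖ ≤ K * |∫ y in v..w, g y v| :=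
        hint (f := fun y => p y v - p' y v) (f' := fun y => G y v) (s := fun y => g y v)
          (fun y => (h.hasDerivAt_p y v).sub (h'.hasDerivAt_p y v))
          (hGcont.comp (cl v)) (hgc.comp (cl v)) (sub_eq_zero.2 (hp v))
          (fun y hy => hGb y (hsub hv hw hy) v hv)
      have hqint' : ‖q w v - q' w v‖ ≤ K * |∫ y in w..v, g w y| :=
        hint (f := fun y => q w y - q' w y) (f' := fun y => G w y) (s := fun y => g w y)
          (fun y => (h.hasDerivAt_q w y).sub (h'.hasDerivAt_q w y))
          (hGcont.comp (cr w)) (hgc.comp (cr w)) (sub_eq_zero.2 (hq w))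
          (fun y hy => hGb w hw y (hsub hw hv hy))
      have : g w v = ‖X w v - X' w v‖ + ‖p w v - p' w v‖ + ‖q w v - q' w v‖ := rfl
      have h0 : 0 ≤ K * |∫ y in w..v, g w y| := by positivity
      linarith)
    w₁ (abs_le.1 (le_max_left _ _)) v₁ (abs_le.1 (le_max_right _ _))
  have h0 : ‖X w₁ v₁ - X' w₁ v₁‖ ≤ 0 := by
    have e : g w₁ v₁ = ‖X w₁ v₁ - X' w₁ v₁‖ + ‖p w₁ v₁ - p' w₁ v₁‖ + ‖q w₁ v₁ - q' w₁ v₁‖ := rfl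
    linarith [norm_nonneg (p w₁ v₁ - p' w₁ v₁), norm_nonneg (q w₁ v₁ - q' w₁ v₁)]
  exact sub_eq_zero.1 (norm_le_zero_iff.1 h0)

/-! ### Comparison of two solutions -/

theorem IsNullSolution.norm_source_sub_le (h : IsNullSolution N S k X p q)
    (h' : IsNullSolution N S k X' p' q') (hN : IsNullForm N N' S C) {A P Q w v : ℝ}
    (hX : ‖X w v - X' w v‖ ≤ A) (hp : ‖p w v - p' w v‖ ≤ P) (hq : ‖q w v - q' w v‖ ≤ Q) :
    ‖N (X w v) (q w v) (p w v) - N (X' w v) (q' w v) (p' w v)‖ ≤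
      C * A * k w * k v + C * Q * k v + C * k w * P := by
  have h0 := hN.pos.le
  have hA := (norm_nonneg _).trans hX
  have hP := (norm_nonneg _).trans hp
  have hQ := (norm_nonneg _).trans hq
  have hkw := (norm_nonneg _).trans (h.norm_q_le w v)
  refine (hN.norm_apply_sub_le (h.mem w v) (h'.mem w v) _ _ _ _).trans ?_
  gcongr
  · exact h.norm_q_le w v
  · exact h.norm_p_le w v
  · exact h.norm_p_le w v
  · exact h'.norm_q_le w v

/-- Along `v = const` the difference of the sources is bounded by a multiple of `k(y)` plus a
multiple of `Q(y)`. Both are integrable in `y`, so the bound does not deteriorate with the distance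
from the diagonal. -/
theorem IsNullSolution.norm_sub_p_le [CompleteSpace E] (h : IsNullSolution N S k X p q)
    (h' : IsNullSolution N S k X' p' q') (hN : IsNullForm N N' S C) (hk : Integrable k)
    {w v A P : ℝ} {Q : ℝ → ℝ} (hQ : Integrable Q) (hQ0 : ∀ y, 0 ≤ Q y)
    (hX : ∀ y ∈ uIcc v w, ‖X y v - X' y v‖ ≤ A) (hp : ∀ y ∈ uIcc v w, ‖p y v - p' y v‖ ≤ P)
    (hq : ∀ y ∈ uIcc v w, ‖q y v - q' y v‖ ≤ Q y) :
    ‖p w v - p' w v‖ ≤ ‖p v v - p' v v‖ + (C * A * k v + C * P) * (∫ y, k y) +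
      C * k v * ∫ y, Q y := by
  have hk0 : ∀ y, 0 ≤ k y := fun y => (norm_nonneg _).trans (h.norm_p_le 0 y)
  have hA : 0 ≤ A := (norm_nonneg _).trans (hX v left_mem_uIcc)
  have hP : 0 ≤ P := (norm_nonneg _).trans (hp v left_mem_uIcc)
  have hC := hN.pos.le
  have cl : Continuous fun y : ℝ => (y, v) := by fun_prop
  have e := intervalIntegral.integral_eq_sub_of_hasDerivAt (a := v) (b := w)
    (fun y _ => (h.hasDerivAt_p y v).sub (h'.hasDerivAt_p y v))
    ((((h.continuous_source hN).comp cl).sub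
      ((h'.continuous_source hN).comp cl)).intervalIntegrable _ _)
  have := norm_intervalIntegral_le_integral_add (x := v) (y := w)
    (f := fun y => N (X y v) (q y v) (p y v) - N (X' y v) (q' y v) (p' y v))
    (α := C * A * k v + C * P) (β := C * k v) hk hQ hk0 hQ0
    (by have := hk0 v; positivity) (by have := hk0 v; positivity) (fun y hy =>
      (h.norm_source_sub_le h' hN (hX y hy) (hp y hy) (hq y hy)).trans (le_of_eq (by ring)))
  have e2 : p w v - p' w v = (p v v - p' v v) + (p w v - p' w v - (p v v - p' v v)) := by abel
  rw [e2]
  refine (norm_add_le _ _).trans ?_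
  rw [add_assoc]
  gcongr
  exact (le_of_eq (congrArg _ e.symm)).trans this

/-- Two solutions with close data of small total variation stay close, together with their first
derivatives. -/
theorem IsNullSolution.norm_sub_le [CompleteSpace E] (h : IsNullSolution N S k X p q)
    (h' : IsNullSolution N S k X' p' q') (hN : IsNullForm N N' S C) (hkc : Continuous k)
    (hk0 : ∀ y, 0 < k y) (hk : Integrable k) (hCk : C * ∫ y, k y ≤ 1 / 100) {d : ℝ → ℝ} {D : ℝ}
    (hdc : Continuous d) (hd0 : ∀ y, 0 ≤ d y) (hd : Integrable d) (hD : 0 < D)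
    (hdD : ∫ y, d y ≤ D) (hX : ∀ y, ‖X y y - X' y y‖ ≤ D) (hp : ∀ y, ‖p y y - p' y y‖ ≤ d y)
    (hq : ∀ y, ‖q y y - q' y y‖ ≤ d y) (w v : ℝ) :
    ‖X w v - X' w v‖ ≤ 5 * D ∧ ‖p w v - p' w v‖ ≤ 2 * d v + (8 * C + 1) * D * k v ∧
      ‖q w v - q' w v‖ ≤ 2 * d w + (8 * C + 1) * D * k w := by
  set κ := ∫ y, k y with hκ
  have hκ0 : 0 ≤ κ := integral_nonneg fun y => (hk0 y).le
  have hC1 := hN.one_le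
  have hC0 := hN.pos
  have hκ1 : κ ≤ 1 / 100 := by nlinarith
  set P : ℝ → ℝ := fun y => 2 * d y + (8 * C + 1) * D * k y with hPdef
  have hP0 : ∀ y, 0 < P y := fun y => by
    have := hk0 y; have := hd0 y; simp only [hPdef]; positivity
  have hPc : Continuous P := by simp only [hPdef]; fun_prop
  have hPi : Integrable P := (hd.const_mul 2).add (hk.const_mul _)
  have hPint : ∫ y, P y ≤ 21 / 10 * D := by
    have : ∫ y, P y = 2 * (∫ y, d y) + (8 * C + 1) * D * κ := by
      simp only [hPdef]
      rw [integral_add (hd.const_mul 2) (hk.const_mul _), integral_const_mul, integral_const_mul]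
    rw [this]
    nlinarith
  set T := max |w| |v|
  have hXn : Continuous fun u : ℝ × ℝ => ‖X u.1 u.2 - X' u.1 u.2‖ :=
    (h.toIsNullField.continuous.sub h'.toIsNullField.continuous).norm
  have hpn : Continuous fun u : ℝ × ℝ => ‖p u.1 u.2 - p' u.1 u.2‖ :=
    (h.continuous_p.sub h'.continuous_p).norm
  have hqn : Continuous fun u : ℝ × ℝ => ‖q u.1 u.2 - q' u.1 u.2‖ :=
    (h.continuous_q.sub h'.continuous_q).norm
  have hFc : Continuous fun u : ℝ × ℝ => max (‖X u.1 u.2 - X' u.1 u.2‖ / (5 * D))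
      (max (‖p u.1 u.2 - p' u.1 u.2‖ / P u.2) (‖q u.1 u.2 - q' u.1 u.2‖ / P u.1)) :=
    (hXn.div_const _).max ((hpn.div (hPc.comp continuous_snd) fun u => (hP0 _).ne').max
      (hqn.div (hPc.comp continuous_fst) fun u => (hP0 _).ne'))
  have hw : w ∈ Icc (-T) T := abs_le.1 (le_max_left _ _)
  have hv : v ∈ Icc (-T) T := abs_le.1 (le_max_right _ _)
  obtain ⟨u₀, hu₀, hmax⟩ := ((isCompact_Icc (a := -T) (b := T)).prod isCompact_Icc).exists_isMaxOn
    ⟨(w, v), hw, hv⟩ hFc.continuousOn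
  -- `M` is the largest ratio, over the square, of the three differences to their target bounds.
  -- Since the paths to the diagonal stay in the square, integration shows that every ratio is at
  -- most `1/2 + M/2`, whence `M ≤ 1`.
  set M := max (‖X u₀.1 u₀.2 - X' u₀.1 u₀.2‖ / (5 * D)) (max (‖p u₀.1 u₀.2 - p' u₀.1 u₀.2‖ / P u₀.2)
    (‖q u₀.1 u₀.2 - q' u₀.1 u₀.2‖ / P u₀.1)) with hM
  have hM0 : 0 ≤ M := le_max_of_le_left (by positivity)
  have hMX : ∀ w ∈ Icc (-T) T, ∀ v ∈ Icc (-T) T, ‖X w v - X' w v‖ ≤ M * (5 * D) :=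
    fun w hw v hv => by
      rw [← div_le_iff₀ (by positivity)]
      exact (le_max_left _ _).trans (hmax (show (w, v) ∈ _ from ⟨hw, hv⟩))
  have hMp : ∀ w ∈ Icc (-T) T, ∀ v ∈ Icc (-T) T, ‖p w v - p' w v‖ ≤ M * P v :=
    fun w hw v hv => by
      rw [← div_le_iff₀ (hP0 _)]
      exact ((le_max_left _ _).trans (le_max_right _ _)).trans
        (hmax (show (w, v) ∈ _ from ⟨hw, hv⟩))
  have hMq : ∀ w ∈ Icc (-T) T, ∀ v ∈ Icc (-T) T, ‖q w v - q' w v‖ ≤ M * P w :=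
    fun w hw v hv => by
      rw [← div_le_iff₀ (hP0 _)]
      exact ((le_max_right _ _).trans (le_max_right _ _)).trans
        (hmax (show (w, v) ∈ _ from ⟨hw, hv⟩))
  have hsub : ∀ {x y : ℝ}, x ∈ Icc (-T) T → y ∈ Icc (-T) T → uIcc x y ⊆ Icc (-T) T :=
    fun hx hy => OrdConnected.uIcc_subset ordConnected_Icc hx hy
  have hMPi : Integrable fun y => M * P y := hPi.const_mul M
  have hMP0 : ∀ y, 0 ≤ M * P y := fun y => mul_nonneg hM0 (hP0 y).le
  -- The constants in `P` are made for this inequality: the data use `d ≤ P / 2`, and `8 C D k`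
  -- leaves room for `C k ∫ P`, where `∫ P ≤ 2.1 D`.
  have harith : ∀ y, d y + (C * (M * (5 * D)) * k y + C * (M * P y)) * κ +
      C * k y * (M * ∫ z, P z) ≤ (1 / 2 + M / 2) * P y := fun y => by
    have hky := (hk0 y).le
    have hdy := hd0 y
    have a1 : C * κ * (5 * D * k y + P y) ≤ 1 / 100 * (5 * D * k y + P y) := by
      have := hP0 y; gcongr
    have a2 : C * k y * ∫ z, P z ≤ C * k y * (21 / 10 * D) := by gcongr
    have a3 : 0 ≤ D * k y := by positivity
    have a4 : D * k y ≤ C * (D * k y) := le_mul_of_one_le_left a3 hC1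
    have a5 : C * κ * (5 * D * k y + P y) + C * k y * ∫ z, P z ≤ 1 / 2 * P y := by
      simp only [hPdef] at a1 a2 ⊢
      nlinarith
    have a6 : d y ≤ 1 / 2 * P y := by simp only [hPdef]; nlinarith
    nlinarith [mul_le_mul_of_nonneg_left a5 hM0]
  have hcontrp : ∀ w ∈ Icc (-T) T, ∀ v ∈ Icc (-T) T, ‖p w v - p' w v‖ ≤ (1 / 2 + M / 2) * P v :=
    fun w hw v hv => by
      have := h.norm_sub_p_le h' hN hk (w := w) (v := v) hMPi hMP0
        (fun y hy => hMX y (hsub hv hw hy) v hv) (fun y hy => hMp y (hsub hv hw hy) v hv)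
        (fun y hy => hMq y (hsub hv hw hy) v hv)
      rw [integral_const_mul] at this
      linarith [harith v, hp v]
  have hcontrq : ∀ w ∈ Icc (-T) T, ∀ v ∈ Icc (-T) T, ‖q w v - q' w v‖ ≤ (1 / 2 + M / 2) * P w :=
    fun w hw v hv => by
      have := h.swap.norm_sub_p_le h'.swap hN.flip hk (w := v) (v := w) hMPi hMP0
        (fun y hy => hMX w hw y (hsub hw hv hy)) (fun y hy => hMq w hw y (hsub hw hv hy))
        (fun y hy => hMp w hw y (hsub hw hv hy))
      rw [integral_const_mul] at this
      linarith [harith w, hq w]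
  have hcontrX : ∀ w ∈ Icc (-T) T, ∀ v ∈ Icc (-T) T,
      ‖X w v - X' w v‖ ≤ (1 / 2 + M / 2) * (5 * D) := fun w hw v hv => by
    have cl : Continuous fun y : ℝ => (y, v) := by fun_prop
    have e := intervalIntegral.integral_eq_sub_of_hasDerivAt (a := v) (b := w)
      (fun y _ => (h.hasDerivAt_left y v).sub (h'.hasDerivAt_left y v))
      (((h.continuous_q.comp cl).sub (h'.continuous_q.comp cl)).intervalIntegrable _ _)
    have i1 := norm_intervalIntegral_le_integral (f := fun y => q y v - q' y v) (a := v) (b := w)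
      hPi (fun y => (hP0 y).le) hM0 (fun y hy => hMq y (hsub hv hw hy) v hv)
    have e2 : X w v - X' w v = (X v v - X' v v) + (X w v - X' w v - (X v v - X' v v)) := by abel
    rw [e2]
    refine (norm_add_le _ _).trans ?_
    have i2 : ‖X w v - X' w v - (X v v - X' v v)‖ ≤ M * ∫ y, P y :=
      (le_of_eq (congrArg _ e.symm)).trans i1
    have i3 := hX v
    have i4 : M * ∫ y, P y ≤ M * (21 / 10 * D) := by gcongr
    nlinarith [mul_nonneg hM0 hD.le]
  have hM1 : M ≤ 1 := by
    have : M ≤ 1 / 2 + M / 2 := by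
      refine max_le ?_ (max_le ?_ ?_)
      · rw [div_le_iff₀ (by positivity)]; exact hcontrX _ hu₀.1 _ hu₀.2
      · rw [div_le_iff₀ (hP0 _)]; exact hcontrp _ hu₀.1 _ hu₀.2
      · rw [div_le_iff₀ (hP0 _)]; exact hcontrq _ hu₀.1 _ hu₀.2
    linarith
  exact ⟨(hMX w hw v hv).trans (mul_le_of_le_one_left (by positivity) hM1),
    (hMp w hw v hv).trans (mul_le_of_le_one_left (hP0 v).le hM1),
    (hMq w hw v hv).trans (mul_le_of_le_one_left (hP0 w).le hM1)⟩

/-- The `v`-derivative of the source `N(X)(q, p)`, where `a` stands for `p_v`. -/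
noncomputable def sourceDeriv (N : E → E →L[ℝ] E →L[ℝ] E) (N' : E → E →L[ℝ] E →L[ℝ] E →L[ℝ] E)
    (x q p a : E) : E := N' x p q p + N x (N x q p) p + N x q a

theorem IsNullSolution.hasDerivAt_source (h : IsNullSolution N S k X p q)
    (hN : IsNullForm N N' S C) (ha : ∀ w v, HasDerivAt (fun y => p w y) (a w v) v) (w v : ℝ) :
    HasDerivAt (fun y => N (X w y) (q w y) (p w y))
      (sourceDeriv N N' (X w v) (q w v) (p w v) (a w v)) v :=
  (h.hasDerivAt_form hN w v).clm_apply (ha w v)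

theorem IsNullSolution.continuous_sourceDeriv (h : IsNullSolution N S k X p q)
    (hN : IsNullForm N N' S C) (hac : Continuous (Function.uncurry a)) :
    Continuous (Function.uncurry fun w v =>
      sourceDeriv N N' (X w v) (q w v) (p w v) (a w v)) :=
  ((h.continuous_deriv_form hN).clm_apply h.continuous_p).add
    (((h.continuous_form hN).clm_apply h.continuous_q).clm_apply hac)

/-- With fixed endpoints `v` and `w`, the integral of the source at height `x` equals `p w x - p v
x`. Differentiating at `x = v` therefore gives no boundary term. -/
theorem IsNullSolution.deriv_p_eq [CompleteSpace E] (h : IsNullSolution N S k X p q) (hN : IsNullForm N N' S C)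
    (hac : Continuous (Function.uncurry a)) (ha : ∀ w v, HasDerivAt (fun y => p w y) (a w v) v)
    (w v : ℝ) : a w v - a v v =
      ∫ y in v..w, sourceDeriv N N' (X y v) (q y v) (p y v) (a y v) := by
  have h1 := hasDerivAt_integral_param
    (f := fun v w => N (X w v) (q w v) (p w v))
    (f₁ := fun v w => sourceDeriv N N' (X w v) (q w v) (p w v) (a w v))
    (fun v w => h.hasDerivAt_source hN ha w v) ((h.continuous_source hN).comp continuous_swap)
    ((h.continuous_sourceDeriv hN hac).comp continuous_swap) v w v
  have h2 : (fun x => ∫ y in v..w, N (X y x) (q y x) (p y x)) = fun x => p w x - p v x := by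
    funext x
    have cl : Continuous fun y : ℝ => (y, x) := by fun_prop
    exact intervalIntegral.integral_eq_sub_of_hasDerivAt (fun y _ => h.hasDerivAt_p y x)
      (((h.continuous_source hN).comp cl).intervalIntegrable _ _)
  rw [h2] at h1
  exact ((ha w v).sub (ha v v)).unique h1

/-- The bound is arranged as a multiple of `k w` plus a multiple of `Q`, the two quantities that
will be integrated in `w`, with coefficients attached to `v`. -/
theorem IsNullSolution.norm_sourceDeriv_sub_le (h : IsNullSolution N S k X p q)
    (h' : IsNullSolution N S k X' p' q') (hN : IsNullForm N N' S C) {A P Q l e w v : ℝ}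
    (hX : ‖X w v - X' w v‖ ≤ A) (hp : ‖p w v - p' w v‖ ≤ P) (hq : ‖q w v - q' w v‖ ≤ Q)
    (hl : ‖a' w v‖ ≤ l) (he : ‖a w v - a' w v‖ ≤ e) :
    ‖sourceDeriv N N' (X w v) (q w v) (p w v) (a w v) -
      sourceDeriv N N' (X' w v) (q' w v) (p' w v) (a' w v)‖ ≤
      (3 * C ^ 2 * A * k v ^ 2 + 4 * C ^ 2 * P * k v + C * A * l + C * e) * k w +
        (2 * C ^ 2 * k v ^ 2 + C * l) * Q := by
  have hC0 := hN.pos.le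
  have hC1 := hN.one_le
  have hA := (norm_nonneg _).trans hX
  have hP := (norm_nonneg _).trans hp
  have hQ := (norm_nonneg _).trans hq
  have hl0 := (norm_nonneg _).trans hl
  have he0 := (norm_nonneg _).trans he
  have hkw := (norm_nonneg _).trans (h.norm_q_le w v)
  have hkv := (norm_nonneg _).trans (h.norm_p_le w v)
  have b1 := h.norm_p_le w v
  have b2 := h.norm_q_le w v
  have b1' := h'.norm_p_le w v
  have b2' := h'.norm_q_le w v
  have mX := h.mem w v
  have mX' := h'.mem w v
  have hCC : C ≤ C ^ 2 := by nlinarith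
  have t1 : ‖N' (X w v) (p w v) (q w v) (p w v) - N' (X' w v) (p' w v) (q' w v) (p' w v)‖ ≤
      (C * A * k v + C * P) * k w * k v + C * k v * Q * k v + C * k v * k w * P := by
    have hB : ‖N' (X' w v) (p' w v)‖ ≤ C * k v :=
      (N' _).le_of_opNorm_le_of_le (hN.norm_deriv_le _ mX') b1'
    have hD : ‖N' (X w v) (p w v) - N' (X' w v) (p' w v)‖ ≤ C * A * k v + C * P := by
      refine (norm_apply_sub_apply_le _ _ _ _).trans ?_
      gcongr
      · exact (hN.lipschitz_deriv _ mX _ mX').trans (by gcongr)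
      · exact hN.norm_deriv_le _ mX'
    refine (norm_apply₂_sub_le _ _ _ _ _ _).trans ?_
    gcongr
  have t2 : ‖N (X w v) (N (X w v) (q w v) (p w v)) (p w v) -
      N (X' w v) (N (X' w v) (q' w v) (p' w v)) (p' w v)‖ ≤
      C * A * (C * k w * k v) * k v + C * (C * A * k w * k v + C * Q * k v + C * k w * P) * k v +
        C * (C * k w * k v) * P := by
    have g1 : ‖N (X w v) (q w v) (p w v)‖ ≤ C * k w * k v :=
      (hN.norm_apply_le mX _ _).trans (by gcongr)
    have g2 : ‖N (X' w v) (q' w v) (p' w v)‖ ≤ C * k w * k v :=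
      (hN.norm_apply_le mX' _ _).trans (by gcongr)
    refine (hN.norm_apply_sub_le mX mX' _ _ _ _).trans ?_
    gcongr
    exact h.norm_source_sub_le h' hN hX hp hq
  have t3 : ‖N (X w v) (q w v) (a w v) - N (X' w v) (q' w v) (a' w v)‖ ≤
      C * A * k w * l + C * Q * l + C * k w * e := by
    rw [norm_sub_rev]
    refine (hN.norm_apply_sub_le mX' mX _ _ _ _).trans ?_
    rw [norm_sub_rev (X' w v), norm_sub_rev (q' w v), norm_sub_rev (a' w v)]
    gcongr
  have e1 : ∀ x y z x' y' z' : E, x + y + z - (x' + y' + z') = (x - x') + (y - y') + (z - z') :=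
    fun x y z x' y' z' => by abel
  unfold sourceDeriv
  rw [e1]
  refine (norm_add₃_le).trans ((add_le_add_three t1 t2 t3).trans ?_)
  have s1 : C * (A * k v ^ 2 * k w) ≤ C ^ 2 * (A * k v ^ 2 * k w) := by gcongr
  have s2 : C * (P * k v * k w) ≤ C ^ 2 * (P * k v * k w) := by gcongr
  have s3 : C * (k v ^ 2 * Q) ≤ C ^ 2 * (k v ^ 2 * Q) := by gcongr
  nlinarith

/-- Comparison of the second derivatives `X_vv`. -/
theorem IsNullSolution.norm_sub_deriv_p_le [CompleteSpace E] (h : IsNullSolution N S k X p q)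
    (h' : IsNullSolution N S k X' p' q') (hN : IsNullForm N N' S C) (hk : Integrable k)
    (hCk : C * ∫ y, k y ≤ 1 / 2) (hac : Continuous (Function.uncurry a))
    (ha : ∀ w v, HasDerivAt (fun y => p w y) (a w v) v) (hac' : Continuous (Function.uncurry a'))
    (ha' : ∀ w v, HasDerivAt (fun y => p' w y) (a' w v) v) {A : ℝ} {P l : ℝ → ℝ}
    (hP : Integrable P) (hX : ∀ w v, ‖X w v - X' w v‖ ≤ A) (hp : ∀ w v, ‖p w v - p' w v‖ ≤ P v)
    (hq : ∀ w v, ‖q w v - q' w v‖ ≤ P w) (hl : ∀ w v, ‖a' w v‖ ≤ l v) (hPA : ∫ y, P y ≤ A)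
    (w v : ℝ) :
    ‖a w v - a' w v‖ ≤ 2 * ‖a v v - a' v v‖ +
      10 * C ^ 2 * (A * k v ^ 2 + P v * k v + A * l v) := by
  have hk0 : ∀ y, 0 ≤ k y := fun y => (norm_nonneg _).trans (h.norm_p_le 0 y)
  have hP0 : ∀ y, 0 ≤ P y := fun y => (norm_nonneg _).trans (hp 0 y)
  have hl0 : ∀ y, 0 ≤ l y := fun y => (norm_nonneg _).trans (hl 0 y)
  have hA : 0 ≤ A := (norm_nonneg _).trans (hX 0 0)
  have hC1 := hN.one_le
  have hC0 := hN.pos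
  have hκ0 : 0 ≤ ∫ y, k y := integral_nonneg hk0
  have cl : Continuous fun y : ℝ => (y, v) := by fun_prop
  have hec : Continuous fun y => ‖a y v - a' y v‖ := ((hac.comp cl).sub (hac'.comp cl)).norm
  obtain ⟨y₀, hy₀, hmax⟩ := (isCompact_uIcc (a := v) (b := w)).exists_isMaxOn
    ⟨w, right_mem_uIcc⟩ hec.continuousOn
  -- The maximum is over the segment back to the diagonal. The difference `a - a'` enters the
  -- differentiated source linearly with the factor `C k`, so its contribution `C M ∫ k ≤ M / 2` is
  -- absorbed.
  set M := ‖a y₀ v - a' y₀ v‖ with hM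
  have hMb : ∀ y ∈ uIcc v w, ‖a y v - a' y v‖ ≤ M := fun y hy => hmax hy
  have hkv := hk0 v
  have hPv := hP0 v
  have hlv := hl0 v
  have hcontr : M ≤ ‖a v v - a' v v‖ +
      ((3 * C ^ 2 * A * k v ^ 2 + 4 * C ^ 2 * P v * k v + C * A * l v + C * M) * (∫ y, k y) +
        (2 * C ^ 2 * k v ^ 2 + C * l v) * ∫ y, P y) := by
    have e : a y₀ v - a' y₀ v = (a v v - a' v v) + ∫ y in v..y₀,
        (sourceDeriv N N' (X y v) (q y v) (p y v) (a y v) -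
          sourceDeriv N N' (X' y v) (q' y v) (p' y v) (a' y v)) := by
      have c1 : Continuous fun y => sourceDeriv N N' (X y v) (q y v) (p y v) (a y v) :=
        (h.continuous_sourceDeriv hN hac).comp cl
      have c2 : Continuous fun y => sourceDeriv N N' (X' y v) (q' y v) (p' y v) (a' y v) :=
        (h'.continuous_sourceDeriv hN hac').comp cl
      rw [intervalIntegral.integral_sub (c1.intervalIntegrable _ _) (c2.intervalIntegrable _ _),
        ← h.deriv_p_eq hN hac ha, ← h'.deriv_p_eq hN hac' ha']
      abel
    refine (le_of_eq (congrArg norm e)).trans ((norm_add_le _ _).trans ?_)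
    gcongr
    refine norm_intervalIntegral_le_integral_add hk hP hk0 hP0 (by positivity) (by positivity)
      fun y hy => h.norm_sourceDeriv_sub_le h' hN (hX y v) (hp y v) (hq y v) (hl y v)
        (hMb y (uIcc_subset_uIcc_left hy₀ hy))
  have h1 := hMb w right_mem_uIcc
  refine h1.trans ?_
  have b1 : (3 * C ^ 2 * A * k v ^ 2 + 4 * C ^ 2 * P v * k v + C * A * l v + C * M) * (∫ y, k y) ≤
      (3 * C ^ 2 * A * k v ^ 2 + 4 * C ^ 2 * P v * k v + C * A * l v) / 2 + M / 2 := by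
    have hκ : ∫ y, k y ≤ 1 / 2 := by nlinarith
    have hM0 : 0 ≤ M := norm_nonneg _
    have i1 : (3 * C ^ 2 * A * k v ^ 2 + 4 * C ^ 2 * P v * k v + C * A * l v) * (∫ y, k y) ≤
        (3 * C ^ 2 * A * k v ^ 2 + 4 * C ^ 2 * P v * k v + C * A * l v) * (1 / 2) := by gcongr
    have i2 : (C * ∫ y, k y) * M ≤ 1 / 2 * M := by gcongr
    nlinarith
  have b2 : (2 * C ^ 2 * k v ^ 2 + C * l v) * ∫ y, P y ≤ (2 * C ^ 2 * k v ^ 2 + C * l v) * A := by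
    gcongr
  have hCC : C ≤ C ^ 2 := by nlinarith
  have b3 : C * (A * l v) ≤ C ^ 2 * (A * l v) := by gcongr
  have b4 : 0 ≤ C ^ 2 * (A * k v ^ 2) := by positivity
  have b5 : 0 ≤ C ^ 2 * (P v * k v) := by positivity
  have b6 : 0 ≤ C ^ 2 * (A * l v) := by positivity
  nlinarith

end Comparison

/-! ### The soliton profile -/

theorem hasDerivAt_tanh (x : ℝ) : HasDerivAt Real.tanh (1 - Real.tanh x ^ 2) x := by
  have h : Real.tanh = fun x => Real.sinh x / Real.cosh x :=
    funext Real.tanh_eq_sinh_div_cosh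
  have hc := (Real.cosh_pos x).ne'
  have := (Real.hasDerivAt_sinh x).div (Real.hasDerivAt_cosh x) hc
  rw [h]
  refine this.congr_deriv ?_
  field_simp

/-- The hyperbolic cosine of the first component of the soliton. -/
noncomputable def solF (n s β β' a b : ℝ) : ℝ :=
  n * Real.cosh (a + b) - s * Real.tanh (β * a + β' * b) * Real.sinh (a + b)

/-- The argument of the arctangent in the second component of the soliton. -/
noncomputable def solG (r β β' a b : ℝ) : ℝ :=
  Real.sinh (β * a + β' * b) * Real.cosh (a + b) +
    r * Real.cosh (β * a + β' * b) * Real.sinh (a + b)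

/-- The suffixes denote derivatives in `a` and `b`. As `F` and `G` are invariant under `(a, β) ↔ (b,
β')`, the derivative in `b` is the `a`-derivative with the pairs exchanged. -/
noncomputable def solFa (n s β β' a b : ℝ) : ℝ :=
  n * Real.sinh (a + b) - s * (β * (1 - Real.tanh (β * a + β' * b) ^ 2) * Real.sinh (a + b) +
    Real.tanh (β * a + β' * b) * Real.cosh (a + b))

noncomputable def solFab (n s β β' a b : ℝ) : ℝ :=
  n * Real.cosh (a + b) - s * ((β + β') * (1 - Real.tanh (β * a + β' * b) ^ 2) * Real.cosh (a + b) -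
    2 * (β * β') * Real.tanh (β * a + β' * b) * (1 - Real.tanh (β * a + β' * b) ^ 2) *
      Real.sinh (a + b) + Real.tanh (β * a + β' * b) * Real.sinh (a + b))

noncomputable def solGa (r β β' a b : ℝ) : ℝ :=
  β * Real.cosh (β * a + β' * b) * Real.cosh (a + b) +
    Real.sinh (β * a + β' * b) * Real.sinh (a + b) +
    r * (β * Real.sinh (β * a + β' * b) * Real.sinh (a + b) +
      Real.cosh (β * a + β' * b) * Real.cosh (a + b))

noncomputable def solGab (r β β' a b : ℝ) : ℝ :=
  (β * β' + 1) * Real.sinh (β * a + β' * b) * Real.cosh (a + b) +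
    (β + β') * Real.cosh (β * a + β' * b) * Real.sinh (a + b) +
    r * ((β * β' + 1) * Real.cosh (β * a + β' * b) * Real.sinh (a + b) +
      (β + β') * Real.sinh (β * a + β' * b) * Real.cosh (a + b))

/-! ### Derivatives of the soliton formulas. -/

section SolitonDerivatives

variable (n s r β β' a b : ℝ)

theorem hasDerivAt_sum_left : HasDerivAt (fun y => y + b) 1 a := (hasDerivAt_id a).add_const b

theorem hasDerivAt_sum_right : HasDerivAt (fun y => a + y) 1 b := (hasDerivAt_id b).const_add a

theorem hasDerivAt_phase_left : HasDerivAt (fun y => β * y + β' * b) β a := by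
  simpa using ((hasDerivAt_id a).const_mul β).add_const (β' * b)

theorem hasDerivAt_phase_right : HasDerivAt (fun y => β * a + β' * y) β' b := by
  simpa using ((hasDerivAt_id b).const_mul β').const_add (β * a)

theorem hasDerivAt_solF : HasDerivAt (fun y => solF n s β β' y b) (solFa n s β β' a b) a := by
  have h1 := hasDerivAt_sum_left a b
  have h2 := (hasDerivAt_tanh (β * a + β' * b)).comp a (hasDerivAt_phase_left β β' a b)
  refine ((h1.cosh.const_mul n).sub ((h2.const_mul s).mul h1.sinh)).congr_deriv ?_
  simp only [solFa, Function.comp_apply]; ring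

theorem hasDerivAt_solFa :
    HasDerivAt (fun y => solFa n s β β' a y) (solFab n s β β' a b) b := by
  have h1 := hasDerivAt_sum_right a b
  have h2 := (hasDerivAt_tanh (β * a + β' * b)).comp b (hasDerivAt_phase_right β β' a b)
  refine ((h1.sinh.const_mul n).sub ((((((h2.pow 2).const_sub 1).const_mul β).mul h1.sinh).add
    (h2.mul h1.cosh)).const_mul s)).congr_deriv ?_
  simp only [solFab, Function.comp_apply, Pi.pow_apply]; push_cast; ring

theorem hasDerivAt_solG : HasDerivAt (fun y => solG r β β' y b) (solGa r β β' a b) a := by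
  have h1 := hasDerivAt_sum_left a b
  have h2 := hasDerivAt_phase_left β β' a b
  refine ((h2.sinh.mul h1.cosh).add ((h2.cosh.const_mul r).mul h1.sinh)).congr_deriv ?_
  simp only [solGa]; ring

theorem hasDerivAt_solGa : HasDerivAt (fun y => solGa r β β' a y) (solGab r β β' a b) b := by
  have h1 := hasDerivAt_sum_right a b
  have h2 := hasDerivAt_phase_right β β' a b
  refine ((((h2.cosh.const_mul β).mul h1.cosh).add (h2.sinh.mul h1.sinh)).add
    ((((h2.sinh.const_mul β).mul h1.sinh).add (h2.cosh.mul h1.cosh)).const_mul r)).congr_deriv ?_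
  simp only [solGab]; ring

theorem solF_swap : solF n s β β' a b = solF n s β' β b a := by
  simp only [solF, add_comm]

theorem solG_swap : solG r β β' a b = solG r β' β b a := by
  simp only [solG, add_comm]

end SolitonDerivatives

/-- The relations between the soliton parameters. -/
structure IsSolitonParam (n s r β β' : ℝ) : Prop where
  n_pos : 0 < n
  s_ne : s ≠ 0
  sq : s ^ 2 = n ^ 2 - 1
  hr : s * r = -n
  sum_mul : s * (β + β') = 2 * n
  prod : β * β' = 1

/-! ### Algebraic identities that make the soliton a solution. -/

section SolitonIdentities

variable {n s r β β' : ℝ}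

theorem IsSolitonParam.swap (h : IsSolitonParam n s r β β') : IsSolitonParam n s r β' β :=
  ⟨h.n_pos, h.s_ne, h.sq, h.hr, by rw [add_comm]; exact h.sum_mul, by rw [mul_comm]; exact h.prod⟩

theorem tanh_mul_cosh (x : ℝ) : Real.tanh x * Real.cosh x = Real.sinh x := by
  rw [Real.tanh_eq_sinh_div_cosh, div_mul_cancel₀ _ (Real.cosh_pos x).ne']

theorem one_sub_tanh_sq_mul (x : ℝ) : (1 - Real.tanh x ^ 2) * Real.cosh x ^ 2 = 1 := by
  have h1 := tanh_mul_cosh x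
  have h2 := Real.cosh_sq x
  calc _ = Real.cosh x ^ 2 - (Real.tanh x * Real.cosh x) ^ 2 := by ring
    _ = 1 := by rw [h1, h2]; ring

/-- With `F = cosh Λ` and phase `Y` this says `sinh² Λ cosh² Y = s² (1 + G²)`. It ties the two
components of the soliton together and lets `1 + G²` be traded for `F² - 1`. -/
theorem IsSolitonParam.solF_sq (h : IsSolitonParam n s r β β') (a b : ℝ) :
    (solF n s β β' a b ^ 2 - 1) * Real.cosh (β * a + β' * b) ^ 2 =
      s ^ 2 * (1 + solG r β β' a b ^ 2) := by
  have h1 := tanh_mul_cosh (β * a + β' * b)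
  have h2 := Real.cosh_sq (β * a + β' * b)
  have h3 := Real.cosh_sq (a + b)
  have h4 := h.sq
  have h5 := h.hr
  simp only [solF, solG]
  generalize Real.tanh (β * a + β' * b) = T at *
  generalize Real.cosh (β * a + β' * b) = c at *
  generalize Real.sinh (β * a + β' * b) = z at *
  generalize Real.cosh (a + b) = x at *
  generalize Real.sinh (a + b) = y at *
  subst h1
  grind

/-- `F² > 1` is read off `solF_sq`; the sign is positive because `s² < n²` and `tanh² ≤ 1` let the
term `n cosh` dominate. -/
theorem IsSolitonParam.one_lt_solF (h : IsSolitonParam n s r β β') (a b : ℝ) :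
    1 < solF n s β β' a b := by
  have hc := Real.cosh_pos (β * a + β' * b)
  have hs : 0 < s ^ 2 := by have := h.s_ne; positivity
  have h1 : 0 < solF n s β β' a b ^ 2 - 1 := by
    have := h.solF_sq a b
    have h2 : 0 < s ^ 2 * (1 + solG r β β' a b ^ 2) := by positivity
    rw [← this] at h2
    exact pos_of_mul_pos_left h2 (by positivity)
  have h2 : 0 < solF n s β β' a b := by
    have hq := one_sub_tanh_sq_mul (β * a + β' * b)
    have hT : Real.tanh (β * a + β' * b) ^ 2 ≤ 1 := by
      by_contra! hlt
      nlinarith [sq_nonneg (Real.cosh (β * a + β' * b))]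
    have h3 := Real.cosh_sq (a + b)
    have hx := Real.cosh_pos (a + b)
    have hn := h.n_pos
    have h4 : (s * Real.tanh (β * a + β' * b) * Real.sinh (a + b)) ^ 2 <
        (n * Real.cosh (a + b)) ^ 2 := by
      calc _ = s ^ 2 * (Real.tanh (β * a + β' * b) ^ 2 * Real.sinh (a + b) ^ 2) := by ring
        _ ≤ s ^ 2 * (1 * Real.sinh (a + b) ^ 2) := by gcongr
        _ < (n * Real.cosh (a + b)) ^ 2 := by
          rw [mul_pow, h3, h.sq]; nlinarith [sq_nonneg (Real.sinh (a + b)), sq_nonneg n]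
    have := (abs_lt_of_sq_lt_sq' h4 (by positivity)).2
    simp only [solF]; linarith
  nlinarith

/-- The logarithmic derivative of `solF_sq` in `a`, cleared of denominators. -/
theorem IsSolitonParam.solF_mul_solFa (h : IsSolitonParam n s r β β') (a b : ℝ) :
    solF n s β β' a b * solFa n s β β' a b * (1 + solG r β β' a b ^ 2) =
      (solF n s β β' a b ^ 2 - 1) * (solG r β β' a b * solGa r β β' a b -
        β * Real.tanh (β * a + β' * b) * (1 + solG r β β' a b ^ 2)) := by
  have hc := (Real.cosh_pos (β * a + β' * b)).ne'
  have hd1 := ((hasDerivAt_solF n s β β' a b).pow 2).sub_const 1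
  have hd2 := hd1.mul ((hasDerivAt_phase_left β β' a b).cosh.pow 2)
  have hd3 := (((hasDerivAt_solG r β β' a b).pow 2).const_add 1).const_mul (s ^ 2)
  have e : (fun y => solF n s β β' y b ^ 2 - 1) * (fun y => Real.cosh (β * y + β' * b)) ^ 2 =
      fun y => s ^ 2 * (1 + solG r β β' y b ^ 2) := funext fun y => h.solF_sq y b
  have e2 := hd2.unique (e ▸ hd3)
  have e3 := h.solF_sq a b
  have e4 := tanh_mul_cosh (β * a + β' * b)
  simp only [Pi.pow_apply, Nat.cast_ofNat, Nat.add_one_sub_one, pow_one] at e2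
  generalize Real.tanh (β * a + β' * b) = T at *
  generalize Real.cosh (β * a + β' * b) = c at *
  generalize Real.sinh (β * a + β' * b) = z at *
  generalize solF n s β β' a b = F at *
  generalize solG r β β' a b = G at *
  generalize solFa n s β β' a b = Fa at *
  generalize solGa r β β' a b = Ga at *
  subst e4
  have hc2 : c ^ 2 ≠ 0 := by positivity
  apply mul_right_cancel₀ hc2
  linear_combination (1 + G ^ 2) / 2 * e2 - (G * Ga) * e3

/-- This is the equation for `Λ` without denominators: the first factor on the left is the numerator
of `(arcosh F)_ab`, and `G_a G_b` comes from the derivatives of the arctangent. Multiplication by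
`cosh⁴ Y` and `solF_sq` make it polynomial. -/
theorem IsSolitonParam.solFab_identity (h : IsSolitonParam n s r β β') (a b : ℝ) :
    (solFab n s β β' a b * (solF n s β β' a b ^ 2 - 1) -
      solF n s β β' a b * solFa n s β β' a b * solFa n s β' β b a) *
        (1 + solG r β β' a b ^ 2) ^ 2 =
      solF n s β β' a b * (solF n s β β' a b ^ 2 - 1) ^ 2 *
        (solGa r β β' a b * solGa r β' β b a) := by
  have hc := (Real.cosh_pos (β * a + β' * b)).ne'
  have e1 := h.solF_sq a b
  have hs := h.s_ne
  have hQ := one_sub_tanh_sq_mul (β * a + β' * b)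
  have hT := tanh_mul_cosh (β * a + β' * b)
  have hch := Real.cosh_sq (a + b)
  have hcY : β' * b + β * a = β * a + β' * b := add_comm _ _
  have hba : b + a = a + b := add_comm _ _
  have hsum := h.sum_mul
  have hprod := h.prod
  have hsq := h.sq
  have hr := h.hr
  -- `s β` and `s β'` have sum `2 n` and product `s² = n² - 1`, so they are `n ± e` with `e² = 1`.
  -- In these terms `s² G_a` and `s² G_b` factor.
  obtain ⟨e, he⟩ : ∃ e, s * β = n + e := ⟨s * β - n, by ring⟩
  have he' : s * β' = n - e := by linear_combination hsum - he
  have hee : e ^ 2 = 1 := by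
    linear_combination -hsq - s ^ 2 * hprod + s * β' * he + (n + e) * he'
  have key : (solFab n s β β' a b * (solF n s β β' a b ^ 2 - 1) -
      solF n s β β' a b * solFa n s β β' a b * solFa n s β' β b a) *
        Real.cosh (β * a + β' * b) ^ 4 =
      solF n s β β' a b * s ^ 4 * (solGa r β β' a b * solGa r β' β b a) := by
    simp only [solF, solFa, solFab, solGa, hcY, hba]
    generalize Real.tanh (β * a + β' * b) = T at *
    generalize Real.cosh (β * a + β' * b) = c at *
    generalize Real.sinh (β * a + β' * b) = z at *
    generalize Real.cosh (a + b) = x at *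
    generalize Real.sinh (a + b) = y at *
    subst hT
    obtain ⟨Q, hQd⟩ : ∃ Q, Q = 1 - T ^ 2 := ⟨_, rfl⟩
    rw [← hQd] at hQ ⊢
    have f1 : n * y - s * (β * Q * y + T * x) = n * y - (n + e) * Q * y - s * T * x := by
      linear_combination (-Q * y) * he
    have f2 : n * y - s * (β' * Q * y + T * x) = n * y - (n - e) * Q * y - s * T * x := by
      linear_combination (-Q * y) * he'
    have f3 : n * x - s * ((β + β') * Q * x - 2 * (β * β') * T * Q * y + T * y) =
        (1 - 2 * Q) * (n * x - s * T * y) := by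
      linear_combination (-Q * x) * hsum + (2 * s * T * Q * y) * hprod
    have g1 : s ^ 2 * (β * c * x + T * c * y + r * (β * (T * c) * y + c * x)) =
        c * (e * (s * x - (n + e) * T * y)) := by
      linear_combination (s * c * x + s * r * T * c * y) * he + (n + e) * T * c * y * hr +
        (s * c * x) * hr + (T * c * y) * hsq + T * c * y * hee
    have g2 : s ^ 2 * (β' * c * x + T * c * y + r * (β' * (T * c) * y + c * x)) =
        c * (-e * (s * x - (n - e) * T * y)) := by
      linear_combination (s * c * x + s * r * T * c * y) * he' + (n - e) * T * c * y * hr +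
        (s * c * x) * hr + (T * c * y) * hsq + T * c * y * hee
    -- What remains of the identity after `F = n x - s T y` and the powers of `c` are taken out.
    have main : (1 - 2 * Q) * ((n * x - s * T * y) ^ 2 - 1) -
        (n * y - (n + e) * Q * y - s * T * x) * (n * y - (n - e) * Q * y - s * T * x) =
        -Q * ((s * x - (n + e) * T * y) * (s * x - (n - e) * T * y)) := by
      subst hQd
      linear_combination (2 * T ^ 2 - 1) * hch +
        (-T ^ 2 * x ^ 2 + (2 * T ^ 2 - 1) * T ^ 2 * y ^ 2 + (1 - T ^ 2) * x ^ 2) * hsq +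
        ((1 - T ^ 2) ^ 2 - (1 - T ^ 2) * T ^ 2) * y ^ 2 * hee
    rw [f1, f2, f3]
    linear_combination (n * x - s * T * y) * c ^ 4 * main -
      (n * x - s * T * y) * (s ^ 2 * (β' * c * x + T * c * y + r * (β' * (T * c) * y + c * x))) *
        g1 - (n * x - s * T * y) * (c * (e * (s * x - (n + e) * T * y))) * g2 -
      (n * x - s * T * y) * c ^ 2 * ((s * x - (n + e) * T * y) * (s * x - (n - e) * T * y)) *
        hQ + (n * x - s * T * y) * c ^ 2 *
          ((s * x - (n + e) * T * y) * (s * x - (n - e) * T * y)) * hee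
  have hc4 : Real.cosh (β * a + β' * b) ^ 4 ≠ 0 := by positivity
  apply mul_right_cancel₀ hc4
  linear_combination (1 + solG r β β' a b ^ 2) ^ 2 * key - solF n s β β' a b * (solGa r β β' a b * solGa r β' β b a) * (s ^ 2 * (1 + solG r β β' a b ^ 2) + (solF n s β β' a b ^ 2 - 1) * Real.cosh (β * a + β' * b) ^ 2) * e1

/-- It rests on `2 r = -(β + β')` and `β β' = 1`. In the equation for `φ` the factors `tanh Y` here
cancel those of `solF_mul_solFa`. -/
theorem IsSolitonParam.solGab_identity (h : IsSolitonParam n s r β β') (a b : ℝ) :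
    solGab r β β' a b = Real.tanh (β * a + β' * b) *
      (β' * solGa r β β' a b + β * solGa r β' β b a) := by
  have hT := tanh_mul_cosh (β * a + β' * b)
  have hcY : β' * b + β * a = β * a + β' * b := add_comm _ _
  have hba : b + a = a + b := add_comm _ _
  have hprod := h.prod
  have hb : 2 * r = -(β + β') := by
    have h1 := h.hr
    have h2 := h.sum_mul
    apply mul_left_cancel₀ h.s_ne
    linarith
  simp only [solGab, solGa, hcY, hba]
  generalize Real.tanh (β * a + β' * b) = T at *
  generalize Real.cosh (β * a + β' * b) = c at *
  generalize Real.sinh (β * a + β' * b) = z at *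
  generalize Real.cosh (a + b) = x at *
  generalize Real.sinh (a + b) = y at *
  subst hT
  have hb' : r = -(β + β') / 2 := by linarith
  subst hb'
  grind

end SolitonIdentities

/-! ### The null form of the PCF system -/

/-- The bilinear map `(q, p) ↦ (q₂ p₂, 0)`. -/
noncomputable def bilin₁ : ℝ × ℝ →L[ℝ] ℝ × ℝ →L[ℝ] ℝ × ℝ :=
  (ContinuousLinearMap.compL ℝ (ℝ × ℝ) ℝ (ℝ × ℝ) (ContinuousLinearMap.inl ℝ ℝ ℝ)).comp
    ((ContinuousLinearMap.mul ℝ ℝ).bilinearComp (ContinuousLinearMap.snd ℝ ℝ ℝ)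
      (ContinuousLinearMap.snd ℝ ℝ ℝ))

/-- The bilinear map `(q, p) ↦ (0, q₁ p₂ + q₂ p₁)`. -/
noncomputable def bilin₂ : ℝ × ℝ →L[ℝ] ℝ × ℝ →L[ℝ] ℝ × ℝ :=
  (ContinuousLinearMap.compL ℝ (ℝ × ℝ) ℝ (ℝ × ℝ) (ContinuousLinearMap.inr ℝ ℝ ℝ)).comp
    ((ContinuousLinearMap.mul ℝ ℝ).bilinearComp (ContinuousLinearMap.fst ℝ ℝ ℝ)
      (ContinuousLinearMap.snd ℝ ℝ ℝ) +
    (ContinuousLinearMap.mul ℝ ℝ).bilinearComp (ContinuousLinearMap.snd ℝ ℝ ℝ)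
      (ContinuousLinearMap.fst ℝ ℝ ℝ))

theorem bilin₁_apply (q p : ℝ × ℝ) : bilin₁ q p = (q.2 * p.2, 0) := by simp [bilin₁]

theorem bilin₂_apply (q p : ℝ × ℝ) : bilin₂ q p = (0, q.1 * p.2 + q.2 * p.1) := by simp [bilin₂]

/-- Since `∂ₜ = ∂_v - ∂_w` and `∂ₓ = ∂_v + ∂_w`, one has `∂ₜ² - ∂ₓ² = -4 ∂_w ∂_v`, and the quadratic
terms become products of a `w`- and a `v`-derivative. The coefficients depend on `Λ = y` alone and
are singular only at `0`, through `coth`. -/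
noncomputable def formCoeff (y : ℝ) : ℝ × ℝ →L[ℝ] ℝ × ℝ →L[ℝ] ℝ × ℝ :=
  (2 * Real.sinh (2 * y)) • bilin₁ + (-(Real.cosh y / Real.sinh y)) • bilin₂

noncomputable def formCoeff' (y : ℝ) : ℝ × ℝ →L[ℝ] ℝ × ℝ →L[ℝ] ℝ × ℝ :=
  (4 * Real.cosh (2 * y)) • bilin₁ + (1 / Real.sinh y ^ 2) • bilin₂

noncomputable def formCoeff'' (y : ℝ) : ℝ × ℝ →L[ℝ] ℝ × ℝ →L[ℝ] ℝ × ℝ :=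
  (8 * Real.sinh (2 * y)) • bilin₁ + (-(2 * Real.cosh y / Real.sinh y ^ 3)) • bilin₂

/-- The null form of the PCF system. -/
noncomputable def pcfForm (x : ℝ × ℝ) : ℝ × ℝ →L[ℝ] ℝ × ℝ →L[ℝ] ℝ × ℝ := formCoeff x.1

noncomputable def pcfForm' (x : ℝ × ℝ) : ℝ × ℝ →L[ℝ] ℝ × ℝ →L[ℝ] ℝ × ℝ →L[ℝ] ℝ × ℝ :=
  (ContinuousLinearMap.fst ℝ ℝ ℝ).smulRight (formCoeff' x.1)

theorem pcfForm_apply (x q p : ℝ × ℝ) :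
    pcfForm x q p = (2 * Real.sinh (2 * x.1) * (q.2 * p.2),
      -(Real.cosh x.1 / Real.sinh x.1) * (q.1 * p.2 + q.2 * p.1)) := by
  simp [pcfForm, formCoeff, bilin₁_apply, bilin₂_apply]

theorem hasDerivAt_two_mul (y : ℝ) : HasDerivAt (fun y : ℝ => 2 * y) 2 y := by
  simpa using (hasDerivAt_id y).const_mul (2 : ℝ)

theorem hasDerivAt_formCoeff {y : ℝ} (hy : 0 < y) : HasDerivAt formCoeff (formCoeff' y) y := by
  have hs : Real.sinh y ≠ 0 := (Real.sinh_pos_iff.2 hy).ne'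
  have h1 : HasDerivAt (fun y => 2 * Real.sinh (2 * y)) (4 * Real.cosh (2 * y)) y := by
    refine ((hasDerivAt_two_mul y).sinh.const_mul 2).congr_deriv ?_; ring
  have h2 : HasDerivAt (fun y => -(Real.cosh y / Real.sinh y)) (1 / Real.sinh y ^ 2) y := by
    refine ((Real.hasDerivAt_cosh y).div (Real.hasDerivAt_sinh y) hs).neg.congr_deriv ?_
    field_simp
    linarith [Real.cosh_sq y]
  exact (h1.smul_const bilin₁).add (h2.smul_const bilin₂)

theorem hasDerivAt_formCoeff' {y : ℝ} (hy : 0 < y) : HasDerivAt formCoeff' (formCoeff'' y) y := by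
  have hs : Real.sinh y ≠ 0 := (Real.sinh_pos_iff.2 hy).ne'
  have h1 : HasDerivAt (fun y => 4 * Real.cosh (2 * y)) (8 * Real.sinh (2 * y)) y := by
    refine ((hasDerivAt_two_mul y).cosh.const_mul 4).congr_deriv ?_; ring
  have h2 : HasDerivAt (fun y => 1 / Real.sinh y ^ 2) (-(2 * Real.cosh y / Real.sinh y ^ 3)) y := by
    have := (((Real.hasDerivAt_sinh y).pow 2).inv (pow_ne_zero 2 hs))
    simp only [one_div]
    refine this.congr_deriv ?_
    simp only [Pi.pow_apply]
    field_simp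
    norm_num
    ring
  exact (h1.smul_const bilin₁).add (h2.smul_const bilin₂)

theorem continuousOn_formCoeff'' : ContinuousOn formCoeff'' (Ioi 0) := by
  have h : ContinuousOn (fun y : ℝ => -(2 * Real.cosh y / Real.sinh y ^ 3)) (Ioi 0) := by
    refine (ContinuousOn.div (by fun_prop) (by fun_prop) fun y hy => ?_).neg
    exact pow_ne_zero _ (Real.sinh_pos_iff.2 hy).ne'
  have h1 : ContinuousOn (fun y : ℝ => 8 * Real.sinh (2 * y)) (Ioi 0) := by
    exact Continuous.continuousOn (by fun_prop)
  exact (h1.smul continuousOn_const).add (h.smul continuousOn_const)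

theorem exists_formCoeff_bound {c d : ℝ} (hc : 0 < c) : ∃ C : ℝ, 1 ≤ C ∧ ∀ y ∈ Icc c d,
    ‖formCoeff y‖ ≤ C ∧ ‖formCoeff' y‖ ≤ C ∧ ∀ z ∈ Icc c d,
      ‖formCoeff y - formCoeff z‖ ≤ C * |y - z| ∧ ‖formCoeff' y - formCoeff' z‖ ≤ C * |y - z| := by
  have hpos : ∀ y ∈ Icc c d, 0 < y := fun y hy => hc.trans_le hy.1
  obtain ⟨C₀, h₀⟩ := (isCompact_Icc (a := c) (b := d)).exists_bound_of_continuousOn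
    (f := formCoeff) fun y hy => (hasDerivAt_formCoeff (hpos y hy)).continuousAt.continuousWithinAt
  obtain ⟨C₁, h₁⟩ := (isCompact_Icc (a := c) (b := d)).exists_bound_of_continuousOn
    (f := formCoeff') fun y hy =>
      (hasDerivAt_formCoeff' (hpos y hy)).continuousAt.continuousWithinAt
  obtain ⟨C₂, h₂⟩ := (isCompact_Icc (a := c) (b := d)).exists_bound_of_continuousOn
    (f := formCoeff'') (continuousOn_formCoeff''.mono hpos)
  set C := max 1 (max C₀ (max C₁ C₂)) with hC
  have e0 : C₀ ≤ C := (le_max_left _ _).trans (le_max_right _ _)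
  have e1 : C₁ ≤ C := (le_max_left _ _).trans ((le_max_right _ _).trans (le_max_right _ _))
  have e2 : C₂ ≤ C := (le_max_right _ _).trans ((le_max_right _ _).trans (le_max_right _ _))
  refine ⟨C, le_max_left _ _, fun y hy => ⟨(h₀ y hy).trans e0, (h₁ y hy).trans e1,
    fun z hz => ⟨?_, ?_⟩⟩⟩
  · exact (convex_Icc c d).norm_image_sub_le_of_norm_hasDerivWithin_le
      (fun y hy => (hasDerivAt_formCoeff (hpos y hy)).hasDerivWithinAt)
      (fun y hy => (h₁ y hy).trans e1) hz hy
  · exact (convex_Icc c d).norm_image_sub_le_of_norm_hasDerivWithin_le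
      (fun y hy => (hasDerivAt_formCoeff' (hpos y hy)).hasDerivWithinAt)
      (fun y hy => (h₂ y hy).trans e2) hz hy

/-- The condition `ρ < x₀.1` keeps the first component on the ball in a compact interval of positive
numbers, where `coth` and its derivatives are bounded. -/
theorem exists_isNullForm_pcfForm {x₀ : ℝ × ℝ} {ρ : ℝ} (h : ρ < x₀.1) :
    ∃ C, IsNullForm pcfForm pcfForm' (Metric.closedBall x₀ ρ) C := by
  obtain ⟨C, hC1, hC⟩ := exists_formCoeff_bound (c := x₀.1 - ρ) (d := x₀.1 + ρ) (by linarith)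
  have hm : ∀ x ∈ Metric.closedBall x₀ ρ, x.1 ∈ Icc (x₀.1 - ρ) (x₀.1 + ρ) := fun x hx => by
    rw [mem_closedBall_iff_norm] at hx
    have := abs_le.1 ((norm_fst_le (x - x₀)).trans hx)
    simp only [Prod.fst_sub] at this
    exact ⟨by linarith [this.1], by linarith [this.2]⟩
  have hlip : ∀ x y : ℝ × ℝ, C * |x.1 - y.1| ≤ C * ‖x - y‖ := fun x y => by
    gcongr; exact norm_fst_le (x - y)
  have hsm : ∀ T : ℝ × ℝ →L[ℝ] ℝ × ℝ →L[ℝ] ℝ × ℝ,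
      ‖(ContinuousLinearMap.fst ℝ ℝ ℝ).smulRight T‖ ≤ ‖T‖ := fun T => by
    rw [ContinuousLinearMap.norm_smulRight_apply]
    exact mul_le_of_le_one_left (norm_nonneg _) (ContinuousLinearMap.norm_fst_le ℝ ℝ ℝ)
  refine ⟨C, hC1, fun x hx => ?_, fun x hx => (hC _ (hm x hx)).1,
    fun x hx => (hsm _).trans (hC _ (hm x hx)).2.1,
    fun x hx y hy => (((hC _ (hm x hx)).2.2 _ (hm y hy)).1).trans (hlip x y), fun x hx y hy => ?_⟩
  · have hp : 0 < x.1 := by have := (hm x hx).1; linarith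
    have := (hasDerivAt_formCoeff hp).hasFDerivAt.comp x
      (ContinuousLinearMap.fst ℝ ℝ ℝ).hasFDerivAt
    refine this.congr_fderiv ?_
    ext <;> simp [pcfForm']
  · have e : pcfForm' x - pcfForm' y =
        (ContinuousLinearMap.fst ℝ ℝ ℝ).smulRight (formCoeff' x.1 - formCoeff' y.1) := by
      refine ContinuousLinearMap.ext fun z => ?_
      simp [pcfForm', smul_sub]
    rw [e]
    exact ((hsm _).trans ((hC _ (hm x hx)).2.2 _ (hm y hy)).2).trans (hlip x y)

/-! ### The soliton profile as a map into the target -/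

section Profile

variable {n s r β β' : ℝ}

/-- The soliton as a function of `(γ₁, γ₂)`. -/
noncomputable def solPsi (n s r β β' a b : ℝ) : ℝ × ℝ :=
  (Real.arcosh (solF n s β β' a b), Real.pi / 4 - 1 / 2 * Real.arctan (solG r β β' a b))

noncomputable def solPsiA (n s r β β' a b : ℝ) : ℝ × ℝ :=
  (solFa n s β β' a b / √(solF n s β β' a b ^ 2 - 1),
    -(1 / 2) * (solGa r β β' a b / (1 + solG r β β' a b ^ 2)))

theorem solPsi_swap (n s r β β' a b : ℝ) : solPsi n s r β β' a b = solPsi n s r β' β b a := by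
  simp only [solPsi, solF_swap n s β β', solG_swap r β β']

theorem IsSolitonParam.hasDerivAt_solPsi (h : IsSolitonParam n s r β β') (a b : ℝ) :
    HasDerivAt (fun y => solPsi n s r β β' y b) (solPsiA n s r β β' a b) a := by
  have h1 := (Real.hasDerivAt_arcosh (h.one_lt_solF a b)).comp a (hasDerivAt_solF n s β β' a b)
  have h2 := ((hasDerivAt_solG r β β' a b).arctan.const_mul (1 / 2)).const_sub (Real.pi / 4)
  refine (h1.prodMk h2).congr_deriv ?_
  simp only [solPsiA, Prod.mk.injEq]
  exact ⟨by ring, by ring⟩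

theorem IsSolitonParam.solF_sq_pos (h : IsSolitonParam n s r β β') (a b : ℝ) :
    0 < solF n s β β' a b ^ 2 - 1 := by
  have := h.one_lt_solF a b
  nlinarith

/-- In the variables `(γ₁, γ₂)` the soliton solves the null-form equation exactly. The first
component is `solFab_identity`; the second combines `solGab_identity` with the logarithmic
derivatives in both variables. -/
theorem IsSolitonParam.hasDerivAt_solPsiA (h : IsSolitonParam n s r β β') (a b : ℝ) :
    HasDerivAt (fun y => solPsiA n s r β β' a y)
      (pcfForm (solPsi n s r β β' a b) (solPsiA n s r β' β b a) (solPsiA n s r β β' a b)) b := by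
  have hF1 := h.one_lt_solF a b
  have hpos := h.solF_sq_pos a b
  have dF : HasDerivAt (fun y => solF n s β β' a y) (solFa n s β' β b a) b := by
    have := hasDerivAt_solF n s β' β b a
    simpa only [solF_swap n s β' β] using this
  have dG : HasDerivAt (fun y => solG r β β' a y) (solGa r β' β b a) b := by
    have := hasDerivAt_solG r β' β b a
    simpa only [solG_swap r β' β] using this
  have hR : √(solF n s β β' a b ^ 2 - 1) ≠ 0 := (Real.sqrt_pos.2 hpos).ne'
  have hG0 : 1 + solG r β β' a b ^ 2 ≠ 0 := by positivity
  have d1 := (hasDerivAt_solFa n s β β' a b).div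
    (((dF.pow 2).sub_const 1).sqrt hpos.ne') hR
  have d2 := ((hasDerivAt_solGa r β β' a b).div ((dG.pow 2).const_add 1) hG0).const_mul (-(1 / 2))
  refine (d1.prodMk d2).congr_deriv ?_
  have i1 := h.solFab_identity a b
  have i2 := h.solGab_identity a b
  have i3 := h.solF_mul_solFa a b
  have i4 := h.swap.solF_mul_solFa b a
  rw [solF_swap n s β' β, solG_swap r β' β, add_comm (β' * b)] at i4
  have hR2 : √(solF n s β β' a b ^ 2 - 1) ^ 2 = solF n s β β' a b ^ 2 - 1 := Real.sq_sqrt hpos.le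
  rw [pcfForm_apply]
  simp only [solPsi, solPsiA, Pi.pow_apply]
  rw [Real.sinh_two_mul, Real.sinh_arcosh hF1.le, Real.cosh_arcosh hF1.le,
    solF_swap n s β' β b a, solG_swap r β' β b a]
  have hβ := h.prod
  generalize √(solF n s β β' a b ^ 2 - 1) = R at *
  generalize solF n s β β' a b = F at *
  generalize solG r β β' a b = G at *
  generalize solFa n s β β' a b = Fa at *
  generalize solGa r β β' a b = Ga at *
  generalize solFa n s β' β b a = Fb at *
  generalize solGa r β' β b a = Gb at *
  generalize solFab n s β β' a b = Fab at *
  generalize solGab r β β' a b = Gab at *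
  generalize Real.tanh (β * a + β' * b) = T at *
  rw [← hR2] at i1 i3 i4
  rw [Prod.mk.injEq]
  constructor
  · have e : (Fab * R - Fa * (F * Fb / R)) / R ^ 2 = F * R * (Ga * Gb) / (1 + G ^ 2) ^ 2 := by
      rw [div_eq_div_iff (by positivity) (by positivity)]
      field_simp
      linear_combination i1
    calc _ = (Fab * R - Fa * (F * Fb / R)) / R ^ 2 := by
          congr 2; field_simp; push_cast; ring
      _ = _ := e
      _ = _ := by field_simp
  · have hR2' : R ^ 2 ≠ 0 := pow_ne_zero 2 hR
    -- The left side is the derivative of `log sinh Λ`, that is `coth Λ Λ_a`. In the sum taken below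
    -- the terms with `T` add up to `-Gab` by `i2`.
    have j3 : F * Fa / R ^ 2 = G * Ga / (1 + G ^ 2) - β * T := by
      rw [div_eq_iff hR2']; field_simp; linear_combination i3
    have j4 : F * Fb / R ^ 2 = G * Gb / (1 + G ^ 2) - β' * T := by
      rw [div_eq_iff hR2']; field_simp; linear_combination i4
    calc _ = -(1 / 2) * (Gab / (1 + G ^ 2) - 2 * G * Ga * Gb / (1 + G ^ 2) ^ 2) := by
          field_simp; push_cast; ring
      _ = 1 / 2 * (1 / (1 + G ^ 2)) * (Ga * (F * Fb / R ^ 2) + Gb * (F * Fa / R ^ 2)) := by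
          rw [j3, j4, i2]; field_simp; ring
      _ = _ := by field_simp; ring

theorem contDiff_tanh : ContDiff ℝ ∞ Real.tanh := by
  have h : Real.tanh = fun x => Real.sinh x / Real.cosh x :=
    funext Real.tanh_eq_sinh_div_cosh
  rw [h]
  exact Real.contDiff_sinh.div Real.contDiff_cosh fun x => (Real.cosh_pos x).ne'

theorem contDiff_solF (n s β β' : ℝ) : ContDiff ℝ ∞ (Function.uncurry (solF n s β β')) := by
  have h1 : ContDiff ℝ ∞ fun u : ℝ × ℝ => u.1 + u.2 := by fun_prop
  have h2 : ContDiff ℝ ∞ fun u : ℝ × ℝ => β * u.1 + β' * u.2 := by fun_prop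
  exact (contDiff_const.mul h1.cosh).sub ((contDiff_const.mul (contDiff_tanh.comp h2)).mul h1.sinh)

theorem contDiff_solFa (n s β β' : ℝ) : ContDiff ℝ ∞ (Function.uncurry (solFa n s β β')) := by
  have h1 : ContDiff ℝ ∞ fun u : ℝ × ℝ => u.1 + u.2 := by fun_prop
  have h2 : ContDiff ℝ ∞ fun u : ℝ × ℝ => β * u.1 + β' * u.2 := by fun_prop
  have h3 := contDiff_tanh.comp h2
  exact (contDiff_const.mul h1.sinh).sub (contDiff_const.mul
    (((contDiff_const.mul (contDiff_const.sub (h3.pow 2))).mul h1.sinh).add (h3.mul h1.cosh)))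

theorem contDiff_solG (r β β' : ℝ) : ContDiff ℝ ∞ (Function.uncurry (solG r β β')) := by
  have h1 : ContDiff ℝ ∞ fun u : ℝ × ℝ => u.1 + u.2 := by fun_prop
  have h2 : ContDiff ℝ ∞ fun u : ℝ × ℝ => β * u.1 + β' * u.2 := by fun_prop
  exact (h2.sinh.mul h1.cosh).add ((contDiff_const.mul h2.cosh).mul h1.sinh)

theorem contDiff_solGa (r β β' : ℝ) : ContDiff ℝ ∞ (Function.uncurry (solGa r β β')) := by
  have h1 : ContDiff ℝ ∞ fun u : ℝ × ℝ => u.1 + u.2 := by fun_prop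
  have h2 : ContDiff ℝ ∞ fun u : ℝ × ℝ => β * u.1 + β' * u.2 := by fun_prop
  exact (((contDiff_const.mul h2.cosh).mul h1.cosh).add (h2.sinh.mul h1.sinh)).add
    (contDiff_const.mul (((contDiff_const.mul h2.sinh).mul h1.sinh).add (h2.cosh.mul h1.cosh)))

theorem IsSolitonParam.contDiff_solPsi (h : IsSolitonParam n s r β β') :
    ContDiff ℝ ∞ (Function.uncurry (solPsi n s r β β')) := by
  have h1 : ContDiff ℝ ∞ fun u : ℝ × ℝ => Real.arcosh (solF n s β β' u.1 u.2) :=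
    contDiff_iff_contDiffAt.2 fun u =>
      ContDiffAt.comp (g := Real.arcosh) (f := Function.uncurry (solF n s β β')) u
        (Real.contDiffAt_arcosh (h.one_lt_solF u.1 u.2))
        (contDiff_solF n s β β').contDiffAt
  have h2 : ContDiff ℝ ∞ fun u : ℝ × ℝ => Real.pi / 4 - 1 / 2 * Real.arctan (solG r β β' u.1 u.2) :=
    contDiff_const.sub (contDiff_const.mul (contDiff_solG r β β').arctan)
  exact h1.prodMk h2

theorem IsSolitonParam.contDiff_solPsiA (h : IsSolitonParam n s r β β') :
    ContDiff ℝ ∞ (Function.uncurry (solPsiA n s r β β')) := by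
  have h1 : ContDiff ℝ ∞ fun u : ℝ × ℝ =>
      solFa n s β β' u.1 u.2 / √(solF n s β β' u.1 u.2 ^ 2 - 1) :=
    (contDiff_solFa n s β β').div
      ((((contDiff_solF n s β β').pow 2).sub contDiff_const).sqrt
        fun u => (h.solF_sq_pos u.1 u.2).ne')
      fun u => (Real.sqrt_pos.2 (h.solF_sq_pos u.1 u.2)).ne'
  have h2 : ContDiff ℝ ∞ fun u : ℝ × ℝ =>
      -(1 / 2) * (solGa r β β' u.1 u.2 / (1 + solG r β β' u.1 u.2 ^ 2)) :=
    contDiff_const.mul ((contDiff_solGa r β β').div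
      (contDiff_const.add ((contDiff_solG r β β').pow 2)) fun u => by
        have : 0 < 1 + solG r β β' u.1 u.2 ^ 2 := by positivity
        exact this.ne')
  exact h1.prodMk h2

noncomputable def solPsiAA (n s r β β' a b : ℝ) : ℝ × ℝ :=
  fderiv ℝ (Function.uncurry (solPsiA n s r β β')) (a, b) (1, 0)

theorem IsSolitonParam.hasDerivAt_solPsiA_left (h : IsSolitonParam n s r β β') (a b : ℝ) :
    HasDerivAt (fun y => solPsiA n s r β β' y b) (solPsiAA n s r β β' a b) a := by
  have hd : HasDerivAt (fun y : ℝ => (y, b)) ((1 : ℝ), (0 : ℝ)) a :=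
    (hasDerivAt_id a).prodMk (hasDerivAt_const a b)
  exact HasFDerivAt.comp_hasDerivAt (f := fun y : ℝ => (y, b)) a
    ((h.contDiff_solPsiA.differentiable (by simp)) (a, b)).hasFDerivAt hd

theorem IsSolitonParam.continuous_solPsiAA (h : IsSolitonParam n s r β β') :
    Continuous (Function.uncurry (solPsiAA n s r β β')) :=
  (h.contDiff_solPsiA.continuous_fderiv (by simp)).clm_apply continuous_const

theorem isSolitonParam_of_pos {μ : ℝ} (hμ : 0 < μ) (hμ1 : μ ≠ 1) :
    IsSolitonParam |speed μ| (1 / sqrtc μ) (speed μ * sqrtc μ) (beta μ) (beta μ)⁻¹ := by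
  have h1 : μ - 1 ≠ 0 := sub_ne_zero.2 hμ1
  have h2 : μ + 1 ≠ 0 := by positivity
  have h3 : μ ^ 2 - 1 ≠ 0 := by
    have : μ ^ 2 - 1 = (μ - 1) * (μ + 1) := by ring
    rw [this]; exact mul_ne_zero h1 h2
  have hn : |speed μ| = (μ ^ 2 + 1) / (2 * μ) := by
    rw [speed, abs_div, abs_neg, abs_of_pos (by positivity : 0 < μ ^ 2 + 1),
      abs_of_pos (by positivity : 0 < 2 * μ)]
  have hv : speed μ = -((μ ^ 2 + 1) / (2 * μ)) := by rw [speed, neg_div]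
  have hc : sqrtc μ ≠ 0 := by rw [sqrtc]; positivity
  refine ⟨by rw [hn]; positivity, one_div_ne_zero hc, ?_, ?_, ?_, ?_⟩
  · rw [hn, sqrtc]; field_simp; ring
  · rw [hn, hv]; field_simp
  · rw [hn, sqrtc, beta]
    have h4 : μ ^ 2 - 1 = (μ - 1) * (μ + 1) := by ring
    rw [h4]
    field_simp; ring
  · exact mul_inv_cancel₀ (by rw [beta]; exact div_ne_zero h2 h1)

theorem solitonB_eq (θ σ : ℝ → ℝ) (μ lam ε t x : ℝ) :
    solitonB θ σ μ lam ε t x = (solPsi |speed μ| (1 / sqrtc μ) (speed μ * sqrtc μ) (beta μ)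
      (beta μ)⁻¹ (lam + ε * θ (x + t)) (ε * σ (x - t))).1 := rfl

theorem solitonD_eq (θ σ : ℝ → ℝ) (μ lam ε t x : ℝ) :
    solitonD θ σ μ lam ε t x = (solPsi |speed μ| (1 / sqrtc μ) (speed μ * sqrtc μ) (beta μ)
      (beta μ)⁻¹ (lam + ε * θ (x + t)) (ε * σ (x - t))).2 := by
  simp only [solitonD, solPsi, solG, phase, seed, gamma1, gamma2]
  rw [← tanh_mul_cosh (beta μ * _ + _), ← tanh_mul_cosh (lam + _ + _)]
  ring_nf

end Profile

/-! ### The soliton in null coordinates -/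

theorem pcfForm_symm (x q p : ℝ × ℝ) : pcfForm x q p = pcfForm x p q := by
  rw [pcfForm_apply, pcfForm_apply, Prod.mk.injEq]
  exact ⟨by ring, by ring⟩

section SolitonField

variable {n s r β β' : ℝ} {f g f' g' f'' g'' : ℝ → ℝ}

/-- Substituting `γ₁ = f(v)`, `γ₂ = g(w)` multiplies the derivatives by `f'` and `g'`, and the mixed
derivative by `f' g'`; by bilinearity the source acquires the same factor. -/
theorem IsSolitonParam.isNullField (h : IsSolitonParam n s r β β')
    (hf : ∀ y, HasDerivAt f (f' y) y) (hg : ∀ y, HasDerivAt g (g' y) y)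
    (hf' : Continuous f') (hg' : Continuous g') :
    IsNullField pcfForm (fun w v => solPsi n s r β β' (f v) (g w))
      (fun w v => f' v • solPsiA n s r β β' (f v) (g w))
      (fun w v => g' w • solPsiA n s r β' β (g w) (f v)) where
  hasDerivAt_right w v := (h.hasDerivAt_solPsi (f v) (g w)).scomp v (hf v)
  hasDerivAt_left w v := by
    simp only [solPsi_swap n s r β β']
    exact (h.swap.hasDerivAt_solPsi (g w) (f v)).scomp w (hg w)
  hasDerivAt_p w v := by
    refine (((h.hasDerivAt_solPsiA (f v) (g w)).scomp w (hg w)).const_smul (f' v)).congr_deriv ?_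
    simp
  hasDerivAt_q w v := by
    refine (((h.swap.hasDerivAt_solPsiA (g w) (f v)).scomp v (hf v)).const_smul
      (g' w)).congr_deriv ?_
    rw [pcfForm_symm, solPsi_swap n s r β' β]
    simp only [map_smul, smul_apply]
    rw [smul_comm]
  continuous_p := by
    have hfc : Continuous f := continuous_iff_continuousAt.2 fun y => (hf y).continuousAt
    have hgc : Continuous g := continuous_iff_continuousAt.2 fun y => (hg y).continuousAt
    have h1 : Continuous fun u : ℝ × ℝ => solPsiA n s r β β' (f u.2) (g u.1) :=
      h.contDiff_solPsiA.continuous.comp₂ (hfc.comp continuous_snd) (hgc.comp continuous_fst)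
    exact (hf'.comp continuous_snd).smul h1
  continuous_q := by
    have hfc : Continuous f := continuous_iff_continuousAt.2 fun y => (hf y).continuousAt
    have hgc : Continuous g := continuous_iff_continuousAt.2 fun y => (hg y).continuousAt
    have h1 : Continuous fun u : ℝ × ℝ => solPsiA n s r β' β (g u.1) (f u.2) :=
      h.swap.contDiff_solPsiA.continuous.comp₂ (hgc.comp continuous_fst) (hfc.comp continuous_snd)
    exact (hg'.comp continuous_fst).smul h1

theorem IsSolitonParam.hasDerivAt_deriv (h : IsSolitonParam n s r β β')
    (hf : ∀ y, HasDerivAt f (f' y) y) (hf' : ∀ y, HasDerivAt f' (f'' y) y) (b v : ℝ) :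
    HasDerivAt (fun y => f' y • solPsiA n s r β β' (f y) b)
      (f'' v • solPsiA n s r β β' (f v) b + f' v ^ 2 • solPsiAA n s r β β' (f v) b) v := by
  refine ((hf' v).smul ((h.hasDerivAt_solPsiA_left (f v) b).scomp v (hf v))).congr_deriv ?_
  rw [smul_smul, pow_two (f' v), add_comm]; rfl

theorem IsSolitonParam.continuous_deriv (h : IsSolitonParam n s r β β')
    (hf : Continuous f) (hf' : Continuous f') (hf'' : Continuous f'') (hg : Continuous g) :
    Continuous (Function.uncurry fun w v => f'' v • solPsiA n s r β β' (f v) (g w) +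
      f' v ^ 2 • solPsiAA n s r β β' (f v) (g w)) := by
  have h1 : Continuous fun u : ℝ × ℝ => solPsiA n s r β β' (f u.2) (g u.1) :=
    h.contDiff_solPsiA.continuous.comp₂ (hf.comp continuous_snd) (hg.comp continuous_fst)
  have h2 : Continuous fun u : ℝ × ℝ => solPsiAA n s r β β' (f u.2) (g u.1) :=
    h.continuous_solPsiAA.comp₂ (hf.comp continuous_snd) (hg.comp continuous_fst)
  exact ((hf''.comp continuous_snd).smul h1).add (((hf'.comp continuous_snd).pow 2).smul h2)

end SolitonField

/-! ### From null coordinates to `(t, x)` -/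

section ToTX

/-- A function of the null coordinates `(x - t, x + t)`, as a function of `(t, x)`. -/
def toTX (g : ℝ → ℝ → ℝ) (t x : ℝ) : ℝ := g (x - t) (x + t)

variable {g g₁ g₂ : ℝ → ℝ → ℝ}

theorem hasDerivAt_toTX_left (h₁ : ∀ w v, HasDerivAt (fun y => g y v) (g₁ w v) w)
    (h₂ : ∀ w v, HasDerivAt (fun y => g w y) (g₂ w v) v)
    (c₁ : Continuous (Function.uncurry g₁)) (c₂ : Continuous (Function.uncurry g₂)) (t x : ℝ) :
    HasDerivAt (fun τ => toTX g τ x) (g₂ (x - t) (x + t) - g₁ (x - t) (x + t)) t := by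
  have hd : HasDerivAt (fun τ : ℝ => (x - τ, x + τ)) ((-1 : ℝ), (1 : ℝ)) t :=
    ((hasDerivAt_id t).const_sub x).prodMk ((hasDerivAt_id t).const_add x)
  refine (HasFDerivAt.comp_hasDerivAt (f := fun τ : ℝ => (x - τ, x + τ)) t
    (hasStrictFDerivAt_of_partials h₁ h₂ c₁ c₂ _).hasFDerivAt hd).congr_deriv ?_
  simp; ring

theorem hasDerivAt_toTX_right (h₁ : ∀ w v, HasDerivAt (fun y => g y v) (g₁ w v) w)
    (h₂ : ∀ w v, HasDerivAt (fun y => g w y) (g₂ w v) v)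
    (c₁ : Continuous (Function.uncurry g₁)) (c₂ : Continuous (Function.uncurry g₂)) (t x : ℝ) :
    HasDerivAt (fun y => toTX g t y) (g₂ (x - t) (x + t) + g₁ (x - t) (x + t)) x := by
  have hd : HasDerivAt (fun y : ℝ => (y - t, y + t)) ((1 : ℝ), (1 : ℝ)) x :=
    ((hasDerivAt_id x).sub_const t).prodMk ((hasDerivAt_id x).add_const t)
  refine (HasFDerivAt.comp_hasDerivAt (f := fun y : ℝ => (y - t, y + t)) x
    (hasStrictFDerivAt_of_partials h₁ h₂ c₁ c₂ _).hasFDerivAt hd).congr_deriv ?_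
  simp; ring

theorem pdt_toTX (h₁ : ∀ w v, HasDerivAt (fun y => g y v) (g₁ w v) w)
    (h₂ : ∀ w v, HasDerivAt (fun y => g w y) (g₂ w v) v)
    (c₁ : Continuous (Function.uncurry g₁)) (c₂ : Continuous (Function.uncurry g₂)) :
    pdt (toTX g) = toTX fun w v => g₂ w v - g₁ w v :=
  funext fun t => funext fun x => (hasDerivAt_toTX_left h₁ h₂ c₁ c₂ t x).deriv

theorem pdx_toTX (h₁ : ∀ w v, HasDerivAt (fun y => g y v) (g₁ w v) w)
    (h₂ : ∀ w v, HasDerivAt (fun y => g w y) (g₂ w v) v)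
    (c₁ : Continuous (Function.uncurry g₁)) (c₂ : Continuous (Function.uncurry g₂)) :
    pdx (toTX g) = toTX fun w v => g₂ w v + g₁ w v :=
  funext fun t => funext fun x => (hasDerivAt_toTX_right h₁ h₂ c₁ c₂ t x).deriv

/-- First and second partial derivatives of a function of two null coordinates, with
`c = g_wv = g_vw`. -/
structure IsNullC2 (g p q a b c : ℝ → ℝ → ℝ) : Prop where
  hasDerivAt_right : ∀ w v, HasDerivAt (fun y => g w y) (p w v) v
  hasDerivAt_left : ∀ w v, HasDerivAt (fun y => g y v) (q w v) w
  hasDerivAt_p_right : ∀ w v, HasDerivAt (fun y => p w y) (a w v) v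
  hasDerivAt_p_left : ∀ w v, HasDerivAt (fun y => p y v) (c w v) w
  hasDerivAt_q_right : ∀ w v, HasDerivAt (fun y => q w y) (c w v) v
  hasDerivAt_q_left : ∀ w v, HasDerivAt (fun y => q y v) (b w v) w
  continuous_a : Continuous (Function.uncurry a)
  continuous_b : Continuous (Function.uncurry b)
  continuous_c : Continuous (Function.uncurry c)

variable {p q a b c p' q' a' b' c' g' : ℝ → ℝ → ℝ}

theorem IsNullC2.sub (h : IsNullC2 g p q a b c) (h' : IsNullC2 g' p' q' a' b' c') :
    IsNullC2 (fun w v => g w v - g' w v) (fun w v => p w v - p' w v) (fun w v => q w v - q' w v)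
      (fun w v => a w v - a' w v) (fun w v => b w v - b' w v) (fun w v => c w v - c' w v) where
  hasDerivAt_right w v := (h.hasDerivAt_right w v).sub (h'.hasDerivAt_right w v)
  hasDerivAt_left w v := (h.hasDerivAt_left w v).sub (h'.hasDerivAt_left w v)
  hasDerivAt_p_right w v := (h.hasDerivAt_p_right w v).sub (h'.hasDerivAt_p_right w v)
  hasDerivAt_p_left w v := (h.hasDerivAt_p_left w v).sub (h'.hasDerivAt_p_left w v)
  hasDerivAt_q_right w v := (h.hasDerivAt_q_right w v).sub (h'.hasDerivAt_q_right w v)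
  hasDerivAt_q_left w v := (h.hasDerivAt_q_left w v).sub (h'.hasDerivAt_q_left w v)
  continuous_a := h.continuous_a.sub h'.continuous_a
  continuous_b := h.continuous_b.sub h'.continuous_b
  continuous_c := h.continuous_c.sub h'.continuous_c

theorem IsNullC2.contDiff_p (h : IsNullC2 g p q a b c) : ContDiff ℝ 1 (Function.uncurry p) :=
  contDiff_one_of_partials h.hasDerivAt_p_left h.hasDerivAt_p_right h.continuous_c h.continuous_a

theorem IsNullC2.contDiff_q (h : IsNullC2 g p q a b c) : ContDiff ℝ 1 (Function.uncurry q) :=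
  contDiff_one_of_partials h.hasDerivAt_q_left h.hasDerivAt_q_right h.continuous_b h.continuous_c

theorem IsNullC2.contDiff_toTX (h : IsNullC2 g p q a b c) :
    ContDiff ℝ 2 (Function.uncurry (toTX g)) := by
  have hg : ContDiff ℝ 2 (Function.uncurry g) :=
    contDiff_two_of_partials h.hasDerivAt_left h.hasDerivAt_right h.contDiff_q h.contDiff_p
  exact hg.comp (by fun_prop : ContDiff ℝ 2 fun u : ℝ × ℝ => (u.2 - u.1, u.2 + u.1))

theorem IsNullC2.pdt_eq (h : IsNullC2 g p q a b c) :
    pdt (toTX g) = toTX fun w v => p w v - q w v :=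
  pdt_toTX h.hasDerivAt_left h.hasDerivAt_right h.contDiff_q.continuous h.contDiff_p.continuous

theorem IsNullC2.pdx_eq (h : IsNullC2 g p q a b c) :
    pdx (toTX g) = toTX fun w v => p w v + q w v :=
  pdx_toTX h.hasDerivAt_left h.hasDerivAt_right h.contDiff_q.continuous h.contDiff_p.continuous

theorem IsNullC2.pdt_pdt_eq (h : IsNullC2 g p q a b c) :
    pdt (pdt (toTX g)) = toTX fun w v => a w v - c w v - (c w v - b w v) := by
  rw [h.pdt_eq]
  exact pdt_toTX (fun w v => (h.hasDerivAt_p_left w v).sub (h.hasDerivAt_q_left w v))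
    (fun w v => (h.hasDerivAt_p_right w v).sub (h.hasDerivAt_q_right w v))
    (h.continuous_c.sub h.continuous_b) (h.continuous_a.sub h.continuous_c)

theorem IsNullC2.pdt_pdx_eq (h : IsNullC2 g p q a b c) :
    pdt (pdx (toTX g)) = toTX fun w v => a w v + c w v - (c w v + b w v) := by
  rw [h.pdx_eq]
  exact pdt_toTX (fun w v => (h.hasDerivAt_p_left w v).add (h.hasDerivAt_q_left w v))
    (fun w v => (h.hasDerivAt_p_right w v).add (h.hasDerivAt_q_right w v))
    (h.continuous_c.add h.continuous_b) (h.continuous_a.add h.continuous_c)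

theorem IsNullC2.pdx_pdx_eq (h : IsNullC2 g p q a b c) :
    pdx (pdx (toTX g)) = toTX fun w v => a w v + c w v + (c w v + b w v) := by
  rw [h.pdx_eq]
  exact pdx_toTX (fun w v => (h.hasDerivAt_p_left w v).add (h.hasDerivAt_q_left w v))
    (fun w v => (h.hasDerivAt_p_right w v).add (h.hasDerivAt_q_right w v))
    (h.continuous_c.add h.continuous_b) (h.continuous_a.add h.continuous_c)

end ToTX

theorem continuous_pcfForm_comp {Y : Type*} [TopologicalSpace Y] {X : Y → ℝ × ℝ}
    (hX : Continuous X) (hpos : ∀ y, 0 < (X y).1) : Continuous fun y => pcfForm (X y) := by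
  have h : ContinuousOn formCoeff (Ioi 0) := fun y hy =>
    (hasDerivAt_formCoeff hy).continuousAt.continuousWithinAt
  exact h.comp_continuous hX.fst hpos

/-! ### Solutions in null coordinates are solutions of the original system. -/

section Fields

variable {X p q a b : ℝ → ℝ → ℝ × ℝ}

theorem IsNullField.isNullC2_fst (h : IsNullField pcfForm X p q) (hpos : ∀ w v, 0 < (X w v).1)
    (ha : ∀ w v, HasDerivAt (fun y => p w y) (a w v) v)
    (hb : ∀ w v, HasDerivAt (fun y => q y v) (b w v) w) (hac : Continuous (Function.uncurry a))
    (hbc : Continuous (Function.uncurry b)) :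
    IsNullC2 (fun w v => (X w v).1) (fun w v => (p w v).1) (fun w v => (q w v).1)
      (fun w v => (a w v).1) (fun w v => (b w v).1)
      (fun w v => (pcfForm (X w v) (q w v) (p w v)).1) where
  hasDerivAt_right w v := (h.hasDerivAt_right w v).fst
  hasDerivAt_left w v := (h.hasDerivAt_left w v).fst
  hasDerivAt_p_right w v := (ha w v).fst
  hasDerivAt_p_left w v := (h.hasDerivAt_p w v).fst
  hasDerivAt_q_right w v := (h.hasDerivAt_q w v).fst
  hasDerivAt_q_left w v := (hb w v).fst
  continuous_a := hac.fst
  continuous_b := hbc.fst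
  continuous_c := (((continuous_pcfForm_comp h.continuous fun u => hpos u.1 u.2).clm_apply
    h.continuous_q).clm_apply h.continuous_p).fst

theorem IsNullField.isNullC2_snd (h : IsNullField pcfForm X p q) (hpos : ∀ w v, 0 < (X w v).1)
    (ha : ∀ w v, HasDerivAt (fun y => p w y) (a w v) v)
    (hb : ∀ w v, HasDerivAt (fun y => q y v) (b w v) w) (hac : Continuous (Function.uncurry a))
    (hbc : Continuous (Function.uncurry b)) :
    IsNullC2 (fun w v => (X w v).2) (fun w v => (p w v).2) (fun w v => (q w v).2)
      (fun w v => (a w v).2) (fun w v => (b w v).2)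
      (fun w v => (pcfForm (X w v) (q w v) (p w v)).2) where
  hasDerivAt_right w v := (h.hasDerivAt_right w v).snd
  hasDerivAt_left w v := (h.hasDerivAt_left w v).snd
  hasDerivAt_p_right w v := (ha w v).snd
  hasDerivAt_p_left w v := (h.hasDerivAt_p w v).snd
  hasDerivAt_q_right w v := (h.hasDerivAt_q w v).snd
  hasDerivAt_q_left w v := (hb w v).snd
  continuous_a := hac.snd
  continuous_b := hbc.snd
  continuous_c := (((continuous_pcfForm_comp h.continuous fun u => hpos u.1 u.2).clm_apply
    h.continuous_q).clm_apply h.continuous_p).snd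

theorem IsNullField.isGlobalSolution (h : IsNullField pcfForm X p q)
    (hpos : ∀ w v, 0 < (X w v).1) (ha : ∀ w v, HasDerivAt (fun y => p w y) (a w v) v)
    (hb : ∀ w v, HasDerivAt (fun y => q y v) (b w v) w) (hac : Continuous (Function.uncurry a))
    (hbc : Continuous (Function.uncurry b)) :
    IsGlobalSolution (toTX fun w v => (X w v).1) (toTX fun w v => (X w v).2) := by
  have h1 := h.isNullC2_fst hpos ha hb hac hbc
  have h2 := h.isNullC2_snd hpos ha hb hac hbc
  refine ⟨h1.contDiff_toTX, h2.contDiff_toTX, fun t x => (hpos _ _).ne', fun t x => ?_,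
    fun t x => ?_⟩
  · rw [h1.pdt_pdt_eq, h1.pdx_pdx_eq, h2.pdt_eq, h2.pdx_eq]
    simp only [toTX, pcfForm_apply]
    ring
  · rw [h2.pdt_pdt_eq, h2.pdx_pdx_eq, h2.pdt_eq, h2.pdx_eq, h1.pdt_eq, h1.pdx_eq]
    have hs : Real.sinh (X (x - t) (x + t)).1 ≠ 0 := (Real.sinh_pos_iff.2 (hpos _ _)).ne'
    simp only [toTX, pcfForm_apply, Real.sinh_two_mul]
    field_simp
    ring

end Fields

/-! ### From `(t, x)` to null coordinates -/

section FromTX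

variable {f : ℝ → ℝ → ℝ}

theorem uncurry_pdt_eq {n : WithTop ℕ∞} (hn : n ≠ 0) (hf : ContDiff ℝ n (Function.uncurry f)) :
    Function.uncurry (pdt f) = fun u => fderiv ℝ (Function.uncurry f) u (1, 0) := by
  funext u
  have hd : HasDerivAt (fun τ : ℝ => (τ, u.2)) ((1 : ℝ), (0 : ℝ)) u.1 :=
    (hasDerivAt_id u.1).prodMk (hasDerivAt_const u.1 u.2)
  exact (HasFDerivAt.comp_hasDerivAt (f := fun τ : ℝ => (τ, u.2)) u.1
    ((hf.differentiable hn) u).hasFDerivAt hd).deriv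

theorem uncurry_pdx_eq {n : WithTop ℕ∞} (hn : n ≠ 0) (hf : ContDiff ℝ n (Function.uncurry f)) :
    Function.uncurry (pdx f) = fun u => fderiv ℝ (Function.uncurry f) u (0, 1) := by
  funext u
  have hd : HasDerivAt (fun y : ℝ => (u.1, y)) ((0 : ℝ), (1 : ℝ)) u.2 :=
    (hasDerivAt_const u.2 u.1).prodMk (hasDerivAt_id u.2)
  exact (HasFDerivAt.comp_hasDerivAt (f := fun y : ℝ => (u.1, y)) u.2
    ((hf.differentiable hn) u).hasFDerivAt hd).deriv

theorem contDiff_pdt (hf : ContDiff ℝ 2 (Function.uncurry f)) :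
    ContDiff ℝ 1 (Function.uncurry (pdt f)) := by
  rw [uncurry_pdt_eq two_ne_zero hf]
  exact (hf.fderiv_right (m := 1) (by norm_num)).clm_apply contDiff_const

theorem contDiff_pdx (hf : ContDiff ℝ 2 (Function.uncurry f)) :
    ContDiff ℝ 1 (Function.uncurry (pdx f)) := by
  rw [uncurry_pdx_eq two_ne_zero hf]
  exact (hf.fderiv_right (m := 1) (by norm_num)).clm_apply contDiff_const

theorem pdx_pdt_eq (hf : ContDiff ℝ 2 (Function.uncurry f)) (t x : ℝ) :
    pdx (pdt f) t x = pdt (pdx f) t x := by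
  have h1 := congrFun (uncurry_pdx_eq one_ne_zero (contDiff_pdt hf)) (t, x)
  have h2 := congrFun (uncurry_pdt_eq one_ne_zero (contDiff_pdx hf)) (t, x)
  have hd : DifferentiableAt ℝ (fderiv ℝ (Function.uncurry f)) (t, x) :=
    (hf.fderiv_right (m := 1) (by norm_num)).differentiable one_ne_zero (t, x)
  rw [uncurry_pdt_eq two_ne_zero hf] at h1
  rw [uncurry_pdx_eq two_ne_zero hf] at h2
  rw [fderiv_clm_apply hd (differentiableAt_const _)] at h1 h2
  have hs : IsSymmSndFDerivAt ℝ (Function.uncurry f) (t, x) :=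
    hf.contDiffAt.isSymmSndFDerivAt (by simp)
  simp at h1 h2
  change pdx (pdt f) t x = _ at h1
  change pdt (pdx f) t x = _ at h2
  rw [h1, h2]
  exact hs _ _

theorem hasDerivAt_null_right {n : WithTop ℕ∞} (hn : n ≠ 0)
    (hf : ContDiff ℝ n (Function.uncurry f)) (w v : ℝ) :
    HasDerivAt (fun y => f ((y - w) / 2) ((w + y) / 2))
      (1 / 2 * (pdt f ((v - w) / 2) ((w + v) / 2) + pdx f ((v - w) / 2) ((w + v) / 2))) v := by
  have hd : HasDerivAt (fun y : ℝ => ((y - w) / 2, (w + y) / 2)) ((1 / 2 : ℝ), (1 / 2 : ℝ)) v :=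
    (((hasDerivAt_id v).sub_const w).div_const 2).prodMk
      (((hasDerivAt_id v).const_add w).div_const 2)
  have h := HasFDerivAt.comp_hasDerivAt (f := fun y : ℝ => ((y - w) / 2, (w + y) / 2)) v
    ((hf.differentiable hn) _).hasFDerivAt hd
  refine h.congr_deriv ?_
  have h1 := congrFun (uncurry_pdt_eq hn hf) ((v - w) / 2, (w + v) / 2)
  have h2 := congrFun (uncurry_pdx_eq hn hf) ((v - w) / 2, (w + v) / 2)
  have e : ((1 / 2 : ℝ), (1 / 2 : ℝ)) = (1 / 2 : ℝ) • (((1 : ℝ), (0 : ℝ)) + ((0 : ℝ), (1 : ℝ))) := by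
    simp
  rw [e, map_smul, map_add, smul_eq_mul, ← h1, ← h2]
  rfl

theorem hasDerivAt_null_left {n : WithTop ℕ∞} (hn : n ≠ 0)
    (hf : ContDiff ℝ n (Function.uncurry f)) (w v : ℝ) :
    HasDerivAt (fun y => f ((v - y) / 2) ((y + v) / 2))
      (1 / 2 * (pdx f ((v - w) / 2) ((w + v) / 2) - pdt f ((v - w) / 2) ((w + v) / 2))) w := by
  have hd : HasDerivAt (fun y : ℝ => ((v - y) / 2, (y + v) / 2)) ((-1 / 2 : ℝ), (1 / 2 : ℝ)) w :=
    (((hasDerivAt_id w).const_sub v).div_const 2).prodMk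
      (((hasDerivAt_id w).add_const v).div_const 2)
  have h := HasFDerivAt.comp_hasDerivAt (f := fun y : ℝ => ((v - y) / 2, (y + v) / 2)) w
    ((hf.differentiable hn) _).hasFDerivAt hd
  refine h.congr_deriv ?_
  have h1 := congrFun (uncurry_pdt_eq hn hf) ((v - w) / 2, (w + v) / 2)
  have h2 := congrFun (uncurry_pdx_eq hn hf) ((v - w) / 2, (w + v) / 2)
  have e : ((-1 / 2 : ℝ), (1 / 2 : ℝ)) =
      (1 / 2 : ℝ) • (((0 : ℝ), (1 : ℝ)) - ((1 : ℝ), (0 : ℝ))) := by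
    ext <;> norm_num
  rw [e, map_smul, map_sub, smul_eq_mul, ← h1, ← h2]
  rfl

variable {Λ φ Λ' φ' : ℝ → ℝ → ℝ}

/-- A global solution of the PCF system in null coordinates. -/
theorem IsGlobalSolution.isNullField (h : IsGlobalSolution Λ φ) :
    IsNullField pcfForm
      (fun w v => (Λ ((v - w) / 2) ((w + v) / 2), φ ((v - w) / 2) ((w + v) / 2)))
      (fun w v =>
        (1 / 2 * (pdt Λ ((v - w) / 2) ((w + v) / 2) + pdx Λ ((v - w) / 2) ((w + v) / 2)),
        1 / 2 * (pdt φ ((v - w) / 2) ((w + v) / 2) + pdx φ ((v - w) / 2) ((w + v) / 2))))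
      (fun w v =>
        (1 / 2 * (pdx Λ ((v - w) / 2) ((w + v) / 2) - pdt Λ ((v - w) / 2) ((w + v) / 2)),
        1 / 2 * (pdx φ ((v - w) / 2) ((w + v) / 2) - pdt φ ((v - w) / 2) ((w + v) / 2)))) := by
  have hc : Continuous fun u : ℝ × ℝ => ((u.2 - u.1) / 2, (u.1 + u.2) / 2) := by fun_prop
  have cΛt := (contDiff_pdt h.contDiff_left).continuous.comp hc
  have cΛx := (contDiff_pdx h.contDiff_left).continuous.comp hc
  have cφt := (contDiff_pdt h.contDiff_right).continuous.comp hc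
  have cφx := (contDiff_pdx h.contDiff_right).continuous.comp hc
  have hs : ∀ t x, Real.sinh (Λ t x) ≠ 0 := fun t x => by
    rw [Ne, Real.sinh_eq_zero]; exact h.ne_zero t x
  -- The null form is the system divided by `-4`, with `sinh 2Λ / sinh² Λ = 2 coth Λ`.
  have key : ∀ t x, ((1 / 4 * (pdx (pdx Λ) t x - pdt (pdt Λ) t x),
      1 / 4 * (pdx (pdx φ) t x - pdt (pdt φ) t x)) : ℝ × ℝ) =
      pcfForm (Λ t x, φ t x)
        (1 / 2 * (pdx Λ t x - pdt Λ t x), 1 / 2 * (pdx φ t x - pdt φ t x))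
        (1 / 2 * (pdt Λ t x + pdx Λ t x), 1 / 2 * (pdt φ t x + pdx φ t x)) := fun t x => by
    have e1 := h.eq_left t x
    have e2 := h.eq_right t x
    have := hs t x
    rw [pcfForm_apply, Prod.mk.injEq]
    constructor
    · simp only
      linear_combination (-1 / 4) * e1
    · have e3 : Real.sinh (2 * Λ t x) / Real.sinh (Λ t x) ^ 2 =
          2 * (Real.cosh (Λ t x) / Real.sinh (Λ t x)) := by
        rw [Real.sinh_two_mul]; field_simp
      rw [e3] at e2
      simp only
      linear_combination (-1 / 4) * e2
  refine ⟨fun w v => (hasDerivAt_null_right two_ne_zero h.contDiff_left w v).prodMk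
    (hasDerivAt_null_right two_ne_zero h.contDiff_right w v),
    fun w v => (hasDerivAt_null_left two_ne_zero h.contDiff_left w v).prodMk
    (hasDerivAt_null_left two_ne_zero h.contDiff_right w v), fun w v => ?_, fun w v => ?_,
    (continuous_const.mul (cΛt.add cΛx)).prodMk (continuous_const.mul (cφt.add cφx)),
    (continuous_const.mul (cΛx.sub cΛt)).prodMk (continuous_const.mul (cφx.sub cφt))⟩
  · have d : ∀ {f : ℝ → ℝ → ℝ}, ContDiff ℝ 2 (Function.uncurry f) → HasDerivAt (fun y =>
        1 / 2 * (pdt f ((v - y) / 2) ((y + v) / 2) + pdx f ((v - y) / 2) ((y + v) / 2)))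
        (1 / 4 * (pdx (pdx f) ((v - w) / 2) ((w + v) / 2) -
          pdt (pdt f) ((v - w) / 2) ((w + v) / 2))) w := fun {f} hf => by
      refine (((hasDerivAt_null_left one_ne_zero (contDiff_pdt hf) w v).add
        (hasDerivAt_null_left one_ne_zero (contDiff_pdx hf) w v)).const_mul (1 / 2)).congr_deriv ?_
      rw [pdx_pdt_eq hf]; ring
    rw [← key]
    exact (d h.contDiff_left).prodMk (d h.contDiff_right)
  · have d : ∀ {f : ℝ → ℝ → ℝ}, ContDiff ℝ 2 (Function.uncurry f) → HasDerivAt (fun y =>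
        1 / 2 * (pdx f ((y - w) / 2) ((w + y) / 2) - pdt f ((y - w) / 2) ((w + y) / 2)))
        (1 / 4 * (pdx (pdx f) ((v - w) / 2) ((w + v) / 2) -
          pdt (pdt f) ((v - w) / 2) ((w + v) / 2))) v := fun {f} hf => by
      refine (((hasDerivAt_null_right one_ne_zero (contDiff_pdx hf) w v).sub
        (hasDerivAt_null_right one_ne_zero (contDiff_pdt hf) w v)).const_mul (1 / 2)).congr_deriv ?_
      rw [pdx_pdt_eq hf]; ring
    rw [← key]
    exact (d h.contDiff_left).prodMk (d h.contDiff_right)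

/-- A continuous function without zeros on the plane has constant sign. Any competing solution with
the same data is thus positive, on the regular side of `coth`. -/
theorem IsGlobalSolution.pos (h : IsGlobalSolution Λ φ) {t₀ x₀ : ℝ} (h₀ : 0 < Λ t₀ x₀) (t x : ℝ) :
    0 < Λ t x := by
  by_contra! hle
  obtain ⟨u, hu⟩ := mem_range_of_exists_le_of_exists_ge h.contDiff_left.continuous
    ⟨(t, x), hle⟩ ⟨(t₀, x₀), h₀.le⟩
  exact h.ne_zero u.1 u.2 hu

/-- A global solution is determined by its data at `t = 0`. -/
theorem IsGlobalSolution.eq_of_data_eq (h : IsGlobalSolution Λ φ) (h' : IsGlobalSolution Λ' φ')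
    (hpos : ∀ x, 0 < Λ 0 x) (h1 : ∀ x, Λ' 0 x = Λ 0 x) (h2 : ∀ x, pdt Λ' 0 x = pdt Λ 0 x)
    (h3 : ∀ x, φ' 0 x = φ 0 x) (h4 : ∀ x, pdt φ' 0 x = pdt φ 0 x) : Λ' = Λ ∧ φ' = φ := by
  have p1 : ∀ t x, 0 < Λ t x := h.pos (hpos 0)
  have p2 : ∀ t x, 0 < Λ' t x := h'.pos (t₀ := 0) (x₀ := 0) (by rw [h1]; exact hpos 0)
  -- The data also fix the `x`-derivatives at `t = 0`, hence both null derivatives on the diagonal.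
  have x1 : ∀ x, pdx Λ' 0 x = pdx Λ 0 x := fun x => by
    simp only [pdx, funext h1]
  have x2 : ∀ x, pdx φ' 0 x = pdx φ 0 x := fun x => by
    simp only [pdx, funext h3]
  have n1 := h.isNullField
  have n2 := h'.isNullField
  have c1 := n1.continuous
  have c2 := n2.continuous
  have hX := n2.eq_of_diag_eq n1
    (continuous_pcfForm_comp c2 fun u => p2 _ _) (continuous_pcfForm_comp c1 fun u => p1 _ _)
    (fun T => by
      -- On a square both first components have positive minima, so all their values lie in one
      -- compact interval on which the coefficients are Lipschitz.
      have hcomp : IsCompact (Icc (-T) T ×ˢ Icc (-T) T) := isCompact_Icc.prod isCompact_Icc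
      obtain ⟨m₁, hm₁, hb₁⟩ := hcomp.exists_forall_le' c1.fst.continuousOn
        (a := 0) fun u _ => p1 _ _
      obtain ⟨m₂, hm₂, hb₂⟩ := hcomp.exists_forall_le' c2.fst.continuousOn
        (a := 0) fun u _ => p2 _ _
      obtain ⟨d₁, hd₁⟩ := hcomp.exists_bound_of_continuousOn c1.fst.continuousOn
      obtain ⟨d₂, hd₂⟩ := hcomp.exists_bound_of_continuousOn c2.fst.continuousOn
      obtain ⟨C, hC1, hC⟩ := exists_formCoeff_bound (c := min m₁ m₂) (d := max d₁ d₂)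
        (lt_min hm₁ hm₂)
      refine ⟨C, fun w hw v hv => ?_⟩
      have e1 := hb₁ (w, v) ⟨hw, hv⟩
      have e2 := hb₂ (w, v) ⟨hw, hv⟩
      have e3 := (le_abs_self _).trans (hd₁ (w, v) ⟨hw, hv⟩)
      have e4 := (le_abs_self _).trans (hd₂ (w, v) ⟨hw, hv⟩)
      refine ((hC _ ⟨(min_le_right _ _).trans e2, e4.trans (le_max_right _ _)⟩).2.2 _
        ⟨(min_le_left _ _).trans e1, e3.trans (le_max_left _ _)⟩).1.trans ?_
      gcongr
      exact norm_fst_le (_ - _ : ℝ × ℝ))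
    (fun y => by simp [h1, h3]) (fun y => by simp [h2, h4, x1, x2])
    (fun y => by simp [h2, h4, x1, x2])
  have hpt : ∀ t x, Λ' t x = Λ t x ∧ φ' t x = φ t x := fun t x => by
    have := congrFun (congrFun hX (x - t)) (x + t)
    have e1 : (x + t - (x - t)) / 2 = t := by ring
    have e2 : (x - t + (x + t)) / 2 = x := by ring
    simpa [e1, e2] using this
  exact ⟨funext fun t => funext fun x => (hpt t x).1, funext fun t => funext fun x => (hpt t x).2⟩

end FromTX

/-! ### Perturbation of a solution -/

theorem hasDerivAt_diag {F : Type*} [NormedAddCommGroup F] [NormedSpace ℝ F]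
    {f f₁ f₂ : ℝ → ℝ → F} (h₁ : ∀ w v, HasDerivAt (fun y => f y v) (f₁ w v) w)
    (h₂ : ∀ w v, HasDerivAt (fun y => f w y) (f₂ w v) v)
    (c₁ : Continuous (Function.uncurry f₁)) (c₂ : Continuous (Function.uncurry f₂)) (y : ℝ) :
    HasDerivAt (fun y => f y y) (f₁ y y + f₂ y y) y := by
  have hd : HasDerivAt (fun y : ℝ => (y, y)) ((1 : ℝ), (1 : ℝ)) y :=
    (hasDerivAt_id y).prodMk (hasDerivAt_id y)
  refine (HasFDerivAt.comp_hasDerivAt (f := fun y : ℝ => (y, y)) y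
    (hasStrictFDerivAt_of_partials h₁ h₂ c₁ c₂ _).hasFDerivAt hd).congr_deriv ?_
  simp

section Perturbation

variable {E : Type*} [NormedAddCommGroup E] [NormedSpace ℝ E] [CompleteSpace E]
  {N : E → E →L[ℝ] E →L[ℝ] E} {N' : E → E →L[ℝ] E →L[ℝ] E →L[ℝ] E} {x₀ : E} {ρ C : ℝ}
  {k : ℝ → ℝ} {XB pB qB aB bB : ℝ → ℝ → E}

/-- Here `ζ` perturbs `X` on the diagonal and `χ` perturbs its time derivative `p - q`. Existence,
second derivatives and comparison with the background are combined, with bounds `P` and `A₂` that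
are functions of a single characteristic variable. -/
theorem exists_perturbed_isNullSolution
    (hN : IsNullForm N N' (Metric.closedBall x₀ ρ) C)
    (hB : IsNullSolution N (Metric.closedBall x₀ ρ) k XB pB qB)
    (daB : ∀ w v, HasDerivAt (fun y => pB w y) (aB w v) v)
    (dbB : ∀ w v, HasDerivAt (fun y => qB y v) (bB w v) w)
    (caB : Continuous (Function.uncurry aB)) (cbB : Continuous (Function.uncurry bB))
    (hkc : Continuous k) (hk0 : ∀ y, 0 < k y) (hk : Integrable k)
    (hCk : C * ∫ y, k y ≤ 1 / 100) (hkρ : ∫ y, k y ≤ ρ / 2) {ζ ζ' ζ'' χ χ' : ℝ → E}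
    (dζ : ∀ y, HasDerivAt ζ (ζ' y) y) (dζ' : ∀ y, HasDerivAt ζ' (ζ'' y) y)
    (dχ : ∀ y, HasDerivAt χ (χ' y) y) (cζ : Continuous ζ'') (cχ : Continuous χ')
    {d d₁ l : ℝ → ℝ} {D : ℝ} (hdc : Continuous d) (hd : Integrable d) (hD : 0 < D)
    (hdD : ∫ y, d y ≤ D) (hdζ : ∀ y, ‖ζ' y‖ + ‖χ y‖ ≤ d y) (hd₁ : ∀ y, ‖ζ'' y‖ + ‖χ' y‖ ≤ d₁ y)
    (hζD : ∀ y, ‖ζ y‖ ≤ D) (hζρ : ∀ y, ‖XB y y - x₀‖ + ‖ζ y‖ ≤ ρ / 2)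
    (hpB : ∀ y, ‖pB y y‖ + d y ≤ k y / 2) (hqB : ∀ y, ‖qB y y‖ + d y ≤ k y / 2)
    (hla : ∀ w v, ‖aB w v‖ ≤ l v) (hlb : ∀ w v, ‖bB w v‖ ≤ l w) {P A₂ : ℝ → ℝ}
    (hP : P = fun y => 2 * d y + (8 * C + 1) * D * k y)
    (hA₂ : A₂ = fun y => 2 * (d₁ y + (C * (5 * D) * k y * k y + C * P y * k y + C * k y * P y)) +
      10 * C ^ 2 * (5 * D * k y ^ 2 + P y * k y + 5 * D * l y)) :
    ∃ X p q a b : ℝ → ℝ → E, IsNullSolution N (Metric.closedBall x₀ ρ) k X p q ∧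
      (∀ w v, HasDerivAt (fun y => p w y) (a w v) v) ∧
      (∀ w v, HasDerivAt (fun y => q y v) (b w v) w) ∧
      Continuous (Function.uncurry a) ∧ Continuous (Function.uncurry b) ∧
      (∀ y, X y y = XB y y + ζ y) ∧ (∀ y, p y y - q y y = pB y y - qB y y + χ y) ∧
      ∀ w v, ‖p w v - pB w v‖ ≤ P v ∧ ‖q w v - qB w v‖ ≤ P w ∧
        ‖N (X w v) (q w v) (p w v) - N (XB w v) (qB w v) (pB w v)‖ ≤
          C * (5 * D) * k w * k v + C * P w * k v + C * k w * P v ∧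
        ‖a w v - aB w v‖ ≤ A₂ v ∧ ‖b w v - bB w v‖ ≤ A₂ w := by
  have hd0 : ∀ y, 0 ≤ d y := fun y => by
    have := hdζ y; have := norm_nonneg (ζ' y); have := norm_nonneg (χ y); linarith
  have hC1 := hN.one_le
  have hC0 := hN.pos
  have hhalf : ∀ x y : E, ‖(1 / 2 : ℝ) • (x + y)‖ ≤ ‖x‖ + ‖y‖ := fun x y => by
    rw [norm_smul]
    have := norm_add_le x y
    have := norm_nonneg (x + y)
    norm_num
    linarith
  have hhalf' : ∀ x y : E, ‖(1 / 2 : ℝ) • (x - y)‖ ≤ ‖x‖ + ‖y‖ := fun x y => by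
    rw [sub_eq_add_neg, ← norm_neg y]; exact hhalf _ _
  have cζ' : Continuous ζ' := continuous_iff_continuousAt.2 fun y => (dζ' y).continuousAt
  have cχ₀ : Continuous χ := continuous_iff_continuousAt.2 fun y => (dχ y).continuousAt
  have hdiag : Continuous fun y : ℝ => (y, y) := by fun_prop
  -- The solution of `δp + δq = ζ'` and `δp - δq = χ`: space derivatives are `p + q`, time
  -- derivatives `p - q`.
  set δp : ℝ → E := fun y => (1 / 2 : ℝ) • (ζ' y + χ y) with hδp
  set δq : ℝ → E := fun y => (1 / 2 : ℝ) • (ζ' y - χ y) with hδq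
  have hδpd : ∀ y, ‖δp y‖ ≤ d y := fun y => (hhalf _ _).trans (hdζ y)
  have hδqd : ∀ y, ‖δq y‖ ≤ d y := fun y => (hhalf' _ _).trans (hdζ y)
  have hδ : ∀ y, δp y + δq y = ζ' y := fun y => by
    simp only [hδp, hδq]; module
  obtain ⟨X, p, q, hX, eX, ep, eq⟩ := exists_isNullSolution hN hkc hk0 hk hCk hkρ
    (X₀ := fun y => XB y y + ζ y) (p₀ := fun y => pB y y + δp y) (q₀ := fun y => qB y y + δq y)
    (fun y => by
      refine ((hasDerivAt_diag hB.hasDerivAt_left hB.hasDerivAt_right hB.continuous_q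
        hB.continuous_p y).add (dζ y)).congr_deriv ?_
      rw [← hδ]; abel)
    (fun y => by
      rw [add_sub_right_comm]
      exact (norm_add_le _ _).trans (hζρ y))
    ((hB.continuous_p.comp hdiag).add ((cζ'.add cχ₀).const_smul _))
    ((hB.continuous_q.comp hdiag).add ((cζ'.sub cχ₀).const_smul _))
    (fun y => (norm_add_le _ _).trans ((add_le_add_right (hδpd y) _).trans (hpB y)))
    (fun y => (norm_add_le _ _).trans ((add_le_add_right (hδqd y) _).trans (hqB y)))
  have cGB := hB.continuous_source hN
  have cG := hX.continuous_source hN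
  have dp₀ : ∀ y, HasDerivAt (fun y => p y y) (N (XB y y) (qB y y) (pB y y) + aB y y +
      (1 / 2 : ℝ) • (ζ'' y + χ' y)) y := fun y => by
    have e : (fun y => p y y) = fun y => pB y y + δp y := funext ep
    rw [e]
    exact (hasDerivAt_diag hB.hasDerivAt_p daB cGB caB y).add
      (((dζ' y).add (dχ y)).const_smul (1 / 2 : ℝ))
  have dq₀ : ∀ y, HasDerivAt (fun y => q y y) (bB y y + N (XB y y) (qB y y) (pB y y) +
      (1 / 2 : ℝ) • (ζ'' y - χ' y)) y := fun y => by
    have e : (fun y => q y y) = fun y => qB y y + δq y := funext eq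
    rw [e]
    exact (hasDerivAt_diag dbB hB.hasDerivAt_q cbB cGB y).add
      (((dζ' y).sub (dχ y)).const_smul (1 / 2 : ℝ))
  have hCk2 : C * ∫ y, k y ≤ 1 / 2 := by linarith
  obtain ⟨a, hac, ha⟩ := hX.exists_hasDerivAt_p hN hk hkc hCk2 dp₀
    (((cGB.comp hdiag).add (caB.comp hdiag)).add ((cζ.add cχ).const_smul _))
  obtain ⟨b', hbc, hb⟩ := hX.swap.exists_hasDerivAt_p hN.flip hk hkc hCk2 dq₀
    (((cbB.comp hdiag).add (cGB.comp hdiag)).add ((cζ.sub cχ).const_smul _))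
  set b : ℝ → ℝ → E := fun w v => b' v w with hbdef
  have hdX : ∀ y, ‖X y y - XB y y‖ ≤ D := fun y => by
    rw [eX, add_sub_cancel_left]; exact hζD y
  have hdp : ∀ y, ‖p y y - pB y y‖ ≤ d y := fun y => by
    rw [ep, add_sub_cancel_left]; exact hδpd y
  have hdq : ∀ y, ‖q y y - qB y y‖ ≤ d y := fun y => by
    rw [eq, add_sub_cancel_left]; exact hδqd y
  have hcomp := hX.norm_sub_le hB hN hkc hk0 hk hCk hdc hd0 hd hD hdD hdX hdp hdq
  have hpP : ∀ w v, ‖p w v - pB w v‖ ≤ P v := fun w v => by rw [hP]; exact (hcomp w v).2.1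
  have hqP : ∀ w v, ‖q w v - qB w v‖ ≤ P w := fun w v => by rw [hP]; exact (hcomp w v).2.2
  have hXD : ∀ w v, ‖X w v - XB w v‖ ≤ 5 * D := fun w v => (hcomp w v).1
  have hPi : Integrable P := by
    rw [hP]; exact (hd.const_mul 2).add (hk.const_mul _)
  have hPD : ∫ y, P y ≤ 5 * D := by
    have : ∫ y, P y = 2 * (∫ y, d y) + (8 * C + 1) * D * ∫ y, k y := by
      rw [hP, integral_add (hd.const_mul 2) (hk.const_mul _), integral_const_mul,
        integral_const_mul]
    have hκ0 : 0 ≤ ∫ y, k y := integral_nonneg fun y => (hk0 y).le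
    have hκ1 : ∫ y, k y ≤ 1 / 100 := by nlinarith
    rw [this]
    nlinarith
  have hG : ∀ w v, ‖N (X w v) (q w v) (p w v) - N (XB w v) (qB w v) (pB w v)‖ ≤
      C * (5 * D) * k w * k v + C * P w * k v + C * k w * P v := fun w v =>
    hX.norm_source_sub_le hB hN (hXD w v) (hpP w v) (hqP w v)
  -- The derivative of `p` along the diagonal is the source plus `a`, so the second derivatives of
  -- the data control `a - aB` there up to the difference of the sources.
  have ha0 : ∀ y, ‖a y y - aB y y‖ ≤
      d₁ y + (C * (5 * D) * k y * k y + C * P y * k y + C * k y * P y) := fun y => by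
    have h1 := (hasDerivAt_diag hX.hasDerivAt_p ha cG hac y).unique (dp₀ y)
    have h2 : a y y - aB y y = (1 / 2 : ℝ) • (ζ'' y + χ' y) -
        (N (X y y) (q y y) (p y y) - N (XB y y) (qB y y) (pB y y)) := by
      rw [← sub_eq_zero] at h1 ⊢
      rw [← h1]; abel
    rw [h2]
    exact (norm_sub_le _ _).trans (add_le_add ((hhalf _ _).trans (hd₁ y)) (hG y y))
  have hb0 : ∀ y, ‖b y y - bB y y‖ ≤
      d₁ y + (C * (5 * D) * k y * k y + C * P y * k y + C * k y * P y) := fun y => by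
    have h1 := (hasDerivAt_diag (fun w v => hb v w) hX.hasDerivAt_q (hbc.comp continuous_swap) cG
      y).unique (dq₀ y)
    have h2 : b y y - bB y y = (1 / 2 : ℝ) • (ζ'' y - χ' y) -
        (N (X y y) (q y y) (p y y) - N (XB y y) (qB y y) (pB y y)) := by
      rw [← sub_eq_zero] at h1 ⊢
      rw [← h1]; simp only [hbdef]; abel
    rw [h2]
    exact (norm_sub_le _ _).trans (add_le_add ((hhalf' _ _).trans (hd₁ y)) (hG y y))
  refine ⟨X, p, q, a, b, hX, ha, fun w v => hb v w, hac, hbc.comp continuous_swap, eX, fun y => ?_,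
    fun w v => ⟨hpP w v, hqP w v, hG w v, ?_, ?_⟩⟩
  · rw [ep, eq]; simp only [hδp, hδq]; module
  · refine (hX.norm_sub_deriv_p_le hB hN hk hCk2 hac ha caB daB hPi hXD hpP hqP hla hPD w
      v).trans ?_
    rw [hA₂]
    have := ha0 v
    simp only
    gcongr
  · refine (hX.swap.norm_sub_deriv_p_le hB.swap hN.flip hk hCk2 hbc hb
      (a' := fun w v => bB v w) (cbB.comp continuous_swap) (fun w v => dbB v w) hPi (fun w v => hXD v w)
      (fun w v => hqP v w) (fun w v => hpP v w) (fun w v => hlb v w) hPD v w).trans ?_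
    rw [hA₂]
    have := hb0 w
    simp only
    gcongr

end Perturbation

/-! ### Perturbations of the soliton -/

/-- For small `ε` the values of the seeds stay near `(λ, 0)`, where continuity supplies bounds
independent of `ε`. -/
theorem IsSolitonParam.exists_uniform_bounds {n s r β β' : ℝ} (h : IsSolitonParam n s r β β')
    (lam : ℝ) {r₀ : ℝ} (hr₀ : 0 < r₀) :
    ∃ K : ℝ, 1 ≤ K ∧ ∃ η : ℝ, 0 < η ∧ ∀ a b : ℝ, |a - lam| ≤ η → |b| ≤ η →
      ‖solPsiA n s r β β' a b‖ ≤ K ∧ ‖solPsiA n s r β' β b a‖ ≤ K ∧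
      ‖solPsiAA n s r β β' a b‖ ≤ K ∧ ‖solPsiAA n s r β' β b a‖ ≤ K ∧
      ‖solPsi n s r β β' a b - solPsi n s r β β' lam 0‖ ≤ r₀ := by
  have cs : Continuous fun u : ℝ × ℝ => (u.2, u.1) := by fun_prop
  have c₀ : Continuous fun u : ℝ × ℝ =>
      ‖solPsi n s r β β' u.1 u.2 - solPsi n s r β β' lam 0‖ :=
    (h.contDiff_solPsi.continuous.sub continuous_const).norm
  have c₁ : Continuous fun u : ℝ × ℝ => ‖solPsiA n s r β β' u.1 u.2‖ :=
    h.contDiff_solPsiA.continuous.norm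
  have c₂ : Continuous fun u : ℝ × ℝ => ‖solPsiA n s r β' β u.2 u.1‖ :=
    (h.swap.contDiff_solPsiA.continuous.comp cs).norm
  have c₃ : Continuous fun u : ℝ × ℝ => ‖solPsiAA n s r β β' u.1 u.2‖ :=
    h.continuous_solPsiAA.norm
  have c₄ : Continuous fun u : ℝ × ℝ => ‖solPsiAA n s r β' β u.2 u.1‖ :=
    (h.swap.continuous_solPsiAA.comp cs).norm
  set M : ℝ × ℝ → ℝ := fun u => ‖solPsiA n s r β β' u.1 u.2‖ + ‖solPsiA n s r β' β u.2 u.1‖ +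
    ‖solPsiAA n s r β β' u.1 u.2‖ + ‖solPsiAA n s r β' β u.2 u.1‖ with hM
  have cM : Continuous M := ((c₁.add c₂).add c₃).add c₄
  have hM0 : 0 ≤ M (lam, 0) := by simp only [hM]; positivity
  have ev : ∀ᶠ u in 𝓝 (lam, (0 : ℝ)), M u < M (lam, 0) + 1 ∧
      ‖solPsi n s r β β' u.1 u.2 - solPsi n s r β β' lam 0‖ < r₀ :=
    (cM.continuousAt.eventually_lt_const (lt_add_one _)).and
      (c₀.continuousAt.eventually_lt_const (by simpa using hr₀))
  obtain ⟨η, hη, hev⟩ := Metric.eventually_nhds_iff.1 ev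
  refine ⟨M (lam, 0) + 1, by linarith, η / 2, by linarith, fun a b ha hb => ?_⟩
  obtain ⟨h1, h2⟩ := @hev (a, b) (by
    rw [Prod.dist_eq, Real.dist_eq, Real.dist_eq, sub_zero]
    exact max_lt (by linarith) (by linarith))
  simp only [hM] at h1 ⊢
  have e1 := norm_nonneg (solPsiA n s r β β' a b)
  have e2 := norm_nonneg (solPsiA n s r β' β b a)
  have e3 := norm_nonneg (solPsiAA n s r β β' a b)
  have e4 := norm_nonneg (solPsiAA n s r β' β b a)
  exact ⟨by linarith, by linarith, by linarith, by linarith, h2.le⟩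

/-! ### Sizes of the data and of the seeds. -/

/-- The integrable profile `(1 + y²)⁻²`. -/
noncomputable def decay (y : ℝ) : ℝ := ((1 + y ^ 2) ^ 2)⁻¹

theorem decay_pos (y : ℝ) : 0 < decay y := by unfold decay; positivity

theorem decay_le_one (y : ℝ) : decay y ≤ 1 :=
  inv_le_one_of_one_le₀ (by nlinarith [sq_nonneg y, sq_nonneg (y ^ 2)])

theorem continuous_decay : Continuous decay :=
  Continuous.inv₀ (by fun_prop) fun y => by positivity

theorem integrable_decay : Integrable decay := by
  refine integrable_inv_one_add_sq.mono' continuous_decay.aestronglyMeasurable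
    (ae_of_all _ fun y => ?_)
  rw [Real.norm_of_nonneg (decay_pos y).le]
  exact inv_anti₀ (by positivity) (by nlinarith [sq_nonneg y, sq_nonneg (y ^ 2)])

theorem integral_decay_pos : 0 < ∫ y, decay y :=
  integral_pos_of_integrable_nonneg_nonzero (x := 0) continuous_decay integrable_decay
    (fun y => (decay_pos y).le) (decay_pos 0).ne'

/-- The pointwise size of the first derivatives of the data with profiles `z₀, w₀, s₀, m₀`. -/
noncomputable def dataSize (z₀ w₀ s₀ m₀ : ℝ → ℝ) (y : ℝ) : ℝ :=
  |deriv z₀ y| + |w₀ y| + |deriv s₀ y| + |m₀ y|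

theorem dataSize_nonneg (z₀ w₀ s₀ m₀ : ℝ → ℝ) (y : ℝ) : 0 ≤ dataSize z₀ w₀ s₀ m₀ y := by
  unfold dataSize; positivity

/-- The pointwise size of the seeds and of their first two derivatives, with an integrable tail. -/
noncomputable def seedSize (θ σ : ℝ → ℝ) (y : ℝ) : ℝ :=
  |deriv θ y| + |deriv σ y| + |deriv (deriv θ) y| + |deriv (deriv σ) y| + decay y

theorem seedSize_nonneg (θ σ : ℝ → ℝ) (y : ℝ) : 0 ≤ seedSize θ σ y := by
  have := decay_pos y
  unfold seedSize; positivity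

theorem IsProfile.deriv {z₀ w₀ s₀ m₀ : ℝ → ℝ} (h : IsProfile z₀ w₀ s₀ m₀) :
    IsProfile (deriv z₀) (deriv w₀) (deriv s₀) (deriv m₀) where
  smooth_z := h.smooth_z.deriv'
  smooth_w := h.smooth_w.deriv'
  smooth_s := h.smooth_s.deriv'
  smooth_m := h.smooth_m.deriv'
  supp_z := h.supp_z.deriv
  supp_w := h.supp_w.deriv
  supp_s := h.supp_s.deriv
  supp_m := h.supp_m.deriv

section Profile

variable {z₀ w₀ s₀ m₀ : ℝ → ℝ}

theorem IsProfile.continuous_dataSize (h : IsProfile z₀ w₀ s₀ m₀) :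
    Continuous (dataSize z₀ w₀ s₀ m₀) :=
  (((h.deriv.smooth_z.continuous.abs.add h.smooth_w.continuous.abs).add
    h.deriv.smooth_s.continuous.abs).add h.smooth_m.continuous.abs)

theorem IsProfile.integrable_dataSize (h : IsProfile z₀ w₀ s₀ m₀) :
    Integrable (dataSize z₀ w₀ s₀ m₀) :=
  (((h.deriv.smooth_z.continuous.integrable_of_hasCompactSupport h.deriv.supp_z).abs.add
    (h.smooth_w.continuous.integrable_of_hasCompactSupport h.supp_w).abs).add
    (h.deriv.smooth_s.continuous.integrable_of_hasCompactSupport h.deriv.supp_s).abs).add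
    (h.smooth_m.continuous.integrable_of_hasCompactSupport h.supp_m).abs

theorem abs_le_integral_abs_deriv {f : ℝ → ℝ} (hf : ContDiff ℝ 1 f) (hc : HasCompactSupport f)
    (y : ℝ) : |f y| ≤ ∫ x, |deriv f x| := by
  have hi : Integrable (deriv f) :=
    (hf.continuous_deriv le_rfl).integrable_of_hasCompactSupport hc.deriv
  rw [← hc.integral_Iic_deriv_eq hf y]
  refine (norm_integral_le_integral_norm (μ := volume.restrict (Iic y)) (deriv f)).trans ?_
  exact setIntegral_le_integral hi.norm (ae_of_all _ fun _ => norm_nonneg _)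

theorem IsProfile.abs_le_integral_dataSize (h : IsProfile z₀ w₀ s₀ m₀) (y : ℝ) :
    |z₀ y| ≤ ∫ x, dataSize z₀ w₀ s₀ m₀ x ∧ |s₀ y| ≤ ∫ x, dataSize z₀ w₀ s₀ m₀ x := by
  have hz : Integrable fun x => |_root_.deriv z₀ x| :=
    (h.deriv.smooth_z.continuous.integrable_of_hasCompactSupport h.deriv.supp_z).abs
  have hs : Integrable fun x => |_root_.deriv s₀ x| :=
    (h.deriv.smooth_s.continuous.integrable_of_hasCompactSupport h.deriv.supp_s).abs
  constructor
  · refine (abs_le_integral_abs_deriv (h.smooth_z.of_le (by norm_cast)) h.supp_z y).trans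
      (integral_mono hz h.integrable_dataSize fun x => ?_)
    simp only [dataSize]; linarith [abs_nonneg (w₀ x), abs_nonneg (_root_.deriv s₀ x), abs_nonneg (m₀ x)]
  · refine (abs_le_integral_abs_deriv (h.smooth_s.of_le (by norm_cast)) h.supp_s y).trans
      (integral_mono hs h.integrable_dataSize fun x => ?_)
    simp only [dataSize]; linarith [abs_nonneg (w₀ x), abs_nonneg (_root_.deriv z₀ x), abs_nonneg (m₀ x)]

end Profile

section Seed

variable {θ σ : ℝ → ℝ}

theorem continuous_deriv_deriv {f : ℝ → ℝ} (hf : ContDiff ℝ 2 f) :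
    ContDiff ℝ 1 (deriv f) ∧ Continuous (deriv (deriv f)) := by
  have h1 : ContDiff ℝ 1 (deriv f) := by
    have : ContDiff ℝ (1 + 1) f := by norm_num; exact hf
    exact this.deriv'
  exact ⟨h1, h1.continuous_deriv le_rfl⟩

theorem continuous_seedSize (hθ : ContDiff ℝ 2 θ) (hσ : ContDiff ℝ 2 σ) :
    Continuous (seedSize θ σ) :=
  ((((continuous_deriv_deriv hθ).1.continuous.abs.add
    (continuous_deriv_deriv hσ).1.continuous.abs).add (continuous_deriv_deriv hθ).2.abs).add
    (continuous_deriv_deriv hσ).2.abs).add continuous_decay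

end Seed

/-- Algebra of the comparison bounds: every error term is controlled by `d + D κ`. -/
theorem exists_comparison_const {C K τ H : ℝ} (hC : 1 ≤ C) (hK : 1 ≤ K) (hτ : 0 ≤ τ)
    (hH : 1 ≤ H) : ∃ A : ℝ, 1 ≤ A ∧ ∀ D : ℝ, 0 < D → D ≤ 1 →
      (∀ d κ k : ℝ, 0 ≤ d → 0 ≤ κ → k ≤ 2 * K * κ + 2 * d + τ * κ →
        2 * d + (8 * C + 1) * D * k ≤ A * (d + D * κ)) ∧
      (∀ d κ k d₁ l P : ℝ, 0 ≤ d → d ≤ D → 0 ≤ κ → κ ≤ H → 0 ≤ d₁ → 0 ≤ k →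
        k ≤ 2 * K * κ + 2 * d + τ * κ → l ≤ K * (κ + κ * κ) →
        P = 2 * d + (8 * C + 1) * D * k →
        2 * (d₁ + (C * (5 * D) * k * k + C * P * k + C * k * P)) +
          10 * C ^ 2 * (5 * D * k ^ 2 + P * k + 5 * D * l) ≤ A * (d₁ + d + D * κ) ∧
        ∀ d' κ' k' P' : ℝ, 0 ≤ d' → d' ≤ D → 0 ≤ κ' → κ' ≤ H → 0 ≤ k' →
          k' ≤ 2 * K * κ' + 2 * d' + τ * κ' → P' = 2 * d' + (8 * C + 1) * D * k' →
          C * (5 * D) * k * k' + C * P * k' + C * k * P' ≤ A * (d' + D * κ') ∧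
          C * (5 * D) * k' * k + C * P' * k + C * k' * P ≤ A * (d' + D * κ')) := by
  -- In every term one small factor is kept and the others are replaced by constants. The tools are
  -- `k ≤ c (H + 1)`, then `D k ≤ c (d + D κ)`, which uses `D ≤ 1`, and `P ≤ b (d + D κ)`.
  obtain ⟨c, hc⟩ : ∃ c, c = 2 * K + τ + 2 := ⟨_, rfl⟩
  obtain ⟨b, hb⟩ : ∃ b, b = 2 + (8 * C + 1) * c := ⟨_, rfl⟩
  have hc1 : 1 ≤ c := by rw [hc]; linarith
  have hb1 : 1 ≤ b := by rw [hb]; nlinarith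
  have hcH : 0 ≤ c * H := by positivity
  obtain ⟨A, hA⟩ : ∃ A, A = b + 2 * (1 + (C * (5 * c) * (c * (H + 1)) + C * b * (c * (H + 1)) +
      C * (c * (H + 1)) * b)) +
      10 * C ^ 2 * (5 * (c * (H + 1)) * c + b * (c * (H + 1)) + 5 * (K * (1 + H))) +
      (C * 5 * (c * (H + 1)) * c + C * (b * (1 + H)) * c + C * (c * (H + 1)) * b) := ⟨_, rfl⟩
  have hA1 : 0 ≤ C * (5 * c) * (c * (H + 1)) + C * b * (c * (H + 1)) + C * (c * (H + 1)) * b := by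
    positivity
  have hA2 : 0 ≤ 10 * C ^ 2 * (5 * (c * (H + 1)) * c + b * (c * (H + 1)) + 5 * (K * (1 + H))) := by
    positivity
  have hA3 : 0 ≤ C * 5 * (c * (H + 1)) * c + C * (b * (1 + H)) * c + C * (c * (H + 1)) * b := by
    positivity
  refine ⟨A, by linarith, fun D hD hD1 => ?_⟩
  have hDk : ∀ d κ k : ℝ, 0 ≤ d → 0 ≤ κ → k ≤ 2 * K * κ + 2 * d + τ * κ →
      D * k ≤ c * (d + D * κ) := fun d κ k hd hκ hk => by
    have h1 : D * k ≤ D * (2 * K * κ + 2 * d + τ * κ) := by gcongr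
    have h2 : D * d ≤ d := mul_le_of_le_one_left hd hD1
    have h3 : 0 ≤ D * κ := by positivity
    have h4 : 0 ≤ (2 * K + τ) * d := by positivity
    rw [hc]; nlinarith
  have hPb : ∀ d κ k : ℝ, 0 ≤ d → 0 ≤ κ → k ≤ 2 * K * κ + 2 * d + τ * κ →
      2 * d + (8 * C + 1) * D * k ≤ b * (d + D * κ) := fun d κ k hd hκ hk => by
    have h1 := mul_le_mul_of_nonneg_left (hDk d κ k hd hκ hk) (by linarith : 0 ≤ 8 * C + 1)
    have h3 : 0 ≤ D * κ := by positivity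
    rw [hb]; nlinarith
  have hkb : ∀ d κ k : ℝ, 0 ≤ d → d ≤ D → 0 ≤ κ → κ ≤ H → k ≤ 2 * K * κ + 2 * d + τ * κ →
      k ≤ c * (H + 1) := fun d κ k hd hdD hκ hκH hk => by
    have h1 : 2 * K * κ + τ * κ ≤ 2 * K * H + τ * H := by gcongr
    have h2 : 0 ≤ 2 * K + τ := by positivity
    rw [hc]; nlinarith
  refine ⟨fun d κ k hd hκ hk => (hPb d κ k hd hκ hk).trans ?_,
    fun d κ k d₁ l P hd hdD hκ hκH hd₁ hk0 hk hl hP => ⟨?_,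
      fun d' κ' k' P' hd' hdD' hκ' hκH' hk0' hk' hP' => ?_⟩⟩
  · have : 0 ≤ d + D * κ := by positivity
    gcongr
    linarith
  · have e0 : 0 ≤ d + D * κ := by positivity
    have hkc := hkb d κ k hd hdD hκ hκH hk
    have hDk1 := hDk d κ k hd hκ hk
    have hP1 : P ≤ b * (d + D * κ) := hP ▸ hPb d κ k hd hκ hk
    have hP0 : 0 ≤ P := by rw [hP]; positivity
    have i1 : D * k * k ≤ c * (d + D * κ) * (c * (H + 1)) := by gcongr
    have i2 : P * k ≤ b * (d + D * κ) * (c * (H + 1)) := by gcongr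
    have i3 : D * l ≤ K * (1 + H) * (d + D * κ) := by
      have h1 : D * l ≤ D * (K * (κ + κ * κ)) := by gcongr
      have h2 : D * (K * (κ + κ * κ)) ≤ D * (K * (κ + H * κ)) := by gcongr
      have h3 : 0 ≤ K * (1 + H) * d := by positivity
      nlinarith
    have j1 := mul_le_mul_of_nonneg_left i1 (by positivity : 0 ≤ 5 * C)
    have j2 := mul_le_mul_of_nonneg_left i2 (by positivity : 0 ≤ C)
    have j3 : 10 * C ^ 2 * (5 * D * k ^ 2 + P * k + 5 * D * l) ≤
        10 * C ^ 2 * (5 * (c * (d + D * κ) * (c * (H + 1))) + b * (d + D * κ) * (c * (H + 1)) +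
          5 * (K * (1 + H) * (d + D * κ))) := by
      gcongr ?_ * ?_
      linarith
    have j4 := mul_nonneg hA3 e0
    have j5 : 0 ≤ b * (d + D * κ) := by positivity
    have j6 := mul_le_mul_of_nonneg_right (show 2 ≤ A by linarith) hd₁
    have j7 : A * (d₁ + d + D * κ) = A * d₁ + A * (d + D * κ) := by ring
    rw [j7]
    have j8 : A * (d + D * κ) = _ := congrArg (· * (d + D * κ)) hA
    rw [j8]
    linarith
  · have e0 : 0 ≤ d' + D * κ' := by positivity
    have hkc := hkb d κ k hd hdD hκ hκH hk
    have hDk1 := hDk d' κ' k' hd' hκ' hk'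
    have hP1 : P' ≤ b * (d' + D * κ') := hP' ▸ hPb d' κ' k' hd' hκ' hk'
    have hP0' : 0 ≤ P' := by rw [hP']; positivity
    -- The mixed terms involve two points and may be charged to either one. At the other point `P`
    -- is only kept as a multiple of `D`, by the pointwise bound `d ≤ D`.
    have hP2 : P ≤ b * (1 + H) * D := by
      have : P ≤ b * (d + D * κ) := hP ▸ hPb d κ k hd hκ hk
      refine this.trans ?_
      rw [mul_assoc]
      gcongr
      nlinarith
    have i1 : k * (D * k') ≤ c * (H + 1) * (c * (d' + D * κ')) := by gcongr
    have i2 : P * k' ≤ b * (1 + H) * (c * (d' + D * κ')) :=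
      calc P * k' ≤ b * (1 + H) * D * k' := by gcongr
        _ = b * (1 + H) * (D * k') := by ring
        _ ≤ _ := by gcongr
    have i3 : k * P' ≤ c * (H + 1) * (b * (d' + D * κ')) := by gcongr
    have j1 := mul_le_mul_of_nonneg_left i1 (by positivity : 0 ≤ 5 * C)
    have j2 := mul_le_mul_of_nonneg_left i2 (by positivity : 0 ≤ C)
    have j3 := mul_le_mul_of_nonneg_left i3 (by positivity : 0 ≤ C)
    have main : C * (5 * D) * k * k' + C * P * k' + C * k * P' ≤ A * (d' + D * κ') := by
      have j4 := mul_nonneg hA1 e0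
      have j5 := mul_nonneg hA2 e0
      have j6 : 0 ≤ b * (d' + D * κ') := by positivity
      have j8 : A * (d' + D * κ') = _ := congrArg (· * (d' + D * κ')) hA
      rw [j8]
      linarith
    exact ⟨main, by linarith⟩

/-! ### The perturbed soliton: existence and comparison. -/

section Core

variable {θ σ : ℝ → ℝ}

theorem integrable_seedSize (hθ : ContDiff ℝ 2 θ) (hθc : HasCompactSupport θ)
    (hσ : ContDiff ℝ 2 σ) (hσc : HasCompactSupport σ) : Integrable (seedSize θ σ) :=
  (((((continuous_deriv_deriv hθ).1.continuous.integrable_of_hasCompactSupport hθc.deriv).abs.add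
    ((continuous_deriv_deriv hσ).1.continuous.integrable_of_hasCompactSupport hσc.deriv).abs).add
    ((continuous_deriv_deriv hθ).2.integrable_of_hasCompactSupport hθc.deriv.deriv).abs).add
    ((continuous_deriv_deriv hσ).2.integrable_of_hasCompactSupport hσc.deriv.deriv).abs).add
    integrable_decay

theorem exists_seedSize_le (hθ : ContDiff ℝ 2 θ) (hθc : HasCompactSupport θ)
    (hσ : ContDiff ℝ 2 σ) (hσc : HasCompactSupport σ) :
    ∃ H : ℝ, 1 ≤ H ∧ ∀ y, seedSize θ σ y ≤ H := by
  obtain ⟨a, ha⟩ := (continuous_deriv_deriv hθ).1.continuous.bounded_above_of_compact_support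
    hθc.deriv
  obtain ⟨b, hb⟩ := (continuous_deriv_deriv hσ).1.continuous.bounded_above_of_compact_support
    hσc.deriv
  obtain ⟨c, hc⟩ := (continuous_deriv_deriv hθ).2.bounded_above_of_compact_support hθc.deriv.deriv
  obtain ⟨d, hd⟩ := (continuous_deriv_deriv hσ).2.bounded_above_of_compact_support hσc.deriv.deriv
  refine ⟨max 1 (a + b + c + d + 1), le_max_left _ _, fun y => le_max_of_le_right ?_⟩
  have := ha y; have := hb y; have := hc y; have := hd y; have := decay_le_one y
  simp only [Real.norm_eq_abs] at *
  unfold seedSize; linarith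

set_option maxHeartbeats 1000000 in
/-- The soliton and the solution with perturbed data, in null coordinates: the difference of first
(and second) null derivatives is controlled by the data along the corresponding characteristic. -/
theorem exists_perturbed_solution {μ lam : ℝ} (hθ : ContDiff ℝ 2 θ) (hθc : HasCompactSupport θ)
    (hσ : ContDiff ℝ 2 σ) (hσc : HasCompactSupport σ) (hμ : 0 < μ) (hμ1 : μ ≠ 1) :
    ∃ ε₁ : ℝ, 0 < ε₁ ∧ ε₁ ≤ 1 ∧ ∃ D₁ : ℝ, 0 < D₁ ∧ ∃ ρ : ℝ, 0 < ρ ∧ ∃ A : ℝ, 1 ≤ A ∧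
      ∀ ε : ℝ, 0 < ε → ε < ε₁ → (∀ t x, ρ ≤ solitonB θ σ μ lam ε t x) ∧
      ∀ z₀ w₀ s₀ m₀ : ℝ → ℝ, IsProfile z₀ w₀ s₀ m₀ → ∀ D : ℝ, 0 < D → D ≤ D₁ →
      ε * (∫ y, dataSize z₀ w₀ s₀ m₀ y) ≤ D →
      ∃ Λ φ : ℝ → ℝ → ℝ,
        IsTheSolution (solitonB θ σ μ lam ε) (solitonD θ σ μ lam ε) ε z₀ w₀ s₀ m₀ Λ φ ∧
        ∀ z s : ℝ → ℝ → ℝ, (∀ t x, z t x = Λ t x - solitonB θ σ μ lam ε t x) →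
          (∀ t x, s t x = φ t x - solitonD θ σ μ lam ε t x) →
          (∀ t x, Real.sinh (solitonB θ σ μ lam ε t x + z t x) ^ 2 ≤ A) ∧
          (∀ t x,
            |nullL z t x| ≤ A * (ε * dataSize z₀ w₀ s₀ m₀ (x + t) + D * seedSize θ σ (x + t)) ∧
            |nullL s t x| ≤ A * (ε * dataSize z₀ w₀ s₀ m₀ (x + t) + D * seedSize θ σ (x + t)) ∧
            |nullLbar z t x| ≤ A * (ε * dataSize z₀ w₀ s₀ m₀ (x - t) + D * seedSize θ σ (x - t)) ∧
            |nullLbar s t x| ≤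
              A * (ε * dataSize z₀ w₀ s₀ m₀ (x - t) + D * seedSize θ σ (x - t))) ∧
          ((∀ y, ε * dataSize z₀ w₀ s₀ m₀ y ≤ D) → ∀ t x,
            |nullL (pdx z) t x| ≤ A * (ε * dataSize (deriv z₀) (deriv w₀) (deriv s₀) (deriv m₀)
              (x + t) + ε * dataSize z₀ w₀ s₀ m₀ (x + t) + D * seedSize θ σ (x + t)) ∧
            |nullL (pdx s) t x| ≤ A * (ε * dataSize (deriv z₀) (deriv w₀) (deriv s₀) (deriv m₀)
              (x + t) + ε * dataSize z₀ w₀ s₀ m₀ (x + t) + D * seedSize θ σ (x + t)) ∧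
            |nullLbar (pdx z) t x| ≤ A * (ε * dataSize (deriv z₀) (deriv w₀) (deriv s₀) (deriv m₀)
              (x - t) + ε * dataSize z₀ w₀ s₀ m₀ (x - t) + D * seedSize θ σ (x - t)) ∧
            |nullLbar (pdx s) t x| ≤ A * (ε * dataSize (deriv z₀) (deriv w₀) (deriv s₀) (deriv m₀)
              (x - t) + ε * dataSize z₀ w₀ s₀ m₀ (x - t) + D * seedSize θ σ (x - t))) := by
  have hs := isSolitonParam_of_pos hμ hμ1
  set n := |speed μ| with hn
  set sl := 1 / sqrtc μ with hsl
  set r := speed μ * sqrtc μ with hr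
  set β := beta μ with hβ
  obtain ⟨x₀, hx₀⟩ : ∃ x₀, x₀ = solPsi n sl r β β⁻¹ lam 0 := ⟨_, rfl⟩
  have hx₀pos : 0 < x₀.1 := by
    rw [hx₀]; exact Real.arcosh_pos (hs.one_lt_solF lam 0)
  -- On the ball of radius `ρ` about `x₀` the first component lies in `[ρ, 3ρ]`; this yields the
  -- lower bound for the soliton and the upper bound for `sinh`.
  obtain ⟨ρ, hρ⟩ : ∃ ρ, ρ = x₀.1 / 2 := ⟨_, rfl⟩
  have hρ0 : 0 < ρ := by rw [hρ]; linarith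
  obtain ⟨C, hN⟩ := exists_isNullForm_pcfForm (x₀ := x₀) (ρ := ρ) (by rw [hρ]; linarith)
  have hC1 := hN.one_le
  obtain ⟨K, hK1, η, hη, hK⟩ := hs.exists_uniform_bounds lam (r₀ := ρ / 4) (by positivity)
  obtain ⟨H, hH1, hH⟩ := exists_seedSize_le hθ hθc hσ hσc
  obtain ⟨bθ, hbθ⟩ := hθ.continuous.bounded_above_of_compact_support hθc
  obtain ⟨bσ, hbσ⟩ := hσ.continuous.bounded_above_of_compact_support hσc
  have hbθ0 : 0 ≤ bθ := (norm_nonneg _).trans (hbθ 0)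
  have hbσ0 : 0 ≤ bσ := (norm_nonneg _).trans (hbσ 0)
  -- The two requirements on `∫ k` in the existence theorem.
  obtain ⟨κ₀, hκ₀⟩ : ∃ κ₀, κ₀ = min (1 / (100 * C)) (ρ / 2) := ⟨_, rfl⟩
  have hκpos : 0 < κ₀ := by rw [hκ₀]; exact lt_min (by positivity) (by positivity)
  -- The dominating function `k` is used as a divisor and must be positive everywhere; the summand
  -- `τ * decay` ensures this at the cost `κ₀ / 4` in the integral.
  obtain ⟨τ, hτ⟩ : ∃ τ, τ = κ₀ / (4 * ∫ y, decay y) := ⟨_, rfl⟩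
  have hJ := integral_decay_pos
  have hτ0 : 0 < τ := by rw [hτ]; positivity
  obtain ⟨A, hA1, hA⟩ := exists_comparison_const hC1 hK1 hτ0.le hH1
  have hIs := integrable_seedSize hθ hθc hσ hσc
  have hIs0 : 0 ≤ ∫ y, seedSize θ σ y := integral_nonneg fun y => seedSize_nonneg θ σ y
  obtain ⟨cθ', cθ''⟩ := continuous_deriv_deriv hθ
  obtain ⟨cσ', cσ''⟩ := continuous_deriv_deriv hσ
  have dθ : ∀ y, HasDerivAt θ (deriv θ y) y := fun y =>
    (hθ.differentiable (by norm_num) y).hasDerivAt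
  have dσ : ∀ y, HasDerivAt σ (deriv σ y) y := fun y =>
    (hσ.differentiable (by norm_num) y).hasDerivAt
  have dθ' : ∀ y, HasDerivAt (deriv θ) (deriv (deriv θ) y) y := fun y =>
    (cθ'.differentiable one_ne_zero y).hasDerivAt
  have dσ' : ∀ y, HasDerivAt (deriv σ) (deriv (deriv σ) y) y := fun y =>
    (cσ'.differentiable one_ne_zero y).hasDerivAt
  -- The bounds on `ε` keep the seeds within `η` of `(λ, 0)` and give `2 K ε ∫ seedSize ≤ κ₀ / 4`.
  -- Those on `D` give `2 ∫ d ≤ κ₀ / 4` and keep the perturbed data in the half ball. The factor of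
  -- `4 * A` covers `L = 2 ∂_v` and the two terms of `∂_v ∂ₓ`.
  refine ⟨min 1 (min (η / (bθ + bσ + 1)) (κ₀ / (8 * K * ((∫ y, seedSize θ σ y) + 1)))),
    by positivity, min_le_left _ _, min 1 (min (κ₀ / 8) (ρ / 4)), by positivity, ρ, hρ0,
    max (4 * A) (Real.sinh (3 * ρ) ^ 2), le_max_of_le_left (by linarith), fun ε hε hεlt => ?_⟩
  have hε1 : ε ≤ 1 := hεlt.le.trans (min_le_left _ _)
  have hεη : ε * (bθ + bσ + 1) ≤ η := by
    rw [← le_div_iff₀ (by positivity)]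
    exact hεlt.le.trans ((min_le_right _ _).trans (min_le_left _ _))
  have hεκ : 2 * K * ε * (∫ y, seedSize θ σ y) ≤ κ₀ / 4 := by
    have h1 : ε * (8 * K * ((∫ y, seedSize θ σ y) + 1)) ≤ κ₀ := by
      rw [← le_div_iff₀ (by positivity)]
      exact hεlt.le.trans ((min_le_right _ _).trans (min_le_right _ _))
    have : 0 ≤ ε * K := by positivity
    nlinarith
  set f : ℝ → ℝ := fun v => lam + ε * θ v with hf
  set g : ℝ → ℝ := fun w => ε * σ w with hg
  set f' : ℝ → ℝ := fun v => ε * deriv θ v with hf'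
  set g' : ℝ → ℝ := fun v => ε * deriv σ v with hg'
  set f'' : ℝ → ℝ := fun v => ε * deriv (deriv θ) v with hf''
  set g'' : ℝ → ℝ := fun v => ε * deriv (deriv σ) v with hg''
  have df : ∀ y, HasDerivAt f (f' y) y := fun y => ((dθ y).const_mul ε).const_add lam
  have dg : ∀ y, HasDerivAt g (g' y) y := fun y => (dσ y).const_mul ε
  have df' : ∀ y, HasDerivAt f' (f'' y) y := fun y => (dθ' y).const_mul ε
  have dg' : ∀ y, HasDerivAt g' (g'' y) y := fun y => (dσ' y).const_mul ε
  have cf : Continuous f := continuous_const.add (continuous_const.mul hθ.continuous)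
  have cg : Continuous g := continuous_const.mul hσ.continuous
  have cf' : Continuous f' := continuous_const.mul cθ'.continuous
  have cg' : Continuous g' := continuous_const.mul cσ'.continuous
  have cf'' : Continuous f'' := continuous_const.mul cθ''
  have cg'' : Continuous g'' := continuous_const.mul cσ''
  have hfb : ∀ y, |f y - lam| ≤ η := fun y => by
    simp only [hf, add_sub_cancel_left, abs_mul, abs_of_pos hε]
    have := hbθ y
    rw [Real.norm_eq_abs] at this
    exact (mul_le_mul_of_nonneg_left (by linarith) hε.le).trans hεη
  have hgb : ∀ y, |g y| ≤ η := fun y => by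
    simp only [hg, abs_mul, abs_of_pos hε]
    have := hbσ y
    rw [Real.norm_eq_abs] at this
    exact (mul_le_mul_of_nonneg_left (by linarith) hε.le).trans hεη
  set XB : ℝ → ℝ → ℝ × ℝ := fun w v => solPsi n sl r β β⁻¹ (f v) (g w) with hXB
  set pB : ℝ → ℝ → ℝ × ℝ := fun w v => f' v • solPsiA n sl r β β⁻¹ (f v) (g w) with hpB
  set qB : ℝ → ℝ → ℝ × ℝ := fun w v => g' w • solPsiA n sl r β⁻¹ β (g w) (f v) with hqB
  have hfield : IsNullField pcfForm XB pB qB := hs.isNullField df dg cf' cg'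
  set aB : ℝ → ℝ → ℝ × ℝ := fun w v => f'' v • solPsiA n sl r β β⁻¹ (f v) (g w) +
    f' v ^ 2 • solPsiAA n sl r β β⁻¹ (f v) (g w) with haB
  set bB : ℝ → ℝ → ℝ × ℝ := fun w v => g'' w • solPsiA n sl r β⁻¹ β (g w) (f v) +
    g' w ^ 2 • solPsiAA n sl r β⁻¹ β (g w) (f v) with hbB
  have daB : ∀ w v, HasDerivAt (fun y => pB w y) (aB w v) v := fun w v =>
    hs.hasDerivAt_deriv df df' (g w) v
  have dbB : ∀ w v, HasDerivAt (fun y => qB y v) (bB w v) w := fun w v =>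
    hs.swap.hasDerivAt_deriv dg dg' (f v) w
  have caB : Continuous (Function.uncurry aB) := hs.continuous_deriv cf cf' cf'' cg
  have cbB : Continuous (Function.uncurry bB) :=
    (hs.swap.continuous_deriv cg cg' cg'' cf).comp continuous_swap
  have hXBx : ∀ w v, ‖XB w v - x₀‖ ≤ ρ / 4 := fun w v => by
    rw [hx₀]; exact (hK _ _ (hfb v) (hgb w)).2.2.2.2
  have hfst : ∀ x ∈ Metric.closedBall x₀ ρ, ρ ≤ x.1 ∧ x.1 ≤ 3 * ρ := fun x hx => by
    have h1 : |x.1 - x₀.1| ≤ ρ := by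
      rw [Metric.mem_closedBall, dist_eq_norm] at hx
      exact (norm_fst_le (x - x₀)).trans hx
    have := abs_le.1 h1
    constructor <;> linarith
  have hXBmem : ∀ w v, XB w v ∈ Metric.closedBall x₀ ρ := fun w v => by
    rw [Metric.mem_closedBall, dist_eq_norm]; linarith [hXBx w v]
  have hBtx : solitonB θ σ μ lam ε = toTX fun w v => (XB w v).1 := funext fun t => funext fun x =>
    solitonB_eq θ σ μ lam ε t x
  have hDtx : solitonD θ σ μ lam ε = toTX fun w v => (XB w v).2 := funext fun t => funext fun x =>
    solitonD_eq θ σ μ lam ε t x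
  have hBpos : ∀ w v, 0 < (XB w v).1 := fun w v => hρ0.trans_le (hfst _ (hXBmem w v)).1
  refine ⟨fun t x => by rw [hBtx]; exact (hfst _ (hXBmem _ _)).1,
    fun z₀ w₀ s₀ m₀ hprof D hD hD1 hdD => ?_⟩
  have hD1' : D ≤ 1 := hD1.trans (min_le_left _ _)
  have hDκ : D ≤ κ₀ / 8 := hD1.trans ((min_le_right _ _).trans (min_le_left _ _))
  have hDρ : D ≤ ρ / 4 := hD1.trans ((min_le_right _ _).trans (min_le_right _ _))
  set d : ℝ → ℝ := fun y => ε * dataSize z₀ w₀ s₀ m₀ y with hd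
  set d₁ : ℝ → ℝ := fun y => ε * dataSize (deriv z₀) (deriv w₀) (deriv s₀) (deriv m₀) y with hd₁
  have hd0 : ∀ y, 0 ≤ d y := fun y => mul_nonneg hε.le (dataSize_nonneg _ _ _ _ y)
  have hd₁0 : ∀ y, 0 ≤ d₁ y := fun y => mul_nonneg hε.le (dataSize_nonneg _ _ _ _ y)
  have cd : Continuous d := continuous_const.mul hprof.continuous_dataSize
  have hdi : Integrable d := hprof.integrable_dataSize.const_mul ε
  have hdI : ∫ y, d y ≤ D := by rw [hd, integral_const_mul]; exact hdD
  -- Half of `k` has to dominate the null derivatives of the soliton together with those of the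
  -- perturbation.
  set k : ℝ → ℝ := fun y => 2 * K * ε * (|deriv θ y| + |deriv σ y|) + 2 * d y + τ * decay y with hk
  have hk0 : ∀ y, 0 < k y := fun y => by
    have := hd0 y; have := decay_pos y
    simp only [hk]; positivity
  have ck : Continuous k :=
    ((continuous_const.mul (cθ'.continuous.abs.add cσ'.continuous.abs)).add
      (continuous_const.mul cd)).add (continuous_const.mul continuous_decay)
  have hseed : ∀ y, |deriv θ y| + |deriv σ y| ≤ seedSize θ σ y := fun y => by
    have := decay_pos y; have := abs_nonneg (deriv (deriv θ) y)
    have := abs_nonneg (deriv (deriv σ) y)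
    unfold seedSize; linarith
  have hseed2 : ∀ y, |deriv (deriv θ) y| + |deriv (deriv σ) y| ≤ seedSize θ σ y := fun y => by
    have := decay_pos y; have := abs_nonneg (deriv θ y)
    have := abs_nonneg (deriv σ y)
    unfold seedSize; linarith
  have hseed3 : ∀ y, decay y ≤ seedSize θ σ y := fun y => by
    unfold seedSize
    linarith [abs_nonneg (deriv (deriv θ) y), abs_nonneg (deriv (deriv σ) y),
      abs_nonneg (deriv θ y), abs_nonneg (deriv σ y)]
  have hkle' : ∀ y, k y ≤ 2 * K * ε * seedSize θ σ y + 2 * d y + τ * decay y := fun y => by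
    simp only [hk]; have := hseed y; gcongr
  have hki' : Integrable fun y => 2 * K * ε * seedSize θ σ y + 2 * d y + τ * decay y :=
    ((hIs.const_mul _).add (hdi.const_mul 2)).add (integrable_decay.const_mul τ)
  have hki : Integrable k := hki'.mono' ck.aestronglyMeasurable (ae_of_all _ fun y => by
    rw [Real.norm_of_nonneg (hk0 y).le]; exact hkle' y)
  have hkI : ∫ y, k y ≤ κ₀ := by
    refine (integral_mono hki hki' hkle').trans ?_
    have i1 : Integrable fun y => 2 * K * ε * seedSize θ σ y + 2 * d y :=
      (hIs.const_mul _).add (hdi.const_mul 2)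
    rw [integral_add i1 (integrable_decay.const_mul τ), integral_add (hIs.const_mul _) (hdi.const_mul 2), integral_const_mul,
      integral_const_mul (2 : ℝ) d, integral_const_mul τ decay]
    have : τ * ∫ y, decay y = κ₀ / 4 := by rw [hτ]; field_simp
    linarith
  have hCk : C * ∫ y, k y ≤ 1 / 100 :=
    calc C * ∫ y, k y ≤ C * (1 / (100 * C)) := by
          gcongr; exact hkI.trans (by rw [hκ₀]; exact min_le_left _ _)
      _ = 1 / 100 := by field_simp
  have hkρ : ∫ y, k y ≤ ρ / 2 := hkI.trans (by rw [hκ₀]; exact min_le_right _ _)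
  have hpBn : ∀ w v, ‖pB w v‖ ≤ K * ε * (|deriv θ v| + |deriv σ v|) := fun w v => by
    simp only [hpB, hf', norm_smul, norm_mul, Real.norm_eq_abs, abs_of_pos hε]
    have h1 := (hK _ _ (hfb v) (hgb w)).1
    calc _ ≤ ε * |deriv θ v| * K := by gcongr
      _ ≤ ε * (|deriv θ v| + |deriv σ v|) * K := by
        gcongr; linarith [abs_nonneg (deriv σ v)]
      _ = _ := by ring
  have hqBn : ∀ w v, ‖qB w v‖ ≤ K * ε * (|deriv θ w| + |deriv σ w|) := fun w v => by
    simp only [hqB, hg', norm_smul, norm_mul, Real.norm_eq_abs, abs_of_pos hε]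
    have h1 := (hK _ _ (hfb v) (hgb w)).2.1
    calc _ ≤ ε * |deriv σ w| * K := by gcongr
      _ ≤ ε * (|deriv θ w| + |deriv σ w|) * K := by
        gcongr; linarith [abs_nonneg (deriv θ w)]
      _ = _ := by ring
  have hkhalf : ∀ y, K * ε * (|deriv θ y| + |deriv σ y|) + d y ≤ k y / 2 := fun y => by
    have : 0 ≤ τ * decay y := mul_nonneg hτ0.le (decay_pos y).le
    simp only [hk]; linarith
  have hBsol : IsNullSolution pcfForm (Metric.closedBall x₀ ρ) k XB pB qB :=
    ⟨hfield, hXBmem, fun w v => by linarith [hpBn w v, hkhalf v, hd0 v, hk0 v],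
      fun w v => by linarith [hqBn w v, hkhalf w, hd0 w, hk0 w]⟩
  have hder : ∀ {h : ℝ → ℝ}, ContDiff ℝ ∞ h → ∀ y, HasDerivAt h (deriv h y) y := fun hh y =>
    (hh.differentiable (by simp) y).hasDerivAt
  set l : ℝ → ℝ := fun y => K * (seedSize θ σ y + seedSize θ σ y * seedSize θ σ y) with hl
  have hlb : ∀ (u₁ u₂ : ℝ) (A₁ A₂ : ℝ × ℝ) (y : ℝ), |u₁| ≤ seedSize θ σ y →
      |u₂| ≤ seedSize θ σ y → ‖A₁‖ ≤ K → ‖A₂‖ ≤ K →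
      ‖(ε * u₁) • A₁ + (ε * u₂) ^ 2 • A₂‖ ≤ l y := fun u₁ u₂ A₁ A₂ y h1 h2 h3 h4 => by
    refine (norm_add_le _ _).trans ?_
    rw [norm_smul, norm_smul, Real.norm_eq_abs, Real.norm_eq_abs, abs_pow, abs_mul, abs_mul,
      abs_of_pos hε]
    have e1 : ε * |u₁| ≤ seedSize θ σ y :=
      (mul_le_of_le_one_left (abs_nonneg _) hε1).trans h1
    have e2 : ε * |u₂| ≤ seedSize θ σ y :=
      (mul_le_of_le_one_left (abs_nonneg _) hε1).trans h2
    have := seedSize_nonneg θ σ y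
    calc _ ≤ seedSize θ σ y * K + seedSize θ σ y ^ 2 * K := by gcongr
      _ = _ := by simp only [hl]; ring
  obtain ⟨P, hP⟩ : ∃ P : ℝ → ℝ, P = fun y => 2 * d y + (8 * C + 1) * D * k y := ⟨_, rfl⟩
  obtain ⟨A₂, hA₂⟩ : ∃ A₂ : ℝ → ℝ, A₂ = fun y => 2 * (d₁ y + (C * (5 * D) * k y * k y +
      C * P y * k y + C * k y * P y)) + 10 * C ^ 2 * (5 * D * k y ^ 2 + P y * k y + 5 * D * l y) :=
    ⟨_, rfl⟩
  have hprod : ∀ (u v : ℝ) , ‖((ε * u, ε * v) : ℝ × ℝ)‖ ≤ ε * (|u| + |v|) := fun u v => by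
    rw [Prod.norm_def]
    simp only [Real.norm_eq_abs, abs_mul, abs_of_pos hε]
    have := mul_nonneg hε.le (abs_nonneg u)
    have := mul_nonneg hε.le (abs_nonneg v)
    exact max_le (by linarith) (by linarith)
  obtain ⟨X, p, q, a, b, hX, da, db, ca, cb, eX, epq, hcmp⟩ := exists_perturbed_isNullSolution
    hN hBsol daB dbB caB cbB ck hk0 hki hCk hkρ
    (ζ := fun y => (ε * z₀ y, ε * s₀ y)) (ζ' := fun y => (ε * deriv z₀ y, ε * deriv s₀ y))
    (ζ'' := fun y => (ε * deriv (deriv z₀) y, ε * deriv (deriv s₀) y))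
    (χ := fun y => (ε * w₀ y, ε * m₀ y)) (χ' := fun y => (ε * deriv w₀ y, ε * deriv m₀ y))
    (fun y => ((hder hprof.smooth_z y).const_mul ε).prodMk ((hder hprof.smooth_s y).const_mul ε))
    (fun y => ((hder hprof.deriv.smooth_z y).const_mul ε).prodMk
      ((hder hprof.deriv.smooth_s y).const_mul ε))
    (fun y => ((hder hprof.smooth_w y).const_mul ε).prodMk ((hder hprof.smooth_m y).const_mul ε))
    ((continuous_const.mul hprof.deriv.deriv.smooth_z.continuous).prodMk
      (continuous_const.mul hprof.deriv.deriv.smooth_s.continuous))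
    ((continuous_const.mul hprof.deriv.smooth_w.continuous).prodMk
      (continuous_const.mul hprof.deriv.smooth_m.continuous))
    (d₁ := d₁) (l := l) cd hdi hD hdI
    (fun y => (add_le_add (hprod _ _) (hprod _ _)).trans (le_of_eq (by
      simp only [hd, dataSize]; ring)))
    (fun y => (add_le_add (hprod _ _) (hprod _ _)).trans (le_of_eq (by
      simp only [hd₁, dataSize]; ring)))
    (fun y => by
      obtain ⟨h1, h2⟩ := hprof.abs_le_integral_dataSize y
      rw [Prod.norm_def]
      simp only [Real.norm_eq_abs, abs_mul, abs_of_pos hε]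
      exact (max_le (by gcongr) (by gcongr)).trans hdD)
    (fun y => by
      obtain ⟨h1, h2⟩ := hprof.abs_le_integral_dataSize y
      have : ‖((ε * z₀ y, ε * s₀ y) : ℝ × ℝ)‖ ≤ D := by
        rw [Prod.norm_def]
        simp only [Real.norm_eq_abs, abs_mul, abs_of_pos hε]
        exact (max_le (by gcongr) (by gcongr)).trans hdD
      linarith [hXBx y y])
    (fun y => (add_le_add_left (hpBn y y) _).trans (hkhalf y))
    (fun y => (add_le_add_left (hqBn y y) _).trans (hkhalf y))
    (fun w v => hlb _ _ _ _ v
      (by linarith [hseed2 v, abs_nonneg (deriv (deriv σ) v)])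
      (by linarith [hseed v, abs_nonneg (deriv σ v)])
      (hK _ _ (hfb v) (hgb w)).1 (hK _ _ (hfb v) (hgb w)).2.2.1)
    (fun w v => hlb _ _ _ _ w
      (by linarith [hseed2 w, abs_nonneg (deriv (deriv θ) w)])
      (by linarith [hseed w, abs_nonneg (deriv θ w)])
      (hK _ _ (hfb v) (hgb w)).2.1 (hK _ _ (hfb v) (hgb w)).2.2.2.1)
    hP hA₂
  have hXpos : ∀ w v, 0 < (X w v).1 := fun w v => hρ0.trans_le (hfst _ (hX.mem w v)).1
  have hsol := hX.toIsNullField.isGlobalSolution hXpos da db ca cb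
  have n1 := hX.toIsNullField.isNullC2_fst hXpos da db ca cb
  have n2 := hX.toIsNullField.isNullC2_snd hXpos da db ca cb
  have m1 := hfield.isNullC2_fst hBpos daB dbB caB cbB
  have m2 := hfield.isNullC2_snd hBpos daB dbB caB cbB
  have hdata : HasPerturbedData (solitonB θ σ μ lam ε) (solitonD θ σ μ lam ε) ε z₀ w₀ s₀ m₀
      (toTX fun w v => (X w v).1) (toTX fun w v => (X w v).2) := by
    rw [hBtx, hDtx]
    constructor
    · intro x; simp [toTX, eX]
    · intro x
      rw [n1.pdt_eq, m1.pdt_eq]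
      simpa [toTX] using congrArg Prod.fst (epq x)
    · intro x; simp [toTX, eX]
    · intro x
      rw [n2.pdt_eq, m2.pdt_eq]
      simpa [toTX] using congrArg Prod.snd (epq x)
  refine ⟨toTX fun w v => (X w v).1, toTX fun w v => (X w v).2, ⟨hsol, hdata,
    fun Λ' φ' h1 h2 => hsol.eq_of_data_eq h1 (fun x => hXpos _ _)
      (fun x => (h2.left x).trans (hdata.left x).symm)
      (fun x => (h2.left_t x).trans (hdata.left_t x).symm)
      (fun x => (h2.right x).trans (hdata.right x).symm)
      (fun x => (h2.right_t x).trans (hdata.right_t x).symm)⟩, fun z s hz hs' => ?_⟩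
  have c1 := n1.sub m1
  have c2 := n2.sub m2
  have ez : z = toTX fun w v => (X w v).1 - (XB w v).1 := funext fun t => funext fun x => by
    rw [hz, hBtx]; rfl
  have es : s = toTX fun w v => (X w v).2 - (XB w v).2 := funext fun t => funext fun x => by
    rw [hs', hDtx]; rfl
  have hfs : ∀ {x y : ℝ × ℝ} {R : ℝ}, ‖x - y‖ ≤ R → |x.1 - y.1| ≤ R ∧ |x.2 - y.2| ≤ R :=
    fun {x y R} h => ⟨(norm_fst_le (x - y)).trans h, (norm_snd_le (x - y)).trans h⟩
  set κ := seedSize θ σ with hκdef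
  have hκ0 : ∀ y, 0 ≤ κ y := fun y => seedSize_nonneg θ σ y
  have hkκ : ∀ y, k y ≤ 2 * K * κ y + 2 * d y + τ * κ y := fun y => by
    refine (hkle' y).trans ?_
    have e1 : 2 * K * ε * κ y ≤ 2 * K * κ y := by
      have : 0 ≤ 2 * K * κ y := by have := hκ0 y; positivity
      nlinarith
    have := hseed3 y
    gcongr
  obtain ⟨hAP, hAR⟩ := hA D hD hD1'
  have hPA : ∀ y, 2 * P y ≤ max (4 * A) (Real.sinh (3 * ρ) ^ 2) * (d y + D * κ y) := fun y => by
    have h1 := hAP (d y) (κ y) (k y) (hd0 y) (hκ0 y) (hkκ y)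
    have e0 : 0 ≤ d y + D * κ y := add_nonneg (hd0 y) (mul_nonneg hD.le (hκ0 y))
    have h2 := mul_le_mul_of_nonneg_right (le_max_left (4 * A) (Real.sinh (3 * ρ) ^ 2)) e0
    have h3 : 0 ≤ A * (d y + D * κ y) := mul_nonneg (by linarith) e0
    simp only [hP]
    linarith
  have hRA : ∀ y R T : ℝ, R ≤ A * (d₁ y + d y + D * κ y) → T ≤ A * (d y + D * κ y) →
      2 * (R + T) ≤ max (4 * A) (Real.sinh (3 * ρ) ^ 2) * (d₁ y + d y + D * κ y) :=
    fun y R T hR hT => by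
      have e0 : 0 ≤ d₁ y + d y + D * κ y :=
        add_nonneg (add_nonneg (hd₁0 y) (hd0 y)) (mul_nonneg hD.le (hκ0 y))
      have e1 := mul_le_mul_of_nonneg_right (le_max_left (4 * A) (Real.sinh (3 * ρ) ^ 2)) e0
      have e2 := mul_nonneg (zero_le_one.trans hA1) (hd₁0 y)
      linarith
  refine ⟨fun t x => ?_, fun t x => ?_, fun hdd t x => ?_⟩
  · have e : solitonB θ σ μ lam ε t x + z t x = (X (x - t) (x + t)).1 := by
      rw [hz]; simp [toTX]
    rw [e]
    obtain ⟨h1, h2⟩ := hfst _ (hX.mem (x - t) (x + t))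
    refine le_max_of_le_right (pow_le_pow_left₀ (Real.sinh_nonneg_iff.2 (by linarith)) ?_ 2)
    exact Real.sinh_le_sinh.2 h2
  -- `L = 2 ∂_v` and `∂ₜ - ∂ₓ = -2 ∂_w`, so each null derivative is controlled on its own
  -- characteristic.
  · obtain ⟨hp, hq, -⟩ := hcmp (x - t) (x + t)
    simp only [nullL, nullLbar, ez, es]
    rw [c1.pdt_eq, c1.pdx_eq, c2.pdt_eq, c2.pdx_eq]
    simp only [toTX]
    have key : ∀ u v R S : ℝ, |u| ≤ R → |v| ≤ S → |u - v + (u + v)| ≤ 2 * R ∧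
        |u - v - (u + v)| ≤ 2 * S := fun u v R S hu hv => by
      rw [show u - v + (u + v) = 2 * u by ring, show u - v - (u + v) = -(2 * v) by ring, abs_neg,
        abs_mul, abs_mul, abs_two]
      constructor <;> linarith
    have k1 := key _ _ _ _ (hfs hp).1 (hfs hq).1
    have k2 := key _ _ _ _ (hfs hp).2 (hfs hq).2
    exact ⟨k1.1.trans (hPA _), k2.1.trans (hPA _), k1.2.trans (hPA _), k2.2.trans (hPA _)⟩
  -- `L ∂ₓ = 2 (∂_v² + ∂_w ∂_v)`. The mixed derivative is the source; its difference is charged to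
  -- `x + t` for `L` and to `x - t` for the other null derivative.
  · obtain ⟨hp, hq, hG, ha, hb⟩ := hcmp (x - t) (x + t)
    simp only [nullL, nullLbar, ez, es]
    rw [c1.pdt_pdx_eq, c1.pdx_pdx_eq, c2.pdt_pdx_eq, c2.pdx_pdx_eq]
    simp only [toTX]
    have key : ∀ u v c R S T : ℝ, |u| ≤ R → |v| ≤ S → |c| ≤ T →
        |u + c - (c + v) + (u + c + (c + v))| ≤ 2 * (R + T) ∧
        |u + c - (c + v) - (u + c + (c + v))| ≤ 2 * (S + T) := fun u v c R S T hu hv hc => by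
      rw [show u + c - (c + v) + (u + c + (c + v)) = 2 * (u + c) by ring,
        show u + c - (c + v) - (u + c + (c + v)) = -(2 * (v + c)) by ring, abs_neg,
        abs_mul, abs_mul, abs_two]
      have := abs_add_le u c
      have := abs_add_le v c
      constructor <;> linarith
    have k1 := key _ _ _ _ _ _ (hfs ha).1 (hfs hb).1 (hfs hG).1
    have k2 := key _ _ _ _ _ _ (hfs ha).2 (hfs hb).2 (hfs hG).2
    obtain ⟨hv, hv'⟩ := hAR (d (x + t)) (κ (x + t)) (k (x + t)) (d₁ (x + t)) (l (x + t)) (P (x + t))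
      (hd0 _) (hdd _) (hκ0 _) (hH _) (hd₁0 _) (hk0 _).le (hkκ _) le_rfl (congrFun hP _)
    obtain ⟨hw, hw'⟩ := hAR (d (x - t)) (κ (x - t)) (k (x - t)) (d₁ (x - t)) (l (x - t)) (P (x - t))
      (hd0 _) (hdd _) (hκ0 _) (hH _) (hd₁0 _) (hk0 _).le (hkκ _) le_rfl (congrFun hP _)
    have hGv := (hw' (d (x + t)) (κ (x + t)) (k (x + t)) (P (x + t))
      (hd0 _) (hdd _) (hκ0 _) (hH _) (hk0 _).le (hkκ _) (congrFun hP _)).1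
    have hGw := (hv' (d (x - t)) (κ (x - t)) (k (x - t)) (P (x - t))
      (hd0 _) (hdd _) (hκ0 _) (hH _) (hk0 _).le (hkκ _) (congrFun hP _)).2
    have hRv := hRA (x + t) _ _ ((congrFun hA₂ _).le.trans hv) hGv
    have hRw := hRA (x - t) _ _ ((congrFun hA₂ _).le.trans hw) hGw
    exact ⟨k1.1.trans hRv, k2.1.trans hRv, k1.2.trans hRw, k2.2.trans hRw⟩

end Core

/-! ### Integral estimates -/

/-- By translation invariance the bound is independent of `t`; this turns pointwise control on
characteristics into energy bounds for all times. -/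
theorem lintegral_ofReal_le_of_null {f g : ℝ → ℝ} (hg : Continuous g) (hg0 : ∀ y, 0 ≤ g y)
    (hgi : Integrable g) {t : ℝ} (h : ∀ x, f x ≤ g (x + t) + g (x - t)) :
    ∫⁻ x, ENNReal.ofReal (f x) ≤ ENNReal.ofReal (2 * ∫ y, g y) := by
  have hm : Measurable fun x => ENNReal.ofReal (g (x + t)) :=
    (hg.comp (continuous_add_const t)).measurable.ennreal_ofReal
  calc ∫⁻ x, ENNReal.ofReal (f x)
      ≤ ∫⁻ x, (ENNReal.ofReal (g (x + t)) + ENNReal.ofReal (g (x - t))) :=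
        lintegral_mono fun x => (ENNReal.ofReal_le_ofReal (h x)).trans ENNReal.ofReal_add_le
    _ = (∫⁻ y, ENNReal.ofReal (g y)) + ∫⁻ y, ENNReal.ofReal (g y) := by
        rw [lintegral_add_left hm,
          lintegral_add_right_eq_self (fun y => ENNReal.ofReal (g y)) t,
          lintegral_sub_right_eq_self (fun y => ENNReal.ofReal (g y)) t]
    _ = _ := by
        rw [← ofReal_integral_eq_lintegral_ofReal hgi (ae_of_all _ hg0),
          ← ENNReal.ofReal_add (integral_nonneg hg0) (integral_nonneg hg0), two_mul]

/-- As `|ν| < 1` and the window has width `o(t)`, both `|x + t|` and `|x - t|` are at least `c t` on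
it, so only the tails of `g` contribute. -/
theorem tendsto_lintegral_cone {f : ℝ → ℝ → ℝ} {g : ℝ → ℝ} (hg : Continuous g)
    (hgi : Integrable g) (h : ∀ t x, f t x ≤ g (x + t) + g (x - t)) {ν : ℝ}
    (hν : ν ∈ Ioo (-1 : ℝ) 1) :
    Tendsto (fun t : ℝ => ∫⁻ x in Icc (ν * t - t / Real.log t ^ 2) (ν * t + t / Real.log t ^ 2),
      ENNReal.ofReal (f t x)) atTop (𝓝 0) := by
  -- Chosen so that `|ν| + c = 1 - c`: one `c` is spent on the width of the window, the other is the
  -- remaining distance to the cone.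
  obtain ⟨c, hc⟩ : ∃ c, c = (1 - |ν|) / 2 := ⟨_, rfl⟩
  have hν1 : |ν| < 1 := abs_lt.2 hν
  have hc0 : 0 < c := by rw [hc]; linarith
  set G : ℝ → ℝ → ℝ≥0∞ := fun t => indicator {y : ℝ | c * t ≤ |y|} fun y => ENNReal.ofReal (g y)
    with hG
  have hset : ∀ t, MeasurableSet {y : ℝ | c * t ≤ |y|} := fun t =>
    measurableSet_le measurable_const continuous_abs.measurable
  have hGm : ∀ t, Measurable (G t) := fun t => hg.measurable.ennreal_ofReal.indicator (hset t)
  have hfin : ∫⁻ y, ENNReal.ofReal (g y) ≠ ⊤ := by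
    refine ne_of_lt (lt_of_le_of_lt (lintegral_mono fun y => ?_) hgi.hasFiniteIntegral)
    rw [← ofReal_norm]
    exact ENNReal.ofReal_le_ofReal (le_abs_self _)
  have hlim : Tendsto (fun t => (∫⁻ y, G t y) + ∫⁻ y, G t y) atTop (𝓝 0) := by
    have h0 : Tendsto (fun t => ∫⁻ y, G t y) atTop (𝓝 (∫⁻ _ : ℝ, (0 : ℝ≥0∞))) := by
      refine tendsto_lintegral_filter_of_dominated_convergence (fun y => ENNReal.ofReal (g y))
        (Eventually.of_forall hGm)
        (Eventually.of_forall fun t => ae_of_all _ fun y => indicator_le_self _ _ y) hfin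
        (ae_of_all _ fun y => ?_)
      refine tendsto_const_nhds.congr' ?_
      filter_upwards [eventually_gt_atTop (|y| / c)] with t ht
      have : ¬ c * t ≤ |y| := by
        rw [not_le, mul_comm]; exact (div_lt_iff₀ hc0).1 ht
      simp [hG, this]
    have := h0.add h0
    simpa using this
  refine tendsto_of_tendsto_of_tendsto_of_le_of_le' tendsto_const_nhds hlim
    (Eventually.of_forall fun _ => zero_le) ?_
  have hlog : Tendsto (fun t : ℝ => (Real.log t ^ 2)⁻¹) atTop (𝓝 0) :=
    ((tendsto_pow_atTop two_ne_zero).comp Real.tendsto_log_atTop).inv_tendsto_atTop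
  filter_upwards [hlog.eventually_le_const hc0, eventually_gt_atTop 0] with t ht ht0
  have hw : t / Real.log t ^ 2 ≤ c * t := by
    rw [div_eq_mul_inv, mul_comm]; gcongr
  have hνt : |ν * t| = |ν| * t := by rw [abs_mul, abs_of_pos ht0]
  have hm : Measurable fun x => G t (x + t) := (hGm t).comp (measurable_add_const t)
  calc _ ≤ ∫⁻ x in Icc (ν * t - t / Real.log t ^ 2) (ν * t + t / Real.log t ^ 2),
          (G t (x + t) + G t (x - t)) := by
        refine setLIntegral_mono' measurableSet_Icc fun x hx => ?_
        have hx' : |x| ≤ |ν| * t + c * t := by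
          rw [← hνt, abs_le]
          have := abs_le.1 (le_refl |ν * t|)
          constructor <;> linarith [hx.1, hx.2]
        have e : |ν| * t + c * t = t - c * t := by rw [hc]; ring
        rw [e] at hx'
        have h1 : c * t ≤ |x + t| := by
          have := neg_abs_le x
          exact le_trans (by linarith) (le_abs_self _)
        have h2 : c * t ≤ |x - t| := by
          have := le_abs_self x
          exact le_trans (by linarith) (neg_le_abs _)
        simp only [hG, indicator_of_mem (show x + t ∈ {y : ℝ | c * t ≤ |y|} from h1),
          indicator_of_mem (show x - t ∈ {y : ℝ | c * t ≤ |y|} from h2)]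
        exact (ENNReal.ofReal_le_ofReal (h t x)).trans ENNReal.ofReal_add_le
    _ ≤ ∫⁻ x, (G t (x + t) + G t (x - t)) := setLIntegral_le_lintegral _ _
    _ = _ := by
        rw [lintegral_add_left hm, lintegral_add_right_eq_self (G t) t,
          lintegral_sub_right_eq_self (G t) t]

/-- Cauchy-Schwarz against the weight `1 + y²`. -/
theorem integral_abs_le_sqrt {f : ℝ → ℝ} (hf : Integrable f)
    (hf2 : Integrable fun y => (1 + y ^ 2) * f y ^ 2) {q : ℝ} (hq : 0 < q)
    (h : ∫ y, (1 + y ^ 2) * f y ^ 2 ≤ q) : ∫ y, |f y| ≤ √(Real.pi * q) := by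
  have hπ := Real.pi_pos
  -- The parameter of the inequality `|f| ≤ (a/2)(1 + y²) f² + 1 / (2 a (1 + y²))`; this value makes
  -- both integrals at most `√(π q) / 2`.
  obtain ⟨a, ha⟩ : ∃ a, a = √(Real.pi * q) / q := ⟨_, rfl⟩
  have hs : 0 < √(Real.pi * q) := Real.sqrt_pos.2 (by positivity)
  have ha0 : 0 < a := by rw [ha]; positivity
  have h1 : ∫ y, |f y| ≤
      ∫ y, (a / 2 * ((1 + y ^ 2) * f y ^ 2) + a⁻¹ / 2 * (1 + y ^ 2)⁻¹) := by
    refine integral_mono hf.abs ((hf2.const_mul _).add (integrable_inv_one_add_sq.const_mul _))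
      fun y => ?_
    have hy : 0 < 1 + y ^ 2 := by positivity
    have e : a / 2 * ((1 + y ^ 2) * f y ^ 2) + a⁻¹ / 2 * (1 + y ^ 2)⁻¹ - |f y| =
        (a * (1 + y ^ 2) * |f y| - 1) ^ 2 / (2 * (a * (1 + y ^ 2))) := by
      rw [← sq_abs (f y)]; field_simp; ring
    have : 0 ≤ (a * (1 + y ^ 2) * |f y| - 1) ^ 2 / (2 * (a * (1 + y ^ 2))) := by positivity
    simp only
    linarith
  rw [integral_add (hf2.const_mul _) (integrable_inv_one_add_sq.const_mul _), integral_const_mul,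
    integral_const_mul, integral_univ_inv_one_add_sq] at h1
  have h2 : a * q = √(Real.pi * q) := by rw [ha]; field_simp
  have h3 : a⁻¹ * Real.pi = √(Real.pi * q) := by
    rw [ha, inv_div, div_mul_eq_mul_div, div_eq_iff hs.ne', Real.mul_self_sqrt (by positivity)]
    ring
  have h4 := mul_le_mul_of_nonneg_left h ha0.le
  linarith

theorem integral_lt_of_lintegral_lt {f : ℝ → ℝ} {b : ℝ} (hf : Integrable f) (hf0 : ∀ y, 0 ≤ f y)
    (h : ∫⁻ y, ENNReal.ofReal (f y) < ENNReal.ofReal b) : ∫ y, f y < b := by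
  rw [← ofReal_integral_eq_lintegral_ofReal hf (ae_of_all _ hf0)] at h
  exact (ENNReal.ofReal_lt_ofReal_iff_of_nonneg (integral_nonneg hf0)).1 h

/-! ### Weights and weighted sizes of the data. -/

theorem continuous_weight (η : ℝ) : Continuous (weight η) :=
  Continuous.rpow_const (by fun_prop) fun y => Or.inl (by positivity)

theorem weight_nonneg (η r : ℝ) : 0 ≤ weight η r := by unfold weight; positivity

theorem le_weight {η : ℝ} (hη : 0 < η) (r : ℝ) : 1 + r ^ 2 ≤ weight η r := by
  unfold weight
  rw [sq_abs]
  exact Real.self_le_rpow_of_one_le (by nlinarith [sq_nonneg r]) (by linarith)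

/-- One square dominates the weights for all admissible `η`, so that the final constant does not
depend on `η`. -/
theorem weight_le {η : ℝ} (hη : η < 1 / 3) (r : ℝ) : weight η r ≤ (1 + r ^ 2) ^ 2 := by
  unfold weight
  rw [sq_abs, ← Real.rpow_two (1 + r ^ 2)]
  exact Real.rpow_le_rpow_of_exponent_le (by nlinarith [sq_nonneg r]) (by linarith)

theorem weight_half_le {η : ℝ} (hη : 0 < η) {r y : ℝ} (h : |r| ≤ |y| / 2) :
    weight η r ≤ weight η y := by
  unfold weight
  refine Real.rpow_le_rpow (by positivity) ?_ (by linarith)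
  have := abs_nonneg r
  have := abs_nonneg y
  exact add_le_add_right (pow_le_pow_left₀ (abs_nonneg r) (by linarith) 2) 1

/-- The sum of squares of the first derivatives of the data. -/
noncomputable def dataSq (z₀ w₀ s₀ m₀ : ℝ → ℝ) (y : ℝ) : ℝ :=
  w₀ y ^ 2 + deriv z₀ y ^ 2 + m₀ y ^ 2 + deriv s₀ y ^ 2

theorem dataSq_nonneg (z₀ w₀ s₀ m₀ : ℝ → ℝ) (y : ℝ) : 0 ≤ dataSq z₀ w₀ s₀ m₀ y := by
  unfold dataSq; positivity

theorem dataSize_sq_le (z₀ w₀ s₀ m₀ : ℝ → ℝ) (y : ℝ) :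
    dataSize z₀ w₀ s₀ m₀ y ^ 2 ≤ 4 * dataSq z₀ w₀ s₀ m₀ y := by
  unfold dataSize dataSq
  rw [← sq_abs (w₀ y), ← sq_abs (deriv z₀ y), ← sq_abs (m₀ y), ← sq_abs (deriv s₀ y)]
  generalize |w₀ y| = a
  generalize |deriv z₀ y| = b
  generalize |m₀ y| = c
  generalize |deriv s₀ y| = d
  nlinarith [sq_nonneg (a - b), sq_nonneg (a - c), sq_nonneg (a - d), sq_nonneg (b - c),
    sq_nonneg (b - d), sq_nonneg (c - d)]

section Profile

variable {z₀ w₀ s₀ m₀ : ℝ → ℝ}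

theorem integrable_mul_sq {f g : ℝ → ℝ} (hg : Continuous g) (hf : Continuous f)
    (hfc : HasCompactSupport f) : Integrable fun y => g y * f y ^ 2 := by
  refine (hg.mul (hf.pow 2)).integrable_of_hasCompactSupport (hfc.mono fun y hy => ?_)
  rw [Function.mem_support] at hy ⊢
  intro h0
  simp [h0] at hy

theorem IsProfile.integrable_mul_dataSq (h : IsProfile z₀ w₀ s₀ m₀) {g : ℝ → ℝ}
    (hg : Continuous g) : Integrable fun y => g y * dataSq z₀ w₀ s₀ m₀ y := by
  have := (((integrable_mul_sq hg h.smooth_w.continuous h.supp_w).add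
    (integrable_mul_sq hg h.deriv.smooth_z.continuous h.deriv.supp_z)).add
    (integrable_mul_sq hg h.smooth_m.continuous h.supp_m)).add
    (integrable_mul_sq hg h.deriv.smooth_s.continuous h.deriv.supp_s)
  refine this.congr (ae_of_all _ fun y => ?_)
  simp only [Pi.add_apply, dataSq]; ring

theorem IsProfile.integral_dataSize_le (h : IsProfile z₀ w₀ s₀ m₀) {q : ℝ} (hq : 0 < q)
    (hle : ∫ y, (1 + y ^ 2) * dataSq z₀ w₀ s₀ m₀ y ≤ q) :
    ∫ y, dataSize z₀ w₀ s₀ m₀ y ≤ √(Real.pi * (4 * q)) := by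
  have hc : Continuous fun y : ℝ => 1 + y ^ 2 := by fun_prop
  have hi := h.integrable_mul_dataSq hc
  have hle' : ∀ y, (1 + y ^ 2) * dataSize z₀ w₀ s₀ m₀ y ^ 2 ≤
      4 * ((1 + y ^ 2) * dataSq z₀ w₀ s₀ m₀ y) := fun y => by
    have := mul_le_mul_of_nonneg_left (dataSize_sq_le z₀ w₀ s₀ m₀ y)
      (by positivity : 0 ≤ 1 + y ^ 2)
    linarith
  have hi2 : Integrable fun y => (1 + y ^ 2) * dataSize z₀ w₀ s₀ m₀ y ^ 2 := by
    refine (hi.const_mul 4).mono' (hc.mul (h.continuous_dataSize.pow 2)).aestronglyMeasurable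
      (ae_of_all _ fun y => ?_)
    rw [Real.norm_of_nonneg (by positivity)]
    exact hle' y
  have := integral_abs_le_sqrt h.integrable_dataSize hi2 (q := 4 * q) (by positivity)
    ((integral_mono hi2 (hi.const_mul 4) hle').trans (by rw [integral_const_mul]; linarith))
  simpa only [abs_of_nonneg (dataSize_nonneg z₀ w₀ s₀ m₀ _)] using this

/-- Each of the four summands is compactly supported, hence bounded by the `L¹` norm of its
derivative. This supplies the pointwise smallness needed for the second derivatives. -/
theorem IsProfile.dataSize_le (h : IsProfile z₀ w₀ s₀ m₀) (y : ℝ) :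
    dataSize z₀ w₀ s₀ m₀ y ≤
      4 * ∫ x, dataSize (_root_.deriv z₀) (_root_.deriv w₀) (_root_.deriv s₀)
        (_root_.deriv m₀) x := by
  obtain ⟨h1, h2⟩ := h.deriv.abs_le_integral_dataSize y
  have hw : Integrable fun x => |_root_.deriv w₀ x| :=
    (h.deriv.smooth_w.continuous.integrable_of_hasCompactSupport h.deriv.supp_w).abs
  have hm : Integrable fun x => |_root_.deriv m₀ x| :=
    (h.deriv.smooth_m.continuous.integrable_of_hasCompactSupport h.deriv.supp_m).abs
  have h3 := (abs_le_integral_abs_deriv (h.smooth_w.of_le (by norm_cast)) h.supp_w y).trans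
    (integral_mono hw h.deriv.integrable_dataSize fun x => by
      simp only [dataSize]
      linarith [abs_nonneg (_root_.deriv (_root_.deriv z₀) x),
        abs_nonneg (_root_.deriv (_root_.deriv s₀) x), abs_nonneg (_root_.deriv m₀ x)])
  have h4 := (abs_le_integral_abs_deriv (h.smooth_m.of_le (by norm_cast)) h.supp_m y).trans
    (integral_mono hm h.deriv.integrable_dataSize fun x => by
      simp only [dataSize]
      linarith [abs_nonneg (_root_.deriv (_root_.deriv z₀) x),
        abs_nonneg (_root_.deriv (_root_.deriv s₀) x), abs_nonneg (_root_.deriv w₀ x)])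
  change _ + _ + _ + _ ≤ _
  linarith

end Profile

/-- Weighted square integrability of the seed size. -/
theorem integrable_weighted_seedSize_sq {θ σ : ℝ → ℝ} (hθ : ContDiff ℝ 2 θ)
    (hθc : HasCompactSupport θ) (hσ : ContDiff ℝ 2 σ) (hσc : HasCompactSupport σ) :
    Integrable fun y => (1 + y ^ 2) ^ 2 * seedSize θ σ y ^ 2 := by
  have hc : Continuous fun y : ℝ => (1 + y ^ 2) ^ 2 := by fun_prop
  have i1 := integrable_mul_sq hc (continuous_deriv_deriv hθ).1.continuous hθc.deriv
  have i2 := integrable_mul_sq hc (continuous_deriv_deriv hσ).1.continuous hσc.deriv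
  have i3 := integrable_mul_sq hc (continuous_deriv_deriv hθ).2 hθc.deriv.deriv
  have i4 := integrable_mul_sq hc (continuous_deriv_deriv hσ).2 hσc.deriv.deriv
  refine (((((i1.add i2).add i3).add i4).add integrable_decay).const_mul 5).mono'
    (hc.mul ((continuous_seedSize hθ hσ).pow 2)).aestronglyMeasurable (ae_of_all _ fun y => ?_)
  rw [Real.norm_of_nonneg (by positivity)]
  simp only [Pi.add_apply]
  have e : decay y = (1 + y ^ 2) ^ 2 * decay y ^ 2 := by
    unfold decay
    field_simp
  rw [e, ← sq_abs (deriv θ y), ← sq_abs (deriv σ y), ← sq_abs (deriv (deriv θ) y),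
    ← sq_abs (deriv (deriv σ) y)]
  have key : seedSize θ σ y ^ 2 ≤ 5 * (|deriv θ y| ^ 2 + |deriv σ y| ^ 2 +
      |deriv (deriv θ) y| ^ 2 + |deriv (deriv σ) y| ^ 2 + decay y ^ 2) := by
    unfold seedSize
    generalize |deriv θ y| = a
    generalize |deriv σ y| = b
    generalize |deriv (deriv θ) y| = c
    generalize |deriv (deriv σ) y| = d
    generalize decay y = f
    nlinarith [sq_nonneg (a - b), sq_nonneg (a - c), sq_nonneg (a - d), sq_nonneg (b - c),
      sq_nonneg (b - d), sq_nonneg (c - d), sq_nonneg (a - f), sq_nonneg (b - f),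
      sq_nonneg (c - f), sq_nonneg (d - f)]
  have := mul_le_mul_of_nonneg_left key (by positivity : 0 ≤ (1 + y ^ 2) ^ 2)
  linarith

/-! ### Energy densities and external energetic control. -/

theorem pdt_sq_add_pdx_sq (f : ℝ → ℝ → ℝ) (t x : ℝ) :
    pdt f t x ^ 2 + pdx f t x ^ 2 = 1 / 2 * (nullL f t x ^ 2 + nullLbar f t x ^ 2) := by
  unfold nullL nullLbar; ring

theorem sq_le_of_abs_le {a b : ℝ} (h : |a| ≤ b) : a ^ 2 ≤ b ^ 2 := by
  rw [← sq_abs]; exact pow_le_pow_left₀ (abs_nonneg a) h 2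

/-- The three energy densities are dominated by functions of the null coordinates. -/
theorem densities_le {B z s : ℝ → ℝ → ℝ} {P : ℝ → ℝ} {A t x : ℝ} (hA : 1 ≤ A)
    (hs : Real.sinh (B t x + z t x) ^ 2 ≤ A)
    (h1 : |nullL z t x| ≤ P (x + t)) (h2 : |nullL s t x| ≤ P (x + t))
    (h3 : |nullLbar z t x| ≤ P (x - t)) (h4 : |nullLbar s t x| ≤ P (x - t)) :
    crossedDensity B z s t x ≤ 3 * A * P (x + t) ^ 2 + 3 * A * P (x - t) ^ 2 ∧
    coneDensity B z s t x ≤ 3 * A * P (x + t) ^ 2 + 3 * A * P (x - t) ^ 2 ∧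
    energyDensity B z s t x ≤ 3 * A * P (x + t) ^ 2 + 3 * A * P (x - t) ^ 2 := by
  have k1 := sq_le_of_abs_le h1
  have k2 := sq_le_of_abs_le h2
  have k3 := sq_le_of_abs_le h3
  have k4 := sq_le_of_abs_le h4
  have hz := pdt_sq_add_pdx_sq z t x
  have hs' := pdt_sq_add_pdx_sq s t x
  have hS0 : 0 ≤ Real.sinh (B t x + z t x) ^ 2 := sq_nonneg _
  have e1 : pdx z t x - pdt z t x = -nullLbar z t x := by unfold nullLbar; ring
  have e2 : pdx s t x - pdt s t x = -nullLbar s t x := by unfold nullLbar; ring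
  unfold crossedDensity coneDensity energyDensity
  rw [e1, e2, add_comm (pdx s t x ^ 2), hs', hz, neg_sq, neg_sq]
  generalize Real.sinh (B t x + z t x) ^ 2 = S at *
  have p1 : 0 ≤ P (x + t) ^ 2 := sq_nonneg _
  have p2 : 0 ≤ P (x - t) ^ 2 := sq_nonneg _
  have q3 := sq_nonneg (nullLbar s t x)
  have q2 := sq_nonneg (nullL s t x)
  have m1 : S * nullLbar s t x ^ 2 ≤ A * P (x - t) ^ 2 := by gcongr
  have m2 : S * nullL s t x ^ 2 ≤ A * P (x + t) ^ 2 := by gcongr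
  have n1 : P (x + t) ^ 2 ≤ A * P (x + t) ^ 2 := le_mul_of_one_le_left p1 hA
  have n2 : P (x - t) ^ 2 ≤ A * P (x - t) ^ 2 := le_mul_of_one_le_left p2 hA
  refine ⟨by linarith, by linarith, by linarith⟩

/-- The factor `sinh²(B + z₀)` could degenerate, so the part of the energy in `z₀'`, which does not
carry it, is used first: by Cauchy-Schwarz on the support it gives `|z₀| ≤ ρ / 2`. Then `B + z₀ ≥ ρ
/ 2`, and the energy controls all squares. -/
theorem integral_dataSq_lt {B : ℝ → ℝ → ℝ} {z₀ w₀ s₀ m₀ : ℝ → ℝ}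
    (h : IsProfile z₀ w₀ s₀ m₀) {ρ M δ : ℝ} (hρ : 0 < ρ) (hδ : 0 < δ)
    (hB : ∀ x, ρ ≤ B 0 x) (hz : tsupport z₀ ⊆ Icc (-M) M)
    (hsmall : √(Real.pi * ((1 + M ^ 2) * (2 * δ))) ≤ ρ / 2)
    (hen : ∫⁻ x, ENNReal.ofReal (profileDensity B z₀ w₀ s₀ m₀ x) < ENNReal.ofReal δ) :
    ∫ y, dataSq z₀ w₀ s₀ m₀ y < δ / min (1 / 2) (2 * Real.sinh (ρ / 2) ^ 2) := by
  have hdz : Continuous (deriv z₀) := h.deriv.smooth_z.continuous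
  have hc : Continuous fun y : ℝ => 1 + y ^ 2 := by fun_prop
  have i1 : Integrable fun y => deriv z₀ y ^ 2 := by
    simpa using integrable_mul_sq (g := fun _ => 1) continuous_const hdz h.deriv.supp_z
  have i2 := integrable_mul_sq hc hdz h.deriv.supp_z
  have hz1 : ∫ y, 1 / 2 * deriv z₀ y ^ 2 < δ := by
    refine integral_lt_of_lintegral_lt (i1.const_mul _) (fun y => by positivity)
      (lt_of_le_of_lt (lintegral_mono fun x => ENNReal.ofReal_le_ofReal ?_) hen)
    have : 0 ≤ 2 * Real.sinh (B 0 x + z₀ x) ^ 2 * ((deriv s₀ x) ^ 2 + (m₀ x) ^ 2) := by positivity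
    have := sq_nonneg (w₀ x)
    unfold profileDensity; linarith
  rw [integral_const_mul] at hz1
  have hz2 : ∫ y, (1 + y ^ 2) * deriv z₀ y ^ 2 ≤ (1 + M ^ 2) * (2 * δ) := by
    calc ∫ y, (1 + y ^ 2) * deriv z₀ y ^ 2 ≤ ∫ y, (1 + M ^ 2) * deriv z₀ y ^ 2 := by
          refine integral_mono i2 (i1.const_mul _) fun y => ?_
          by_cases hy : y ∈ tsupport z₀
          · have : y ^ 2 ≤ M ^ 2 := sq_le_of_abs_le (abs_le.2 (hz hy))
            simp only
            gcongr
          · have : deriv z₀ y = 0 := by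
              by_contra hne
              exact hy (support_deriv_subset hne)
            simp [this]
      _ ≤ _ := by
          rw [integral_const_mul]
          gcongr
          linarith
  have hz3 : ∀ y, |z₀ y| ≤ ρ / 2 := fun y =>
    ((abs_le_integral_abs_deriv (h.smooth_z.of_le (by norm_cast)) h.supp_z y).trans
      (integral_abs_le_sqrt (hdz.integrable_of_hasCompactSupport h.deriv.supp_z) i2
        (by positivity) hz2)).trans hsmall
  obtain ⟨c, hcdef⟩ : ∃ c, c = min (1 / 2) (2 * Real.sinh (ρ / 2) ^ 2) := ⟨_, rfl⟩
  have hsinh : 0 < Real.sinh (ρ / 2) := Real.sinh_pos_iff.2 (by linarith)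
  have hc0 : 0 < c := by rw [hcdef]; exact lt_min (by norm_num) (by positivity)
  have i3 : Integrable fun y => c * dataSq z₀ w₀ s₀ m₀ y :=
    h.integrable_mul_dataSq (g := fun _ => c) continuous_const
  rw [← hcdef, lt_div_iff₀ hc0, mul_comm, ← integral_const_mul]
  refine integral_lt_of_lintegral_lt i3 (fun y => mul_nonneg hc0.le (dataSq_nonneg _ _ _ _ y))
    (lt_of_le_of_lt (lintegral_mono fun x => ENNReal.ofReal_le_ofReal ?_) hen)
  have hsh : Real.sinh (ρ / 2) ^ 2 ≤ Real.sinh (B 0 x + z₀ x) ^ 2 := by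
    refine pow_le_pow_left₀ hsinh.le (Real.sinh_le_sinh.2 ?_) 2
    have := (abs_le.1 (hz3 x)).1
    linarith [hB x]
  have c1 : c ≤ 1 / 2 := hcdef ▸ min_le_left _ _
  have c2 : c ≤ 2 * Real.sinh (B 0 x + z₀ x) ^ 2 :=
    (hcdef ▸ min_le_right _ _ : c ≤ 2 * Real.sinh (ρ / 2) ^ 2).trans (by linarith)
  have d1 := mul_le_mul_of_nonneg_right c1 (by positivity : 0 ≤ w₀ x ^ 2 + deriv z₀ x ^ 2)
  have d2 := mul_le_mul_of_nonneg_right c2 (by positivity : 0 ≤ deriv s₀ x ^ 2 + m₀ x ^ 2)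
  unfold profileDensity dataSq
  linarith

theorem IsProfile.integral_weighted_dataSq_le {z₀ w₀ s₀ m₀ : ℝ → ℝ}
    (h : IsProfile z₀ w₀ s₀ m₀) {M : ℝ} (hz : tsupport z₀ ⊆ Icc (-M) M)
    (hw : tsupport w₀ ⊆ Icc (-M) M) (hs : tsupport s₀ ⊆ Icc (-M) M)
    (hm : tsupport m₀ ⊆ Icc (-M) M) :
    ∫ y, (1 + y ^ 2) * dataSq z₀ w₀ s₀ m₀ y ≤ (1 + M ^ 2) * ∫ y, dataSq z₀ w₀ s₀ m₀ y := by
  rw [← integral_const_mul]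
  refine integral_mono (h.integrable_mul_dataSq (by fun_prop))
    (h.integrable_mul_dataSq continuous_const) fun y => ?_
  by_cases hy : y ∈ Icc (-M) M
  · have : y ^ 2 ≤ M ^ 2 := sq_le_of_abs_le (abs_le.2 hy)
    have := dataSq_nonneg z₀ w₀ s₀ m₀ y
    simp only
    gcongr
  · have h0 : dataSq z₀ w₀ s₀ m₀ y = 0 := by
      have e1 : _root_.deriv z₀ y = 0 := by
        by_contra hne; exact hy (hz (support_deriv_subset hne))
      have e2 : _root_.deriv s₀ y = 0 := by
        by_contra hne; exact hy (hs (support_deriv_subset hne))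
      have e3 : w₀ y = 0 := image_eq_zero_of_notMem_tsupport fun hne => hy (hw hne)
      have e4 : m₀ y = 0 := image_eq_zero_of_notMem_tsupport fun hne => hy (hm hne)
      simp [dataSq, e1, e2, e3, e4]
    simp [h0]

/-- The three conclusions of the first part come from one dominating function `g` whose integral is
`O(ε² δ)`: both the data and the constant `D` are proportional to `ε`. -/
theorem external_energetic_control (θ σ : ℝ → ℝ) (μ lam : ℝ)
    (hθ : ContDiff ℝ 2 θ) (hθc : HasCompactSupport θ)
    (hσ : ContDiff ℝ 2 σ) (hσc : HasCompactSupport σ)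
    (hμ : 0 < μ) (hμ1 : μ ≠ 1) (M : ℝ) :
    ∃ ε₀ : ℝ, 0 < ε₀ ∧ ∀ ε : ℝ, 0 < ε → ε < ε₀ →
      ∃ δ₀ : ℝ, 0 < δ₀ ∧ ∀ δ : ℝ, 0 < δ → δ < δ₀ →
      ∀ z₀ w₀ s₀ m₀ : ℝ → ℝ, IsProfile z₀ w₀ s₀ m₀ →
      tsupport z₀ ⊆ Set.Icc (-M) M → tsupport w₀ ⊆ Set.Icc (-M) M →
      tsupport s₀ ⊆ Set.Icc (-M) M → tsupport m₀ ⊆ Set.Icc (-M) M →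
      ∫⁻ x, ENNReal.ofReal (profileDensity (solitonB θ σ μ lam ε) z₀ w₀ s₀ m₀ x)
        < ENNReal.ofReal δ →
      ∃ Λ φ : ℝ → ℝ → ℝ,
        IsTheSolution (solitonB θ σ μ lam ε) (solitonD θ σ μ lam ε) ε z₀ w₀ s₀ m₀ Λ φ ∧
        ∀ z s : ℝ → ℝ → ℝ, (∀ t x, z t x = Λ t x - solitonB θ σ μ lam ε t x) →
          (∀ t x, s t x = φ t x - solitonD θ σ μ lam ε t x) →
          ∃ g : ℝ → ℝ, Continuous g ∧ (∀ y, 0 ≤ g y) ∧ Integrable g ∧ 2 * (∫ y, g y) < δ ∧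
            ∀ t x, crossedDensity (solitonB θ σ μ lam ε) z s t x ≤ g (x + t) + g (x - t) ∧
              coneDensity (solitonB θ σ μ lam ε) z s t x ≤ g (x + t) + g (x - t) ∧
              energyDensity (solitonB θ σ μ lam ε) z s t x ≤ g (x + t) + g (x - t) := by
  obtain ⟨ε₁, hε₁, hε₁1, D₁, hD₁, ρ, hρ, A, hA, H⟩ :=
    exists_perturbed_solution (lam := lam) hθ hθc hσ hσc hμ hμ1
  have cκ := continuous_seedSize hθ hσ
  have iκ : Integrable fun y => seedSize θ σ y ^ 2 := by
    refine (integrable_weighted_seedSize_sq hθ hθc hσ hσc).mono' (cκ.pow 2).aestronglyMeasurable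
      (ae_of_all _ fun y => ?_)
    rw [Real.norm_of_nonneg (by positivity)]
    exact le_mul_of_one_le_left (by positivity) (by nlinarith [sq_nonneg y, sq_nonneg (y ^ 2)])
  obtain ⟨I, hI⟩ : ∃ I, I = ∫ y, seedSize θ σ y ^ 2 := ⟨_, rfl⟩
  have hI0 : 0 ≤ I := hI ▸ integral_nonneg fun y => sq_nonneg _
  have hsinh : 0 < Real.sinh (ρ / 2) := Real.sinh_pos_iff.2 (by linarith)
  obtain ⟨c, hc⟩ : ∃ c, c = min (1 / 2) (2 * Real.sinh (ρ / 2) ^ 2) := ⟨_, rfl⟩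
  have hc0 : 0 < c := by rw [hc]; exact lt_min (by norm_num) (by positivity)
  have hπ := Real.pi_pos
  -- The constant for which energy below `δ` and support in `[-M, M]` give `∫ dataSize ≤ √(Q δ)`.
  obtain ⟨Q, hQ⟩ : ∃ Q, Q = Real.pi * (4 * ((1 + M ^ 2) * (1 / c))) := ⟨_, rfl⟩
  have hQ0 : 0 < Q := by rw [hQ]; positivity
  -- The integral of `g` will be at most `Z ε² δ`; as `Z` does not involve `ε`, a small `ε` makes `2
  -- Z ε² < 1`.
  obtain ⟨Z, hZ⟩ : ∃ Z, Z = 6 * A ^ 3 * (4 / c + Q * I) := ⟨_, rfl⟩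
  have hZ0 : 0 ≤ Z := by rw [hZ]; positivity
  refine ⟨min ε₁ (1 / (2 * Z + 1)), by positivity, fun ε hε hεlt => ?_⟩
  have hε1 : ε < ε₁ := hεlt.trans_le (min_le_left _ _)
  have hε1' : ε ≤ 1 := hε1.le.trans hε₁1
  have hεZ : 2 * (Z * ε ^ 2) < 1 := by
    have h1 : ε * (2 * Z + 1) < 1 := by
      rw [← lt_div_iff₀ (by positivity)]; exact hεlt.trans_le (min_le_right _ _)
    have h2 : Z * ε ^ 2 ≤ Z * ε := by
      gcongr; nlinarith
    linarith
  obtain ⟨hB, H⟩ := H ε hε hε1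
  -- The first bound on `δ` gives `√(Q δ) ≤ D₁`, the second `|z₀| ≤ ρ / 2`.
  refine ⟨min (D₁ ^ 2 / Q) ((ρ / 2) ^ 2 / (Real.pi * ((1 + M ^ 2) * 2))), by positivity,
    fun δ hδ hδlt z₀ w₀ s₀ m₀ hp hz hw hs hm hen => ?_⟩
  have hδ1 : √(Q * δ) ≤ D₁ := by
    rw [Real.sqrt_le_left hD₁.le, mul_comm, ← le_div_iff₀ hQ0]
    exact hδlt.le.trans (min_le_left _ _)
  have hδ2 : √(Real.pi * ((1 + M ^ 2) * (2 * δ))) ≤ ρ / 2 := by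
    rw [Real.sqrt_le_left (by linarith)]
    have : δ * (Real.pi * ((1 + M ^ 2) * 2)) ≤ (ρ / 2) ^ 2 := by
      rw [← le_div_iff₀ (by positivity)]; exact hδlt.le.trans (min_le_right _ _)
    linarith
  have hsq := integral_dataSq_lt hp hρ hδ (fun x => hB 0 x) hz hδ2 hen
  rw [← hc] at hsq
  have hI1 : ∫ y, dataSize z₀ w₀ s₀ m₀ y ≤ √(Q * δ) := by
    have h1 : ∫ y, (1 + y ^ 2) * dataSq z₀ w₀ s₀ m₀ y ≤ (1 + M ^ 2) * (δ / c) :=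
      (hp.integral_weighted_dataSq_le hz hw hs hm).trans (by gcongr)
    have h2 := hp.integral_dataSize_le (q := (1 + M ^ 2) * (δ / c)) (by positivity) h1
    have e : Real.pi * (4 * ((1 + M ^ 2) * (δ / c))) = Q * δ := by rw [hQ]; ring
    rwa [e] at h2
  have hs0 : 0 < √(Q * δ) := Real.sqrt_pos.2 (by positivity)
  obtain ⟨Λ, φ, hsol, hest⟩ := H z₀ w₀ s₀ m₀ hp (ε * √(Q * δ)) (by positivity)
    ((mul_le_of_le_one_left hs0.le hε1').trans hδ1) (by gcongr)
  refine ⟨Λ, φ, hsol, fun z s hz' hs' => ?_⟩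
  obtain ⟨e1, e2, -⟩ := hest z s hz' hs'
  set P : ℝ → ℝ := fun y =>
    A * (ε * dataSize z₀ w₀ s₀ m₀ y + ε * √(Q * δ) * seedSize θ σ y) with hP
  have cP : Continuous P := continuous_const.mul
    ((continuous_const.mul hp.continuous_dataSize).add (continuous_const.mul cκ))
  have hPle : ∀ y, 3 * A * P y ^ 2 ≤ 6 * A ^ 3 * ε ^ 2 *
      (4 * dataSq z₀ w₀ s₀ m₀ y + Q * δ * seedSize θ σ y ^ 2) := fun y => by
    have h1 := dataSize_sq_le z₀ w₀ s₀ m₀ y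
    have h2 : √(Q * δ) ^ 2 = Q * δ := Real.sq_sqrt (by positivity)
    have h3 : (dataSize z₀ w₀ s₀ m₀ y + √(Q * δ) * seedSize θ σ y) ^ 2 ≤
        2 * (4 * dataSq z₀ w₀ s₀ m₀ y + Q * δ * seedSize θ σ y ^ 2) := by
      have h5 : (√(Q * δ) * seedSize θ σ y) ^ 2 = Q * δ * seedSize θ σ y ^ 2 := by
        rw [mul_pow, h2]
      nlinarith [sq_nonneg (dataSize z₀ w₀ s₀ m₀ y - √(Q * δ) * seedSize θ σ y)]
    have h4 := mul_le_mul_of_nonneg_left h3 (by positivity : 0 ≤ 3 * A ^ 3 * ε ^ 2)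
    calc 3 * A * P y ^ 2 = 3 * A ^ 3 * ε ^ 2 *
          (dataSize z₀ w₀ s₀ m₀ y + √(Q * δ) * seedSize θ σ y) ^ 2 := by simp only [hP]; ring
      _ ≤ _ := h4
      _ = _ := by ring
  have i1 : Integrable (dataSq z₀ w₀ s₀ m₀) := by
    simpa using hp.integrable_mul_dataSq (g := fun _ => 1) continuous_const
  have i2 : Integrable fun y => 6 * A ^ 3 * ε ^ 2 *
      (4 * dataSq z₀ w₀ s₀ m₀ y + Q * δ * seedSize θ σ y ^ 2) :=
    ((i1.const_mul 4).add (iκ.const_mul _)).const_mul _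
  have hg0 : ∀ y, 0 ≤ 3 * A * P y ^ 2 := fun y => by positivity
  have cg : Continuous fun y => 3 * A * P y ^ 2 := continuous_const.mul (cP.pow 2)
  have i3 : Integrable fun y => 3 * A * P y ^ 2 :=
    i2.mono' cg.aestronglyMeasurable (ae_of_all _ fun y => by
      rw [Real.norm_of_nonneg (hg0 y)]; exact hPle y)
  refine ⟨fun y => 3 * A * P y ^ 2, cg, hg0, i3, ?_, fun t x => ?_⟩
  · have h1 : ∫ y, 3 * A * P y ^ 2 ≤
        6 * A ^ 3 * ε ^ 2 * (4 * (∫ y, dataSq z₀ w₀ s₀ m₀ y) + Q * δ * I) :=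
      (integral_mono i3 i2 hPle).trans_eq (by
        rw [integral_const_mul, integral_add (i1.const_mul 4) (iκ.const_mul _),
          integral_const_mul, integral_const_mul, ← hI])
    have h2 : 6 * A ^ 3 * ε ^ 2 * (4 * (∫ y, dataSq z₀ w₀ s₀ m₀ y) + Q * δ * I) ≤
        6 * A ^ 3 * ε ^ 2 * (4 * (δ / c) + Q * δ * I) := by gcongr
    have h3 : 6 * A ^ 3 * ε ^ 2 * (4 * (δ / c) + Q * δ * I) = Z * ε ^ 2 * δ := by rw [hZ]; ring
    have h4 := mul_lt_mul_of_pos_right hεZ hδ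
    simp only
    linarith
  · obtain ⟨a1, a2, a3, a4⟩ := e2 t x
    exact densities_le (P := P) hA (e1 t x) a1 a2 a3 a4

/-! ### Weighted energies and full orbital stability. -/

theorem nullEnergyOrder_le {η t : ℝ} (hη : 0 < η) {k : ℕ} {ψ : ℝ → ℝ → ℝ} {R : ℝ → ℝ}
    (hR : Continuous R) (hi : Integrable fun y => weight η y * R y ^ 2)
    (h1 : ∀ x, |nullL (pdx^[k] ψ) t x| ≤ R (x + t))
    (h2 : ∀ x, |nullLbar (pdx^[k] ψ) t x| ≤ R (x - t)) :
    nullEnergyOrder η k ψ t ≤ ENNReal.ofReal (2 * ∫ y, weight η y * R y ^ 2) := by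
  refine lintegral_ofReal_le_of_null (t := t) ((continuous_weight η).mul (hR.pow 2))
    (fun y => mul_nonneg (weight_nonneg η y) (sq_nonneg _)) hi fun x => ?_
  have w1 : weight η ((t - x) / 2) ≤ weight η (x - t) :=
    weight_half_le hη (by rw [abs_div, abs_two, abs_sub_comm])
  have w2 : weight η ((t + x) / 2) ≤ weight η (x + t) :=
    weight_half_le hη (by rw [abs_div, abs_two, add_comm])
  have n1 := weight_nonneg η (x - t)
  have n2 := weight_nonneg η (x + t)
  rw [add_comm]
  gcongr
  · exact h1 x
  · exact h2 x

theorem profileSize_lt {z₀ w₀ s₀ m₀ : ℝ → ℝ} (h : IsProfile z₀ w₀ s₀ m₀) {η b : ℝ}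
    (hlt : profileSize η z₀ w₀ s₀ m₀ < ENNReal.ofReal b) :
    (∫ y, weight η y * dataSq z₀ w₀ s₀ m₀ y) +
      ∫ y, weight η y * dataSq (deriv z₀) (deriv w₀) (deriv s₀) (deriv m₀) y < b := by
  have i0 := h.integrable_mul_dataSq (continuous_weight η)
  have i1 := h.deriv.integrable_mul_dataSq (continuous_weight η)
  have n0 : ∀ y, 0 ≤ weight η y * dataSq z₀ w₀ s₀ m₀ y := fun y =>
    mul_nonneg (weight_nonneg η y) (dataSq_nonneg _ _ _ _ y)
  have n1 : ∀ y, 0 ≤ weight η y * dataSq (deriv z₀) (deriv w₀) (deriv s₀) (deriv m₀) y := fun y =>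
    mul_nonneg (weight_nonneg η y) (dataSq_nonneg _ _ _ _ y)
  have e : profileSize η z₀ w₀ s₀ m₀ =
      (∫⁻ y, ENNReal.ofReal (weight η y * dataSq z₀ w₀ s₀ m₀ y)) + ∫⁻ y, ENNReal.ofReal
        (weight η y * dataSq (deriv z₀) (deriv w₀) (deriv s₀) (deriv m₀) y) := by
    simp only [profileSize, Finset.sum_range_succ, Finset.sum_range_zero, zero_add,
      iteratedDeriv_zero, dataSq, iteratedDeriv_succ]
  rw [e, ← ofReal_integral_eq_lintegral_ofReal i0 (ae_of_all _ n0),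
    ← ofReal_integral_eq_lintegral_ofReal i1 (ae_of_all _ n1),
    ← ENNReal.ofReal_add (integral_nonneg n0) (integral_nonneg n1)] at hlt
  exact (ENNReal.ofReal_lt_ofReal_iff_of_nonneg
    (add_nonneg (integral_nonneg n0) (integral_nonneg n1))).1 hlt

theorem IsProfile.integral_dataSize_le_of_weight {z₀ w₀ s₀ m₀ : ℝ → ℝ}
    (h : IsProfile z₀ w₀ s₀ m₀) {η δ : ℝ} (hη : 0 < η) (hδ : 0 < δ)
    (hle : ∫ y, weight η y * dataSq z₀ w₀ s₀ m₀ y ≤ δ ^ 2) :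
    ∫ y, dataSize z₀ w₀ s₀ m₀ y ≤ 4 * δ := by
  have h1 : ∫ y, (1 + y ^ 2) * dataSq z₀ w₀ s₀ m₀ y ≤ δ ^ 2 :=
    (integral_mono (h.integrable_mul_dataSq (by fun_prop))
      (h.integrable_mul_dataSq (continuous_weight η)) fun y =>
      mul_le_mul_of_nonneg_right (le_weight hη y) (dataSq_nonneg _ _ _ _ y)).trans hle
  refine (h.integral_dataSize_le (by positivity) h1).trans ?_
  rw [Real.sqrt_le_left (by positivity)]
  nlinarith [Real.pi_lt_four, sq_nonneg δ]

/-- The weight is at least `1 + y²`, so the hypothesis bounds the `L¹` norms of the first and second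
derivatives by `4 δ`, and the first derivatives pointwise by `16 δ`. The comparison then applies
with `D = 16 δ`, and the weights are integrated along characteristics. -/
theorem full_orbital_stability (θ σ : ℝ → ℝ) (μ lam : ℝ)
    (hθ : ContDiff ℝ 2 θ) (hθc : HasCompactSupport θ)
    (hσ : ContDiff ℝ 2 σ) (hσc : HasCompactSupport σ)
    (hμ : 0 < μ) (hμ1 : μ ≠ 1) :
    ∃ ε₀ : ℝ, 0 < ε₀ ∧ ∀ ε : ℝ, 0 < ε → ε < ε₀ →
      ∃ C δ₀ : ℝ, 0 < C ∧ 0 < δ₀ ∧ ∀ δ : ℝ, 0 < δ → δ < δ₀ →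
      ∀ η : ℝ, 0 < η → η < 1 / 3 →
      ∀ z₀ w₀ s₀ m₀ : ℝ → ℝ, IsProfile z₀ w₀ s₀ m₀ →
      profileSize η z₀ w₀ s₀ m₀ < ENNReal.ofReal (δ ^ 2) →
      ∃ Λ φ : ℝ → ℝ → ℝ,
        IsTheSolution (solitonB θ σ μ lam ε) (solitonD θ σ μ lam ε) ε z₀ w₀ s₀ m₀ Λ φ ∧
        ∀ z s : ℝ → ℝ → ℝ, (∀ t x, z t x = Λ t x - solitonB θ σ μ lam ε t x) →
          (∀ t x, s t x = φ t x - solitonD θ σ μ lam ε t x) →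
          ∀ t : ℝ, nullEnergy η z t + nullEnergy η s t ≤ ENNReal.ofReal (C * δ ^ 2) := by
  obtain ⟨ε₁, hε₁, hε₁1, D₁, hD₁, ρ, hρ, A, hA, H⟩ :=
    exists_perturbed_solution (lam := lam) hθ hθc hσ hσc hμ hμ1
  have cκ := continuous_seedSize hθ hσ
  have iκ := integrable_weighted_seedSize_sq hθ hθc hσ hσc
  obtain ⟨V, hV⟩ : ∃ V, V = ∫ y, (1 + y ^ 2) ^ 2 * seedSize θ σ y ^ 2 := ⟨_, rfl⟩
  have hV0 : 0 ≤ V := hV ▸ integral_nonneg fun y => by positivity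
  -- `256 = 16²` comes from `D = 16 δ`. Each of the four energies, orders `0` and `1` of `z` and
  -- `s`, is at most `2 · 3 A² (4 + 256 V) δ²`.
  refine ⟨ε₁, hε₁, fun ε hε hεlt => ⟨24 * A ^ 2 * (4 + 256 * V), D₁ / 16, by positivity,
    by positivity, fun δ hδ hδlt η hη hη3 z₀ w₀ s₀ m₀ hp hsize => ?_⟩⟩
  have hε1 : ε ≤ 1 := hεlt.le.trans hε₁1
  have hq := profileSize_lt hp hsize
  have n0 : 0 ≤ ∫ y, weight η y * dataSq z₀ w₀ s₀ m₀ y := integral_nonneg fun y =>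
    mul_nonneg (weight_nonneg η y) (dataSq_nonneg _ _ _ _ y)
  have n1 : 0 ≤ ∫ y, weight η y * dataSq (deriv z₀) (deriv w₀) (deriv s₀) (deriv m₀) y :=
    integral_nonneg fun y => mul_nonneg (weight_nonneg η y) (dataSq_nonneg _ _ _ _ y)
  have hI0 := hp.integral_dataSize_le_of_weight hη hδ (by linarith)
  have hI1 := hp.deriv.integral_dataSize_le_of_weight hη hδ (by linarith)
  have hsup : ∀ y, dataSize z₀ w₀ s₀ m₀ y ≤ 16 * δ := fun y =>
    (hp.dataSize_le y).trans (by linarith)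
  obtain ⟨Λ, φ, hsol, hest⟩ := (H ε hε hεlt).2 z₀ w₀ s₀ m₀ hp (16 * δ) (by positivity)
    (by linarith) (by
      have := mul_le_mul_of_nonneg_left hI0 hε.le
      nlinarith)
  refine ⟨Λ, φ, hsol, fun z s hz' hs' t => ?_⟩
  obtain ⟨-, e2, e3⟩ := hest z s hz' hs'
  have e4 := e3 fun y =>
    (mul_le_of_le_one_left (dataSize_nonneg _ _ _ _ y) hε1).trans (hsup y)
  have hd0 : ∀ y, 0 ≤ ε * dataSize z₀ w₀ s₀ m₀ y := fun y =>
    mul_nonneg hε.le (dataSize_nonneg _ _ _ _ y)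
  have hd1 : ∀ y, 0 ≤ ε * dataSize (deriv z₀) (deriv w₀) (deriv s₀) (deriv m₀) y := fun y =>
    mul_nonneg hε.le (dataSize_nonneg _ _ _ _ y)
  set R : ℝ → ℝ := fun y => A * (ε * dataSize (deriv z₀) (deriv w₀) (deriv s₀) (deriv m₀) y +
    ε * dataSize z₀ w₀ s₀ m₀ y + 16 * δ * seedSize θ σ y) with hR
  have hPR : ∀ y, A * (ε * dataSize z₀ w₀ s₀ m₀ y + 16 * δ * seedSize θ σ y) ≤ R y := fun y => by
    have := hd1 y
    simp only [hR]; gcongr; linarith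
  have cR : Continuous R := continuous_const.mul
    (((continuous_const.mul hp.deriv.continuous_dataSize).add
      (continuous_const.mul hp.continuous_dataSize)).add (continuous_const.mul cκ))
  have hRle : ∀ y, weight η y * R y ^ 2 ≤ 3 * A ^ 2 *
      (4 * (weight η y * dataSq (deriv z₀) (deriv w₀) (deriv s₀) (deriv m₀) y) +
        4 * (weight η y * dataSq z₀ w₀ s₀ m₀ y) +
        256 * δ ^ 2 * ((1 + y ^ 2) ^ 2 * seedSize θ σ y ^ 2)) := fun y => by
    have hw := weight_nonneg η y
    have a1 := dataSize_sq_le z₀ w₀ s₀ m₀ y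
    have a2 := dataSize_sq_le (deriv z₀) (deriv w₀) (deriv s₀) (deriv m₀) y
    have b1 : (ε * dataSize z₀ w₀ s₀ m₀ y) ^ 2 ≤ dataSize z₀ w₀ s₀ m₀ y ^ 2 :=
      pow_le_pow_left₀ (hd0 y) (mul_le_of_le_one_left (dataSize_nonneg _ _ _ _ y) hε1) 2
    have b2 : (ε * dataSize (deriv z₀) (deriv w₀) (deriv s₀) (deriv m₀) y) ^ 2 ≤
        dataSize (deriv z₀) (deriv w₀) (deriv s₀) (deriv m₀) y ^ 2 :=
      pow_le_pow_left₀ (hd1 y) (mul_le_of_le_one_left (dataSize_nonneg _ _ _ _ y) hε1) 2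
    have key : ∀ a b c : ℝ, (a + b + c) ^ 2 ≤ 3 * (a ^ 2 + b ^ 2 + c ^ 2) := fun a b c => by
      nlinarith [sq_nonneg (a - b), sq_nonneg (a - c), sq_nonneg (b - c)]
    have c1 : R y ^ 2 ≤ 3 * A ^ 2 *
        (4 * dataSq (deriv z₀) (deriv w₀) (deriv s₀) (deriv m₀) y + 4 * dataSq z₀ w₀ s₀ m₀ y +
          256 * δ ^ 2 * seedSize θ σ y ^ 2) := by
      have k1 := key (ε * dataSize (deriv z₀) (deriv w₀) (deriv s₀) (deriv m₀) y)
        (ε * dataSize z₀ w₀ s₀ m₀ y) (16 * δ * seedSize θ σ y)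
      rw [mul_pow (16 * δ), mul_pow 16 δ] at k1
      simp only [hR]
      rw [mul_pow]
      have := mul_le_mul_of_nonneg_left (k1.trans (mul_le_mul_of_nonneg_left (add_le_add_left
        (add_le_add (b2.trans a2) (b1.trans a1)) _) zero_le_three)) (sq_nonneg A)
      linarith
    have c2 := mul_le_mul_of_nonneg_left c1 hw
    have c3 := mul_le_mul_of_nonneg_right (weight_le hη3 y)
      (by positivity : 0 ≤ 3 * A ^ 2 * (256 * δ ^ 2 * seedSize θ σ y ^ 2))
    linarith
  have j0 := hp.integrable_mul_dataSq (continuous_weight η)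
  have j1 := hp.deriv.integrable_mul_dataSq (continuous_weight η)
  have j2 : Integrable fun y =>
      4 * (weight η y * dataSq (deriv z₀) (deriv w₀) (deriv s₀) (deriv m₀) y) +
        4 * (weight η y * dataSq z₀ w₀ s₀ m₀ y) := (j1.const_mul 4).add (j0.const_mul 4)
  have j3 := (j2.add (iκ.const_mul (256 * δ ^ 2))).const_mul (3 * A ^ 2)
  have jR : Integrable fun y => weight η y * R y ^ 2 :=
    j3.mono' ((continuous_weight η).mul (cR.pow 2)).aestronglyMeasurable (ae_of_all _ fun y => by
      rw [Real.norm_of_nonneg (mul_nonneg (weight_nonneg η y) (sq_nonneg _))]; exact hRle y)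
  have hRI : ∫ y, weight η y * R y ^ 2 ≤ 3 * A ^ 2 * ((4 + 256 * V) * δ ^ 2) := by
    refine (integral_mono jR j3 hRle).trans ?_
    rw [integral_const_mul]
    refine mul_le_mul_of_nonneg_left ?_ (by positivity)
    simp only [Pi.add_apply]
    rw [integral_add j2 (iκ.const_mul (256 * δ ^ 2)),
      integral_add (j1.const_mul 4) (j0.const_mul 4), integral_const_mul, integral_const_mul,
      integral_const_mul, ← hV]
    linarith
  have hRI0 : 0 ≤ ∫ y, weight η y * R y ^ 2 :=
    integral_nonneg fun y => mul_nonneg (weight_nonneg η y) (sq_nonneg _)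
  have z0 := nullEnergyOrder_le (k := 0) (ψ := z) (t := t) hη cR jR
    (fun x => (e2 t x).1.trans (hPR _)) (fun x => (e2 t x).2.2.1.trans (hPR _))
  have z1 := nullEnergyOrder_le (k := 1) (ψ := z) (t := t) hη cR jR
    (fun x => (e4 t x).1) (fun x => (e4 t x).2.2.1)
  have s0 := nullEnergyOrder_le (k := 0) (ψ := s) (t := t) hη cR jR
    (fun x => (e2 t x).2.1.trans (hPR _)) (fun x => (e2 t x).2.2.2.trans (hPR _))
  have s1 := nullEnergyOrder_le (k := 1) (ψ := s) (t := t) hη cR jR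
    (fun x => (e4 t x).2.1) (fun x => (e4 t x).2.2.2)
  unfold nullEnergy
  refine (add_le_add (add_le_add z0 z1) (add_le_add s0 s1)).trans ?_
  rw [← ENNReal.ofReal_add (by positivity) (by positivity),
    ← ENNReal.ofReal_add (by positivity) (by positivity)]
  exact ENNReal.ofReal_le_ofReal (by linarith)

end PCF

/-! ### Conclusion. -/

open PCF in
theorem theorem1p2 (θ σ : ℝ → ℝ) (μ lam : ℝ)
    (hθ : ContDiff ℝ 2 θ) (hθc : HasCompactSupport θ)
    (hσ : ContDiff ℝ 2 σ) (hσc : HasCompactSupport σ)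
    (hμ : 0 < μ) (hμ1 : μ ≠ 1) (hlam : 0 < lam) :
    -- (1) External energetic control, for profiles supported in `[-M, M]`
    (∀ M : ℝ, 0 < M → ∃ ε₀ : ℝ, 0 < ε₀ ∧ ∀ ε : ℝ, 0 < ε → ε < ε₀ →
      ∃ δ₀ : ℝ, 0 < δ₀ ∧ ∀ δ : ℝ, 0 < δ → δ < δ₀ →
      ∀ z₀ w₀ s₀ m₀ : ℝ → ℝ, IsProfile z₀ w₀ s₀ m₀ →
      tsupport z₀ ⊆ Set.Icc (-M) M → tsupport w₀ ⊆ Set.Icc (-M) M →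
      tsupport s₀ ⊆ Set.Icc (-M) M → tsupport m₀ ⊆ Set.Icc (-M) M →
      ∫⁻ x, ENNReal.ofReal (profileDensity (solitonB θ σ μ lam ε) z₀ w₀ s₀ m₀ x)
        < ENNReal.ofReal δ →
      ∃ Λ φ : ℝ → ℝ → ℝ,
        IsTheSolution (solitonB θ σ μ lam ε) (solitonD θ σ μ lam ε) ε z₀ w₀ s₀ m₀ Λ φ ∧
        ∀ z s : ℝ → ℝ → ℝ, (∀ t x, z t x = Λ t x - solitonB θ σ μ lam ε t x) →
          (∀ t x, s t x = φ t x - solitonD θ σ μ lam ε t x) →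
          -- crossed global control
          (∀ t : ℝ, ∫⁻ x, ENNReal.ofReal (crossedDensity (solitonB θ σ μ lam ε) z s t x)
            < ENNReal.ofReal (3 * δ)) ∧
          -- inside light-cone convergence
          (∀ ν ∈ Set.Ioo (-1 : ℝ) 1, Tendsto (fun t : ℝ =>
            ∫⁻ x in Set.Icc (ν * t - t / Real.log t ^ 2) (ν * t + t / Real.log t ^ 2),
              ENNReal.ofReal (coneDensity (solitonB θ σ μ lam ε) z s t x)) atTop (𝓝 0)) ∧
          -- exterior stability
          (∀ R : ℝ, 0 < R → tsupport (deriv θ) ∪ tsupport (deriv σ) ⊆ Set.Ioo (-R) R →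
            ∀ t : ℝ, 0 ≤ t → ∫⁻ x in {x : ℝ | R ≤ |x + t|},
              ENNReal.ofReal (energyDensity (solitonB θ σ μ lam ε) z s t x)
                < ENNReal.ofReal δ)) ∧
    -- (2) Full orbital stability
    (∃ ε₀ : ℝ, 0 < ε₀ ∧ ∀ ε : ℝ, 0 < ε → ε < ε₀ →
      ∃ C δ₀ : ℝ, 0 < C ∧ 0 < δ₀ ∧ ∀ δ : ℝ, 0 < δ → δ < δ₀ →
      ∀ η : ℝ, 0 < η → η < 1 / 3 →
      ∀ z₀ w₀ s₀ m₀ : ℝ → ℝ, IsProfile z₀ w₀ s₀ m₀ →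
      profileSize η z₀ w₀ s₀ m₀ < ENNReal.ofReal (δ ^ 2) →
      ∃ Λ φ : ℝ → ℝ → ℝ,
        IsTheSolution (solitonB θ σ μ lam ε) (solitonD θ σ μ lam ε) ε z₀ w₀ s₀ m₀ Λ φ ∧
        ∀ z s : ℝ → ℝ → ℝ, (∀ t x, z t x = Λ t x - solitonB θ σ μ lam ε t x) →
          (∀ t x, s t x = φ t x - solitonD θ σ μ lam ε t x) →
          ∀ t : ℝ, 0 ≤ t → nullEnergy η z t + nullEnergy η s t ≤ ENNReal.ofReal (C * δ ^ 2)) := by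
  constructor
  · intro M _
    obtain ⟨ε₀, hε₀, H⟩ := external_energetic_control θ σ μ lam hθ hθc hσ hσc hμ hμ1 M
    refine ⟨ε₀, hε₀, fun ε hε hεlt => ?_⟩
    obtain ⟨δ₀, hδ₀, H⟩ := H ε hε hεlt
    refine ⟨δ₀, hδ₀, fun δ hδ hδlt z₀ w₀ s₀ m₀ hp hz hw hs hm hen => ?_⟩
    obtain ⟨Λ, φ, hsol, H⟩ := H δ hδ hδlt z₀ w₀ s₀ m₀ hp hz hw hs hm hen
    refine ⟨Λ, φ, hsol, fun z s hz' hs' => ?_⟩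
    obtain ⟨g, cg, g0, gi, gδ, hg⟩ := H z s hz' hs'
    refine ⟨fun t => ?_, fun ν hν => tendsto_lintegral_cone cg gi (fun t x => (hg t x).2.1) hν,
      fun R _ _ t _ => ?_⟩
    · exact (lintegral_ofReal_le_of_null cg g0 gi fun x => (hg t x).1).trans_lt
        ((ENNReal.ofReal_lt_ofReal_iff (by linarith)).2 (by linarith))
    · exact (setLIntegral_le_lintegral _ _).trans_lt
        ((lintegral_ofReal_le_of_null cg g0 gi fun x => (hg t x).2.2).trans_lt
          ((ENNReal.ofReal_lt_ofReal_iff hδ).2 gδ))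
  · obtain ⟨ε₀, hε₀, H⟩ := full_orbital_stability θ σ μ lam hθ hθc hσ hσc hμ hμ1
    refine ⟨ε₀, hε₀, fun ε hε hεlt => ?_⟩
    obtain ⟨C, δ₀, hC, hδ₀, H⟩ := H ε hε hεlt
    refine ⟨C, δ₀, hC, hδ₀, fun δ hδ hδlt η hη hη3 z₀ w₀ s₀ m₀ hp hsize => ?_⟩
    obtain ⟨Λ, φ, hsol, H⟩ := H δ hδ hδlt η hη hη3 z₀ w₀ s₀ m₀ hp hsize
    exact ⟨Λ, φ, hsol, fun z s hz' hs' t _ => H z s hz' hs' t⟩
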